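/- Let qubits be labelled by $(i,j)$, $1\le i\le n$, $j\in\mathbb Z$ (qubit $i$ of block $j$). Let $\mathcal P$ be the group of all finitely supported Pauli operators $i^c X_{\alpha}Z_{\beta}$ on these qubits, so that, up to phase, an operator is a pair of vectors $(\alpha,\beta)\in\mathbb F_2[D,D^{-1}]^n\times\mathbb F_2[D,D^{-1}]^n$ and multiplication by $D$ is the shift by one block. A *quantum convolutional code with frames of $p$ blocks* is the set of all states of the qubit stream that are fixed by a stabilizer group $S\subset\mathcal P$, where $S$ is abelian, contains no scalar other than $1$, and is generated by finitely many operators together with all their shifts by multiples of $p$ blocks. Its asymptotic rate is $\lim_{N\to\infty}\frac{nN-\log_2|S_N|}{nN}$, where $S_N$ is the group of those elements of $S$ that are supported on the blocks $0,\dots,N-1$. **Theorem.** Let $\mathcal C$ be a quantum convolutional code with frames of one block, with stabilizer group $S$. Then there are $p\ge1$, a code $\mathcal C_{\mathrm{sub}}\subseteq\mathcal C$ that is convolutional with frames of $p$ blocks and whose stabilizer group is, up to phases of its elements, invariant under the shift by any number of blocks, an integer $0\le k\le n$, and an encoder $\mathcal E$ with the following properties. 1. Inserting $n-k$ qubits in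 the state $|0\rangle$ into each block of an arbitrary input stream of $k$ qubits per block, and then applying $\mathcal E$, produces exactly the states of $\mathcal C_{\mathrm{sub}}$. 2. $\mathcal E$ and $\mathcal E^{-1}$ are non-catastrophic: each is realized by a circuit of finite depth, i.e. by finitely many layers of one- and two-qubit Clifford gates, the gates within a layer acting on disjoint sets of qubits. 3. $\mathcal E$ and $\mathcal E^{-1}$ use only shift-invariant Clifford gates: each is a finite sequence of infinitely replicated gates, every one of which is a Hadamard, phase, CNOT or CSIGN gate repeated in every block, or a Pauli $X$ gate repeated in every $p$-th block. 4. $\mathcal E$ and $\mathcal E^{-1}$ can be carried out online: for each of them there are $m\ge 0$ and one finite Clifford circuit $W$ on the blocks $0,\dots,m$ such that, for every starting time $b\in\mathbb Z$ (in frames of $p$ blocks), the operation agrees, on every operator supported on blocks with index at least $pb+m$, with the successive application of $W$ shifted by $pb,\ p(b+1),\ p(b+2),\dots$ blocks. (Thus qubits are received and sent with constant delay.) 5. The asymptotic rates of $\mathcal C$ and $\mathcal C_{\mathrm{sub}}$ exist and are equal, with common value $k/n$. -/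

import Mathlib

open scoped ComplexOrder

noncomputable section

namespace QConv

/-- The qubits of a bi-infinite stream of blocks of `n` qubits: `(i, j)` is the `i`-th qubit of
the `j`-th block. -/
abbrev Qubit (n : ℕ) := Fin n × ℤ

/-- Finitely supported binary labels of the qubits, i.e. `n`-tuples of Laurent polynomials over
`𝔽₂`: the coefficient of `D ^ j` in the `i`-th entry is the value at `(i, j)`. -/
abbrev Label (n : ℕ) := Qubit n →₀ ZMod 2

/-- The phase exponent of `(-1) ^ a`, as a power of the imaginary unit. -/
def signPhase (a : ZMod 2) : ZMod 4 := 2 * (a.val : ZMod 4)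

theorem signPhase_add (a b : ZMod 2) : signPhase (a + b) = signPhase a + signPhase b := by
  revert a b; decide

theorem signPhase_zero : signPhase 0 = 0 := by decide

theorem signPhase_add_self (a : ZMod 2) : signPhase a + signPhase a = 0 := by
  revert a; decide

/-- The number (mod 2) of common positions of two labels. -/
def dot {n : ℕ} (z x : Label n) : ZMod 2 := z.sum fun q a => a * x q

section dot
variable {n : ℕ}

theorem dot_add_left (z z' x : Label n) : dot (z + z') x = dot z x + dot z' x :=
  Finsupp.sum_add_index' (fun _ => zero_mul _) (fun _ _ _ => add_mul _ _ _)

theorem dot_add_right (z x x' : Label n) : dot z (x + x') = dot z x + dot z x' := by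
  simp [dot, Finsupp.sum, mul_add, Finset.sum_add_distrib]

theorem dot_zero_left (x : Label n) : dot 0 x = 0 := Finsupp.sum_zero_index

theorem dot_zero_right (z : Label n) : dot z 0 = 0 := by simp [dot, Finsupp.sum]

theorem dot_single_left (q : Qubit n) (a : ZMod 2) (x : Label n) :
    dot (Finsupp.single q a) x = a * x q :=
  Finsupp.sum_single_index (zero_mul _)

theorem dot_single_right (q : Qubit n) (a : ZMod 2) (z : Label n) :
    dot z (Finsupp.single q a) = z q * a := by
  classical
  rw [dot, Finsupp.sum, Finset.sum_eq_single q]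
  · simp
  · intro b _ hb
    simp [Ne.symm hb]
  · intro h
    simp [Finsupp.notMem_support_iff.mp h]

end dot

theorem label_add_self {n : ℕ} (x : Label n) : x + x = 0 := by
  ext q
  exact CharTwo.add_self_eq_zero _

/-- The infinite Pauli group: `⟨c, x, z⟩` is the finitely supported operator
`i ^ c · (⨂ X ^ (x q)) (⨂ Z ^ (z q))`. -/
@[ext]
structure Pauli (n : ℕ) where
  phase : ZMod 4
  x : Label n
  z : Label n

namespace Pauli
variable {n : ℕ}

instance : One (Pauli n) := ⟨⟨0, 0, 0⟩⟩

/-- Moving `Z ^ g.z` past `X ^ h.x` produces the sign `(-1) ^ (g.z · h.x)`. -/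
instance : Mul (Pauli n) :=
  ⟨fun g h => ⟨g.phase + h.phase + signPhase (dot g.z h.x), g.x + h.x, g.z + h.z⟩⟩

instance : Inv (Pauli n) := ⟨fun g => ⟨-g.phase + signPhase (dot g.z g.x), g.x, g.z⟩⟩

@[simp] theorem one_phase : (1 : Pauli n).phase = 0 := rfl
@[simp] theorem one_x : (1 : Pauli n).x = 0 := rfl
@[simp] theorem one_z : (1 : Pauli n).z = 0 := rfl
@[simp] theorem mul_phase (g h : Pauli n) :
    (g * h).phase = g.phase + h.phase + signPhase (dot g.z h.x) := rfl
@[simp] theorem mul_x (g h : Pauli n) : (g * h).x = g.x + h.x := rfl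
@[simp] theorem mul_z (g h : Pauli n) : (g * h).z = g.z + h.z := rfl
@[simp] theorem inv_phase (g : Pauli n) :
    (g⁻¹).phase = -g.phase + signPhase (dot g.z g.x) := rfl
@[simp] theorem inv_x (g : Pauli n) : (g⁻¹).x = g.x := rfl
@[simp] theorem inv_z (g : Pauli n) : (g⁻¹).z = g.z := rfl

instance : Group (Pauli n) :=
  Group.ofLeftAxioms
    (by
      intro a b c
      ext1
      · simp only [mul_phase, mul_z, mul_x, dot_add_left, dot_add_right, signPhase_add]
        ring
      · exact add_assoc _ _ _
      · exact add_assoc _ _ _)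
    (by
      intro a
      ext1
      · simp [dot_zero_left, signPhase_zero]
      · exact zero_add _
      · exact zero_add _)
    (by
      intro a
      ext1
      · have h := signPhase_add_self (dot a.z a.x)
        simp only [mul_phase, inv_phase, inv_z, one_phase]
        linear_combination h
      · exact label_add_self _
      · exact label_add_self _)

/-- The scalar `i ^ c`; these elements form the center. -/
def scalar (c : ZMod 4) : Pauli n := ⟨c, 0, 0⟩

/-- The Pauli matrix `X` on qubit `q`. -/
def X (q : Qubit n) : Pauli n := ⟨0, Finsupp.single q 1, 0⟩

/-- The Pauli matrix `Z` on qubit `q`. -/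
def Z (q : Qubit n) : Pauli n := ⟨0, 0, Finsupp.single q 1⟩

/-- Multiplication of all labels by `D ^ s`: the operator is moved `s` blocks later. -/
def shift (s : ℤ) (g : Pauli n) : Pauli n :=
  ⟨g.phase,
    Finsupp.equivMapDomain ((Equiv.refl (Fin n)).prodCongr (Equiv.addRight s)) g.x,
    Finsupp.equivMapDomain ((Equiv.refl (Fin n)).prodCongr (Equiv.addRight s)) g.z⟩

/-- The operator acts as the identity on every qubit whose block is not in `B`. -/
def SupportedOn (g : Pauli n) (B : Set ℤ) : Prop :=
  ∀ q : Qubit n, g.x q ≠ 0 ∨ g.z q ≠ 0 → q.2 ∈ B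

end Pauli

/-! ### Codes -/

/-- `S` is the stabilizer group of a quantum convolutional code with frames of `p` blocks (that is,
of `p * n` qubits): it is abelian, meets the center trivially, and is generated by finitely many
operators together with all their versions shifted by whole frames. -/
structure IsConvolutional {n : ℕ} (p : ℕ) (S : Subgroup (Pauli n)) : Prop where
  comm : ∀ g ∈ S, ∀ h ∈ S, g * h = h * g
  center : ∀ c : ZMod 4, Pauli.scalar c ∈ S → c = 0
  generated : ∃ G : Finset (Pauli n),
    S = Subgroup.closure {h | ∃ g ∈ G, ∃ j : ℤ, h = Pauli.shift (p * j) g}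

/-- States of the infinite stream of qubits, given by the expectation values of the Pauli
operators: normalized positive functionals on the `*`-algebra spanned by the Pauli group. -/
structure IsState {n : ℕ} (ω : Pauli n → ℂ) : Prop where
  one : ω 1 = 1
  scalar : ∀ (c : ZMod 4) (g : Pauli n), ω (Pauli.scalar c * g) = Complex.I ^ c.val * ω g
  nonneg : ∀ (s : Finset (Pauli n)) (a : Pauli n → ℂ),
    0 ≤ ∑ g ∈ s, ∑ h ∈ s, star (a g) * a h * ω (g⁻¹ * h)

/-- The code with stabilizer group `S`: all states fixed by `S`. -/
def codeSpace {n : ℕ} (S : Subgroup (Pauli n)) : Set (Pauli n → ℂ) :=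
  {ω | IsState ω ∧ ∀ g ∈ S, ω g = 1}

/-- The elements of `S` that are supported on the `N` blocks `0, …, N - 1`. -/
def window {n : ℕ} (S : Subgroup (Pauli n)) (N : ℕ) : Set (Pauli n) :=
  {g | g ∈ S ∧ g.SupportedOn (Set.Ico 0 (N : ℤ))}

/-- The code cut off to `N` blocks has `2 ^ (n * N) / |window S N|` dimensions, so it encodes
`n * N - log₂ |window S N|` qubits into `n * N` qubits. The asymptotic rate is the limit of the
quotient. -/
def HasRate {n : ℕ} (S : Subgroup (Pauli n)) (ρ : ℝ) : Prop :=
  Filter.Tendsto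
    (fun N : ℕ => ((n : ℝ) * N - Real.logb 2 (Nat.card (window S N))) / ((n : ℝ) * N))
    Filter.atTop (nhds ρ)

/-! ### Gates -/

/-- Clifford gates on one or two qubits. -/
inductive Gate (n : ℕ)
  | hadamard (q : Qubit n)
  | phase (q : Qubit n)
  | cnot (c t : Qubit n) (h : c ≠ t)
  | csign (a b : Qubit n) (h : a ≠ b)
  | pauliX (q : Qubit n)

namespace Gate
variable {n : ℕ}

/-- The qubits on which a gate acts. -/
def support : Gate n → Set (Qubit n)
  | hadamard q => {q}
  | phase q => {q}
  | cnot c t _ => {c, t}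
  | csign a b _ => {a, b}
  | pauliX q => {q}

/-- The same gate, `s` blocks later. -/
def shift (s : ℤ) : Gate n → Gate n
  | hadamard q => hadamard (q.1, q.2 + s)
  | phase q => phase (q.1, q.2 + s)
  | cnot c t h => cnot (c.1, c.2 + s) (t.1, t.2 + s) (by
      intro e
      simp only [Prod.mk.injEq, add_left_inj] at e
      exact h (Prod.ext e.1 e.2))
  | csign a b h => csign (a.1, a.2 + s) (b.1, b.2 + s) (by
      intro e
      simp only [Prod.mk.injEq, add_left_inj] at e
      exact h (Prod.ext e.1 e.2))
  | pauliX q => pauliX (q.1, q.2 + s)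

/-- The conjugation `g ↦ U g U†` of a Pauli operator by the gate `U`. -/
def conj : Gate n → Pauli n → Pauli n
  | hadamard q, g =>
      ⟨g.phase + signPhase (g.x q * g.z q),
        g.x + Finsupp.single q (g.x q + g.z q), g.z + Finsupp.single q (g.x q + g.z q)⟩
  | phase q, g => ⟨g.phase + ((g.x q).val : ZMod 4), g.x, g.z + Finsupp.single q (g.x q)⟩
  | cnot c t _, g =>
      ⟨g.phase, g.x + Finsupp.single t (g.x c), g.z + Finsupp.single c (g.z t)⟩
  | csign a b _, g =>
      ⟨g.phase + signPhase (g.x a * g.x b), g.x,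
        g.z + (Finsupp.single b (g.x a) + Finsupp.single a (g.x b))⟩
  | pauliX q, g => ⟨g.phase + signPhase (g.z q), g.x, g.z⟩

theorem conj_mul (γ : Gate n) (g h : Pauli n) : γ.conj (g * h) = γ.conj g * γ.conj h := by
  cases γ with
  | hadamard q =>
    ext1
    · simp only [conj, Pauli.mul_phase, Pauli.mul_x, Pauli.mul_z, dot_add_left, dot_add_right,
        dot_single_left, dot_single_right, Finsupp.add_apply, Finsupp.single_eq_same,
        signPhase_add]
      generalize g.x q = a, g.z q = b, h.x q = c, h.z q = d
      generalize signPhase (dot g.z h.x) = e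
      have key : ∀ a b c d : ZMod 2, signPhase ((a + c) * (b + d)) = signPhase (a * b)
          + signPhase (c * d) + (signPhase ((a + b) * c)
          + signPhase ((b + (a + b)) * (c + d))) := by decide
      rw [key]; ring
    · simp only [conj, Pauli.mul_x, Pauli.mul_z, Finsupp.add_apply, Finsupp.single_add]; abel
    · simp only [conj, Pauli.mul_x, Pauli.mul_z, Finsupp.add_apply, Finsupp.single_add]; abel
  | phase q =>
    ext1
    · simp only [conj, Pauli.mul_phase, Pauli.mul_x, dot_add_left,
        dot_single_left, Finsupp.add_apply, signPhase_add]
      generalize g.x q = a, h.x q = c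
      have key : ∀ a c : ZMod 2, (((a + c).val : ℕ) : ZMod 4) = (a.val : ZMod 4) + (c.val : ZMod 4)
          + signPhase (a * c) := by decide
      rw [key]; ring
    · rfl
    · simp only [conj, Pauli.mul_x, Pauli.mul_z, Finsupp.add_apply, Finsupp.single_add]; abel
  | cnot c t hct =>
    ext1
    · simp only [conj, Pauli.mul_phase, dot_add_left, dot_add_right,
        dot_single_left, dot_single_right, Finsupp.add_apply,
        Finsupp.single_eq_of_ne hct.symm, signPhase_add, add_zero]
      linear_combination -signPhase_add_self (g.z t * h.x c)
    · simp only [conj, Pauli.mul_x, Finsupp.add_apply, Finsupp.single_add]; abel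
    · simp only [conj, Pauli.mul_z, Finsupp.add_apply, Finsupp.single_add]; abel
  | csign a b hab =>
    ext1
    · simp only [conj, Pauli.mul_phase, Pauli.mul_x, dot_add_left,
        dot_single_left, Finsupp.add_apply, signPhase_add]
      generalize g.x a = a1, g.x b = b1, h.x a = a2, h.x b = b2
      have key : ∀ a1 b1 a2 b2 : ZMod 2, signPhase ((a1 + a2) * (b1 + b2)) = signPhase (a1 * b1)
          + signPhase (a2 * b2) + (signPhase (a1 * b2) + signPhase (b1 * a2)) := by decide
      rw [key]; ring
    · rfl
    · simp only [conj, Pauli.mul_x, Pauli.mul_z, Finsupp.add_apply, Finsupp.single_add]; abel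
  | pauliX q =>
    ext1
    · simp only [conj, Pauli.mul_phase, Pauli.mul_z, Finsupp.add_apply, signPhase_add]
      ring
    · rfl
    · rfl

theorem conj_conj_conj_conj (γ : Gate n) (g : Pauli n) :
    γ.conj (γ.conj (γ.conj (γ.conj g))) = g := by
  have h2 : ∀ (q : Qubit n) (a : ZMod 2), Finsupp.single q a + Finsupp.single q a = 0 :=
    fun q a => label_add_self _
  cases γ with
  | hadamard q =>
    have key : ∀ g : Pauli n, (hadamard q).conj ((hadamard q).conj g) = g := by
      intro g
      have ha : ∀ a b : ZMod 2, a + (a + b) = b := by decide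
      have hb : ∀ a b : ZMod 2, b + (a + b) = a := by decide
      ext1
      · simp only [conj, Finsupp.add_apply, Finsupp.single_eq_same, ha, hb]
        rw [mul_comm (g.z q), add_assoc, signPhase_add_self, add_zero]
      · simp only [conj, Finsupp.add_apply, Finsupp.single_eq_same, ha, hb]
        rw [add_comm (g.z q), add_assoc, h2, add_zero]
      · simp only [conj, Finsupp.add_apply, Finsupp.single_eq_same, ha, hb]
        rw [add_comm (g.z q), add_assoc, h2, add_zero]
    rw [key, key]
  | phase q =>
    have h4 : ∀ a : ZMod 2, ((a.val : ZMod 4) + a.val) + ((a.val : ZMod 4) + a.val) = 0 := by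
      decide
    ext1
    · simp only [conj]
      linear_combination h4 (g.x q)
    · rfl
    · simp only [conj]
      rw [add_assoc _ (Finsupp.single q _) (Finsupp.single q _), h2, add_zero, add_assoc, h2,
        add_zero]
  | cnot c t hct =>
    have key : ∀ g : Pauli n, (cnot c t hct).conj ((cnot c t hct).conj g) = g := by
      intro g
      ext1
      · rfl
      · simp only [conj, Finsupp.add_apply, Finsupp.single_eq_of_ne hct, add_zero]
        rw [add_assoc, h2, add_zero]
      · simp only [conj, Finsupp.add_apply, Finsupp.single_eq_of_ne hct.symm, add_zero]
        rw [add_assoc, h2, add_zero]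
    rw [key, key]
  | csign a b hab =>
    have key : ∀ g : Pauli n, (csign a b hab).conj ((csign a b hab).conj g) = g := by
      intro g
      ext1
      · simp only [conj]
        rw [add_assoc, signPhase_add_self, add_zero]
      · rfl
      · simp only [conj]
        rw [add_assoc, label_add_self, add_zero]
    rw [key, key]
  | pauliX q =>
    have key : ∀ g : Pauli n, (pauliX q).conj ((pauliX q).conj g) = g := by
      intro g
      ext1
      · simp only [conj]
        rw [add_assoc, signPhase_add_self, add_zero]
      · rfl
      · rfl
    rw [key, key]

/-- The automorphism of the Pauli group given by conjugation with a gate. -/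
def act (γ : Gate n) : MulAut (Pauli n) where
  toFun := γ.conj
  invFun g := γ.conj (γ.conj (γ.conj g))
  left_inv := γ.conj_conj_conj_conj
  right_inv := γ.conj_conj_conj_conj
  map_mul' := γ.conj_mul

end Gate

/-! ### Circuits -/

/-- Conjugation by a finite circuit; the head of the list is applied first. -/
def circuit {n : ℕ} (W : List (Gate n)) : MulAut (Pauli n) :=
  (W.reverse.map Gate.act).prod

/-- `f (a + N - 1) ∘ ⋯ ∘ f (a + 1) ∘ f a`. -/
def cascade {n : ℕ} (f : ℤ → MulAut (Pauli n)) (a : ℤ) (N : ℕ) : MulAut (Pauli n) :=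
  ((List.range N).reverse.map fun s : ℕ => f (a + s)).prod

/-- `α` is the infinite cascade that applies the gate `γ` and all its versions shifted by multiples
of `p` blocks. -/
def IsReplicated {n : ℕ} (p : ℕ) (γ : Gate n) (α : MulAut (Pauli n)) : Prop :=
  ∀ g : Pauli n, ∃ M₀ : ℕ, ∀ M ≥ M₀,
    cascade (fun s => (γ.shift (p * s)).act) (-(M : ℤ)) (2 * M + 1) g = α g

/-- `E` is a finite sequence of replicated gates, each of which is either a Hadamard, phase, CNOT or
CSIGN gate repeated in every block, or a Pauli `X` gate repeated in every `p`-th block. -/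
def IsShiftInvariantClifford {n : ℕ} (p : ℕ) (E : MulAut (Pauli n)) : Prop :=
  ∃ L : List (MulAut (Pauli n)), E = L.prod ∧ ∀ α ∈ L,
    (∃ γ : Gate n, (∀ q, γ ≠ Gate.pauliX q) ∧ IsReplicated 1 γ α) ∨
    (∃ q : Qubit n, IsReplicated p (Gate.pauliX q) α)

/-- `α` is the simultaneous application of a (possibly infinite) set `Γ` of gates which act on
pairwise disjoint sets of qubits. -/
def IsLayer {n : ℕ} (Γ : Set (Gate n)) (α : MulAut (Pauli n)) : Prop :=
  (Γ.PairwiseDisjoint Gate.support) ∧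
  (∀ c : ZMod 4, α (Pauli.scalar c) = Pauli.scalar c) ∧
  (∀ γ ∈ Γ, ∀ q ∈ γ.support,
    α (Pauli.X q) = γ.act (Pauli.X q) ∧ α (Pauli.Z q) = γ.act (Pauli.Z q)) ∧
  (∀ q : Qubit n, (∀ γ ∈ Γ, q ∉ γ.support) →
    α (Pauli.X q) = Pauli.X q ∧ α (Pauli.Z q) = Pauli.Z q)

/-- `E` is realized by a circuit of finite depth: a finite sequence of layers. -/
def IsNonCatastrophic {n : ℕ} (E : MulAut (Pauli n)) : Prop :=
  ∃ L : List (MulAut (Pauli n)), E = L.prod ∧ ∀ α ∈ L, ∃ Γ : Set (Gate n), IsLayer Γ α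

/-- `E` can be carried out online with constant delay and memory: there is one finite circuit `W` on
the blocks `0, …, m` such that, for a stream starting at any time `b`, `E` is the result of applying
`W` successively, shifted by `b, b + 1, b + 2, …` frames of `p` blocks. After its step number `s`
the blocks up to `p * (s + 1) - 1` are not touched any more and can be sent, and this step needs only
the blocks up to `p * s + m`. The first `m` blocks of the stream are a preamble. -/
def IsOnline {n : ℕ} (p : ℕ) (E : MulAut (Pauli n)) : Prop :=
  ∃ (m : ℕ) (W : List (Gate n)),
    (∀ γ ∈ W, ∀ q ∈ γ.support, q.2 ∈ Set.Icc (0 : ℤ) m) ∧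
    ∀ (b : ℤ) (g : Pauli n), g.SupportedOn (Set.Ici (p * b + m)) →
      ∃ N₀ : ℕ, ∀ N ≥ N₀,
        cascade (fun s => circuit (W.map (Gate.shift (p * s)))) b N g = E g

/-! ### Encoding -/

/-- The part of a label on the streams selected by `e`. -/
def restrictLabel {n k : ℕ} (e : Fin k ↪ Fin n) (x : Label n) : Label k :=
  Finsupp.comapDomain (Prod.map e id) x
    (Function.Injective.injOn (e.injective.prodMap Function.injective_id))

open Classical in
/-- The state of the stream of blocks of `n` qubits in which the qubits `e 0, …, e (k - 1)` of the
blocks carry the state `φ` and every other qubit is in the state `|0⟩`. -/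
def insertZeros {n k : ℕ} (e : Fin k ↪ Fin n) (φ : Pauli k → ℂ) : Pauli n → ℂ := fun g =>
  if ∀ q : Qubit n, q.1 ∉ Set.range e → g.x q = 0 then
    φ ⟨g.phase, restrictLabel e g.x, restrictLabel e g.z⟩
  else 0

/-- The state obtained from `ω` by applying the unitary circuit with conjugation action `E`. -/
def applyToState {n : ℕ} (E : MulAut (Pauli n)) (ω : Pauli n → ℂ) : Pauli n → ℂ :=
  fun g => ω (E⁻¹ g)

/-- `E` is an encoder for the code with stabilizer group `S`: inserting qubits in the state `|0⟩`
into an arbitrary input stream of `k` qubits per block and applying `E` yields exactly the states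
of the code. -/
def IsEncoder {n k : ℕ} (e : Fin k ↪ Fin n) (E : MulAut (Pauli n)) (S : Subgroup (Pauli n)) :
    Prop :=
  codeSpace S = {ω | ∃ φ : Pauli k → ℂ, IsState φ ∧ ω = applyToState E (insertZeros e φ)}

end QConv

end

noncomputable section

namespace QConv

variable {n : ℕ}

/-! ### Labels, shifts and supports -/

/-! Up to phases, conjugation by replicated Clifford gates is a symplectic row operation over the
Laurent polynomials `𝔽₂[D, D⁻¹]`: a CNOT adds `D ^ k` times the X row of one stream to that of
another, a Hadamard exchanges the X and Z rows of a stream, CSIGN and phase gates add multiples of X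
rows to Z rows. The ring is Euclidean, with the distance between the extreme nonzero coefficients as
size. Among all nonzero X rows that such operations can produce from one stabilizer element, take
one of least size; division by it leaves no remainder, so it clears the rows of the other streams.
On its own stream only symmetric multiples of the X row can be added to the Z row. These suffice,
because commutation with all shifts forces both rows to have the same centre (`centre_eq`), so one
symmetric move removes both ends of the Z row. A Hadamard then leaves Z labels on a single stream
(`exists_normal_form`).

Whatever commutes with all shifts of this element has no X label on that stream, so the remaining
streams can be treated without disturbing the finished ones. By induction (`exists_isZOn`) an
automorphism `E₀` takes `S` to signed products of `Z` on a set `J` of streams. Each pivot row has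
finite size, so division leaves remainders in a fixed window: the labels obtained have finite index
among all Z labels on `J`.

This finite index is what the rest depends on. The image of `S` need not contain every `Z` on `J`,
up to sign; the subcode arises by adjoining the missing ones. The signs of the image form a
character of its labels, which extends to a character `χ` of all labels (`exists_sign_character`).
The phases of a shift-invariant group do not change under shifts, so `χ` is determined by its values
on a window, and the pigeonhole principle makes it periodic (`exists_period`). A periodic sign
change is a finite product of replicated Pauli `X` gates (`good_flip`). With `E = E₀⁻¹ * flip χ`,
the group `T = E (zGroup J)` contains `S`, and its states are the encoded ones
(`isEncoder_map_zGroup`). Since `E` and `E⁻¹` move supports by a bounded amount, a window of `N`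
blocks of `T` has `2 ^ (|J| N + O(1))` elements; the one of `S` is smaller by at most a constant
factor (`exists_card_window_le_mul`).

The circuit properties are collected in `Good`, which is closed under products. Inverses need no
separate treatment: every gate has order dividing four (`IsLim.inv_eq`), and sign changes are
involutions. -/

theorem signPhase_injective : Function.Injective signPhase := by
  intro a b; revert a b; decide

/-- The label moved by `s` blocks. -/
def shiftLabel (s : ℤ) (x : Label n) : Label n :=
  Finsupp.equivMapDomain ((Equiv.refl (Fin n)).prodCongr (Equiv.addRight s)) x

@[simp] theorem shiftLabel_apply (s : ℤ) (x : Label n) (q : Qubit n) :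
    shiftLabel s x q = x (q.1, q.2 - s) := by
  rw [shiftLabel, Finsupp.equivMapDomain_apply, sub_eq_add_neg]
  rfl

theorem shiftLabel_add (s : ℤ) (x y : Label n) :
    shiftLabel s (x + y) = shiftLabel s x + shiftLabel s y := by
  ext q; simp

theorem shiftLabel_zero (s : ℤ) : shiftLabel s (0 : Label n) = 0 := by
  ext q; simp

theorem shiftLabel_single (s : ℤ) (q : Qubit n) (a : ZMod 2) :
    shiftLabel s (Finsupp.single q a) = Finsupp.single (q.1, q.2 + s) a := by
  rw [shiftLabel, Finsupp.equivMapDomain_single]; rfl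

theorem shiftLabel_shiftLabel (s t : ℤ) (x : Label n) :
    shiftLabel s (shiftLabel t x) = shiftLabel (s + t) x := by
  ext q; simp [sub_sub]

theorem dot_shiftLabel (s : ℤ) (z x : Label n) :
    dot (shiftLabel s z) (shiftLabel s x) = dot z x := by
  induction z using Finsupp.induction_linear with
  | zero => rw [shiftLabel_zero, dot_zero_left, dot_zero_left]
  | add f g hf hg => rw [shiftLabel_add, dot_add_left, dot_add_left, hf, hg]
  | single q a => simp [shiftLabel_single, dot_single_left]

namespace Pauli

@[simp] theorem shift_phase (s : ℤ) (g : Pauli n) : (shift s g).phase = g.phase := rfl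
theorem shift_x' (s : ℤ) (g : Pauli n) : (shift s g).x = shiftLabel s g.x := rfl
theorem shift_z' (s : ℤ) (g : Pauli n) : (shift s g).z = shiftLabel s g.z := rfl
@[simp] theorem shift_x (s : ℤ) (g : Pauli n) (q : Qubit n) :
    (shift s g).x q = g.x (q.1, q.2 - s) := shiftLabel_apply s g.x q
@[simp] theorem shift_z (s : ℤ) (g : Pauli n) (q : Qubit n) :
    (shift s g).z q = g.z (q.1, q.2 - s) := shiftLabel_apply s g.z q

theorem shift_mul (s : ℤ) (g h : Pauli n) : shift s (g * h) = shift s g * shift s h := by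
  ext1
  · simp only [mul_phase, shift_phase, shift_x', shift_z', dot_shiftLabel]
  · exact shiftLabel_add ..
  · exact shiftLabel_add ..

theorem shift_shift (s t : ℤ) (g : Pauli n) : shift s (shift t g) = shift (s + t) g := by
  ext1
  · rfl
  · exact shiftLabel_shiftLabel ..
  · exact shiftLabel_shiftLabel ..

theorem shift_scalar (s : ℤ) (c : ZMod 4) : shift s (scalar c : Pauli n) = scalar c := by
  ext1
  · rfl
  · exact shiftLabel_zero _
  · exact shiftLabel_zero _

theorem shift_one (s : ℤ) : shift s (1 : Pauli n) = 1 := shift_scalar s 0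

/-- The shift as a group homomorphism. -/
def shiftHom (s : ℤ) : Pauli n →* Pauli n where
  toFun := shift s
  map_one' := shift_one s
  map_mul' := shift_mul s

theorem scalar_mul (c : ZMod 4) (g : Pauli n) : scalar c * g = ⟨c + g.phase, g.x, g.z⟩ := by
  ext1
  · simp [scalar, dot_zero_left, signPhase_zero]
  · simp [scalar]
  · simp [scalar]

theorem commute_iff (g h : Pauli n) : g * h = h * g ↔ dot g.z h.x = dot h.z g.x := by
  constructor
  · intro e
    have := congrArg phase e
    rw [mul_phase, mul_phase] at this
    apply signPhase_injective
    linear_combination this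
  · intro e
    ext1
    · simp only [mul_phase, e]; ring
    · exact add_comm _ _
    · exact add_comm _ _

/-- The Pauli operator acts nontrivially on the qubit `q`. -/
def Touches (g : Pauli n) (q : Qubit n) : Prop := g.x q ≠ 0 ∨ g.z q ≠ 0

theorem not_touches {g : Pauli n} {q : Qubit n} : ¬ g.Touches q ↔ g.x q = 0 ∧ g.z q = 0 := by
  simp [Touches]

theorem exists_bound (g : Pauli n) : ∃ L : ℕ, ∀ q, g.Touches q → |q.2| ≤ L := by
  classical
  refine ⟨(g.x.support ∪ g.z.support).sup fun q => q.2.natAbs, fun q hq => ?_⟩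
  have h : q ∈ g.x.support ∪ g.z.support := by
    simpa [Touches] using hq
  rw [Int.abs_eq_natAbs]
  exact_mod_cast Finset.le_sup (f := fun q : Qubit n => q.2.natAbs) h

end Pauli

namespace Gate

theorem conj_of_not_touches (γ : Gate n) (g : Pauli n) (h : ∀ q ∈ γ.support, ¬ g.Touches q) :
    γ.conj g = g := by
  simp only [Pauli.not_touches] at h
  cases γ with
  | hadamard q =>
    obtain ⟨h1, h2⟩ := h q (by simp [support])
    ext1 <;> simp [conj, h1, h2, signPhase_zero]
  | phase q =>
    obtain ⟨h1, h2⟩ := h q (by simp [support])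
    ext1 <;> simp [conj, h1]
  | cnot c t hct =>
    obtain ⟨h1, h2⟩ := h c (by simp [support])
    obtain ⟨h3, h4⟩ := h t (by simp [support])
    ext1 <;> simp [conj, h1, h4]
  | csign a b hab =>
    obtain ⟨h1, h2⟩ := h a (by simp [support])
    obtain ⟨h3, h4⟩ := h b (by simp [support])
    ext1 <;> simp [conj, h1, h3, signPhase_zero]
  | pauliX q =>
    obtain ⟨h1, h2⟩ := h q (by simp [support])
    ext1 <;> simp [conj, h2, signPhase_zero]

theorem conj_scalar (γ : Gate n) (c : ZMod 4) : γ.conj (Pauli.scalar c) = Pauli.scalar c :=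
  γ.conj_of_not_touches _ fun q _ => by simp [Pauli.Touches, Pauli.scalar]

theorem conj_shift (γ : Gate n) (s : ℤ) (g : Pauli n) :
    (γ.shift s).conj (Pauli.shift s g) = Pauli.shift s (γ.conj g) := by
  cases γ <;> ext1 <;>
    simp [conj, shift, Pauli.shift_x', Pauli.shift_z', shiftLabel_add, shiftLabel_single]

theorem shift_shift (γ : Gate n) (s t : ℤ) : (γ.shift s).shift t = γ.shift (s + t) := by
  cases γ <;> simp [shift, add_assoc]

theorem mem_support_shift (γ : Gate n) (s : ℤ) (q : Qubit n) :
    q ∈ (γ.shift s).support ↔ (q.1, q.2 - s) ∈ γ.support := by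
  obtain ⟨i, t⟩ := q
  cases γ <;> simp [shift, support, Prod.ext_iff, sub_eq_iff_eq_add]

theorem act_pow_four (γ : Gate n) : γ.act ^ 4 = 1 := by
  ext1 g
  exact γ.conj_conj_conj_conj g

end Gate

theorem touches_X {q q' : Qubit n} (h : (Pauli.X q).Touches q') : q' = q := by
  by_contra hne
  exact h.elim (fun h => h (by simp [Pauli.X, hne]))
    (fun h => h rfl)

theorem touches_Z {q q' : Qubit n} (h : (Pauli.Z q).Touches q') : q' = q := by
  by_contra hne
  exact h.elim (fun h => h rfl)
    (fun h => h (by simp [Pauli.Z, hne]))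

/-! ### Cascades of commuting automorphisms -/

theorem cascade_zero (f : ℤ → MulAut (Pauli n)) (a : ℤ) : cascade f a 0 = 1 := rfl

theorem cascade_succ (f : ℤ → MulAut (Pauli n)) (a : ℤ) (N : ℕ) :
    cascade f a (N + 1) = f (a + N) * cascade f a N := by
  simp [cascade, List.range_succ]

theorem cascade_add (f : ℤ → MulAut (Pauli n)) (a : ℤ) (M N : ℕ) :
    cascade f a (M + N) = cascade f (a + M) N * cascade f a M := by
  induction N with
  | zero => simp [cascade_zero]
  | succ N ih =>
    rw [← add_assoc, cascade_succ, ih, cascade_succ, mul_assoc]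
    push_cast
    rw [add_assoc]

theorem cascade_apply_of_fixed (f : ℤ → MulAut (Pauli n)) (a : ℤ) (N : ℕ) (g : Pauli n)
    (h : ∀ t, a ≤ t → t < a + N → f t g = g) : cascade f a N g = g := by
  induction N with
  | zero => rfl
  | succ N ih =>
    rw [cascade_succ, MulAut.mul_apply, ih fun t h1 h2 => h t h1 (by push_cast; omega)]
    exact h _ (by omega) (by push_cast; omega)

theorem cascade_commute_of {f : ℤ → MulAut (Pauli n)} {A : MulAut (Pauli n)} (a : ℤ) (N : ℕ)
    (h : ∀ t, a ≤ t → t < a + N → Commute A (f t)) : Commute A (cascade f a N) := by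
  induction N with
  | zero => exact Commute.one_right _
  | succ N ih =>
    rw [cascade_succ]
    exact (h _ (by omega) (by push_cast; omega)).mul_right
      (ih fun t h1 h2 => h t h1 (by push_cast; omega))

theorem cascade_commute {f g : ℤ → MulAut (Pauli n)} (a b : ℤ) (M N : ℕ)
    (h : ∀ s t, Commute (f s) (g t)) : Commute (cascade f a M) (cascade g b N) :=
  cascade_commute_of _ _ fun t _ _ =>
    (cascade_commute_of _ _ fun s _ _ => (h s t).symm).symm

/-- Only factors `f s` that precede `g t` in time have to be interchanged with it. This one-sided
form permits the pipelining of two online circuits in `IsOnline.mul`, where `f t` and `g t`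
themselves may overlap. -/
theorem cascade_mul {f g : ℤ → MulAut (Pauli n)} (h : ∀ s t, s < t → Commute (f s) (g t)) (a : ℤ)
    (N : ℕ) : cascade (fun t => f t * g t) a N = cascade f a N * cascade g a N := by
  induction N with
  | zero => rfl
  | succ N ih =>
    rw [cascade_succ, cascade_succ, cascade_succ, ih]
    have : Commute (g (a + N)) (cascade f a N) :=
      cascade_commute_of _ _ fun t _ ht => (h _ _ ht).symm
    simp only [mul_assoc]
    rw [← mul_assoc (g _), this.eq, mul_assoc]

/-- The factors before `A` fix `g`. Those from `B` on are applied last, but commute past the middle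
block and then act on `g` itself, which they fix too. -/
theorem cascade_eq_of_fixed {f : ℤ → MulAut (Pauli n)} (hc : ∀ s t, Commute (f s) (f t))
    {A B : ℤ} {g : Pauli n} (hfix : ∀ t, (t < A ∨ B ≤ t) → f t g = g) (hAB : A ≤ B)
    {a : ℤ} {N : ℕ} (ha : a ≤ A) (hb : B ≤ a + N) :
    cascade f a N g = cascade f A (B - A).toNat g := by
  obtain ⟨u, hu⟩ : ∃ u : ℕ, A = a + u := ⟨(A - a).toNat, by omega⟩
  obtain ⟨v, hv⟩ : ∃ v : ℕ, B = A + v := ⟨(B - A).toNat, by omega⟩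
  obtain ⟨w, hw⟩ : ∃ w : ℕ, N = u + (v + w) := ⟨(a + N - B).toNat, by omega⟩
  have hv' : (B - A).toNat = v := by omega
  rw [hv', hw, cascade_add, ← hu, cascade_add, ← hv, MulAut.mul_apply,
    cascade_apply_of_fixed f a u g fun t _ h => hfix t (Or.inl (by omega)),
    (cascade_commute _ _ _ _ hc).eq, MulAut.mul_apply,
    cascade_apply_of_fixed f B w g fun t h _ => hfix t (Or.inr h)]

/-! ### Infinite products of commuting automorphisms -/

/-- `α` is the infinite cascade of the automorphisms `f t`. -/
def IsLim (f : ℤ → MulAut (Pauli n)) (α : MulAut (Pauli n)) : Prop :=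
  ∀ g, ∃ M : ℕ, ∀ (a : ℤ) (N : ℕ), a ≤ -M → (M : ℤ) ≤ a + N → cascade f a N g = α g

/-- Only finitely many of the automorphisms `f t` move any given operator. -/
def LocallyFinite (f : ℤ → MulAut (Pauli n)) : Prop :=
  ∀ g, ∃ M : ℕ, ∀ t : ℤ, (t < -M ∨ (M : ℤ) ≤ t) → f t g = g

/-- On each operator the finite cascades become stationary. Any two operators and their product are
evaluated by one common finite cascade, so multiplicativity and injectivity are inherited from
finite cascades. -/
theorem exists_isLim {f : ℤ → MulAut (Pauli n)} (hc : ∀ s t, Commute (f s) (f t))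
    (hf : LocallyFinite f) : ∃ α, IsLim f α := by
  choose M hM using hf
  let F : Pauli n → Pauli n := fun g => cascade f (-(M g)) (2 * M g) g
  have hF : ∀ g (A B a : ℤ) (N : ℕ), (∀ t, (t < A ∨ B ≤ t) → f t g = g) → A ≤ B →
      a ≤ A → B ≤ a + N → cascade f a N g = F g := by
    intro g A B a N h hAB ha hb
    have h1 := cascade_eq_of_fixed hc h hAB (a := min a (-(M g))) (N := N + (2 * a.natAbs + 3 * M g))
      (by omega) (by omega)
    have h2 := cascade_eq_of_fixed hc (hM g) (by omega) (a := min a (-(M g)))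
      (N := N + (2 * a.natAbs + 3 * M g)) (by omega) (by omega)
    rw [cascade_eq_of_fixed hc h hAB ha hb, ← h1, h2]
    change _ = cascade f _ _ g
    congr 2; omega
  have hlim : ∀ g, ∃ K : ℕ, ∀ (a : ℤ) (N : ℕ), a ≤ -K → (K : ℤ) ≤ a + N →
      cascade f a N g = F g :=
    fun g => ⟨M g, fun a N ha hb => hF g _ _ a N (hM g) (by omega) ha hb⟩
  have two : ∀ g h, ∃ (a : ℤ) (N : ℕ), cascade f a N g = F g ∧ cascade f a N h = F h ∧
      cascade f a N (g * h) = F (g * h) := by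
    intro g h
    obtain ⟨K, hK⟩ := hlim g
    obtain ⟨L, hL⟩ := hlim h
    obtain ⟨J, hJ⟩ := hlim (g * h)
    refine ⟨-(K + L + J : ℕ), 2 * (K + L + J), hK _ _ ?_ ?_, hL _ _ ?_ ?_, hJ _ _ ?_ ?_⟩ <;>
      push_cast <;> omega
  let Fh : Pauli n →* Pauli n := MonoidHom.mk' F (by
    intro g h
    obtain ⟨a, N, h1, h2, h3⟩ := two g h
    rw [← h1, ← h2, ← h3, map_mul])
  have hinj : Function.Injective Fh := by
    intro g h e
    obtain ⟨a, N, h1, h2, -⟩ := two g h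
    apply (cascade f a N).injective
    rw [h1, h2]
    exact e
  have hsurj : Function.Surjective Fh := by
    intro h
    set C := cascade f (-(M h)) (2 * M h) with hC
    -- The outer factors commute with `C`, so they fix `C⁻¹ h` because they fix `h`; the limit
    -- therefore acts on `C⁻¹ h` as `C` does.
    refine ⟨C⁻¹ h, ?_⟩
    change F _ = h
    rw [← hF (C⁻¹ h) (-(M h)) (M h) (-(M h)) (2 * M h) ?_ (by omega) le_rfl
      (by push_cast; omega), ← hC, MulAut.apply_inv_self]
    intro t ht
    have : Commute (f t) C⁻¹ := (cascade_commute_of _ _ fun s _ _ => hc t s).inv_right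
    rw [← MulAut.mul_apply, this.eq, MulAut.mul_apply, hM h t ht]
  exact ⟨MulEquiv.ofBijective Fh ⟨hinj, hsurj⟩, hlim⟩

namespace IsLim

variable {f f' : ℤ → MulAut (Pauli n)} {α α' : MulAut (Pauli n)}

theorem exists_interval (h : IsLim f α) (h' : IsLim f' α') (g g' : Pauli n) (L : ℕ) :
    ∃ (a : ℤ) (N : ℕ), a ≤ -L ∧ (L : ℤ) ≤ a + N ∧
      cascade f a N g = α g ∧ cascade f' a N g' = α' g' := by
  obtain ⟨K, hK⟩ := h g
  obtain ⟨J, hJ⟩ := h' g'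
  refine ⟨-(K + L + J : ℕ), 2 * (K + L + J), ?_, ?_, hK _ _ ?_ ?_, hJ _ _ ?_ ?_⟩ <;>
    push_cast <;> omega

theorem apply_of_fixed (h : IsLim f α) {g : Pauli n} (hg : ∀ t, f t g = g) : α g = g := by
  obtain ⟨a, N, -, -, h1, -⟩ := h.exists_interval h g g 0
  rw [← h1, cascade_apply_of_fixed]
  exact fun t _ _ => hg t

theorem apply_of_fixed_ne (h : IsLim f α) (hc : ∀ s t, Commute (f s) (f t)) {g : Pauli n} (t : ℤ)
    (hg : ∀ s, s ≠ t → f s g = g) : α g = f t g := by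
  obtain ⟨a, N, h0, h0', h1, -⟩ := h.exists_interval h g g (2 * t.natAbs + 1)
  rw [← h1, cascade_eq_of_fixed hc (A := t) (B := t + 1) (fun s hs => hg s (by omega)) (by omega)
    (by omega) (by omega)]
  have : (t + 1 - t).toNat = 0 + 1 := by omega
  rw [this, cascade_succ, cascade_zero]
  simp

theorem mul (h : IsLim f α) (h' : IsLim f' α') (hc : ∀ s t, Commute (f s) (f' t)) :
    IsLim (fun t => f t * f' t) (α * α') := by
  intro g
  obtain ⟨K, hK⟩ := h' g
  obtain ⟨J, hJ⟩ := h (α' g)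
  refine ⟨K + J, fun a N ha hb => ?_⟩
  push_cast at ha hb
  rw [cascade_mul fun s t _ => hc s t, MulAut.mul_apply, hK a N (by omega) (by omega),
    hJ a N (by omega) (by omega), MulAut.mul_apply]

theorem unique (h : IsLim f α) (h' : IsLim f α') : α = α' := by
  ext1 g
  obtain ⟨K, hK⟩ := h g
  obtain ⟨J, hJ⟩ := h' g
  rw [← hK (-(K + J : ℕ)) (2 * (K + J)) (by push_cast; omega) (by push_cast; omega),
    hJ (-(K + J : ℕ)) (2 * (K + J)) (by push_cast; omega) (by push_cast; omega)]

theorem isLim_one : IsLim (fun _ => (1 : MulAut (Pauli n))) 1 := fun g =>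
  ⟨0, fun a N _ _ => cascade_apply_of_fixed _ a N g fun _ _ _ => rfl⟩

theorem pow_four (h : IsLim f α) (hc : ∀ s t, Commute (f s) (f t)) (h4 : ∀ t, f t ^ 4 = 1) :
    α ^ 4 = 1 := by
  have h2 := h.mul h hc
  have h4' := h2.mul h2 fun s t =>
    ((hc s t).mul_left (hc s t)).mul_right ((hc s t).mul_left (hc s t))
  have e : (fun t => f t * f t * (f t * f t)) = fun _ => 1 := by
    funext t
    rw [← h4 t]; simp only [pow_succ, pow_zero, one_mul, mul_assoc]
  rw [e] at h4'
  rw [isLim_one.unique h4']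
  simp only [pow_succ, pow_zero, one_mul, mul_assoc]

/-- This expresses the inverse of a replicated gate as a sequence of replicated gates, so that
inverses of encoders inherit every property stable under products. -/
theorem inv_eq (h : IsLim f α) (hc : ∀ s t, Commute (f s) (f t)) (h4 : ∀ t, f t ^ 4 = 1) :
    α⁻¹ = α * α * α := by
  rw [inv_eq_iff_mul_eq_one, ← h.pow_four hc h4]
  simp only [pow_succ, pow_zero, one_mul, mul_assoc]

end IsLim

/-! ### Gates with disjoint supports -/

/-- Scalars and the single-qubit `X` and `Z` generate the Pauli group. -/
theorem Pauli.hom_ext {M : Type*} [Monoid M] {φ ψ : Pauli n →* M}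
    (hs : ∀ c, φ (Pauli.scalar c) = ψ (Pauli.scalar c)) (hX : ∀ q, φ (Pauli.X q) = ψ (Pauli.X q))
    (hZ : ∀ q, φ (Pauli.Z q) = ψ (Pauli.Z q)) : φ = ψ := by
  have two : ∀ a : ZMod 2, a = 0 ∨ a = 1 := by decide
  have one : φ 1 = ψ 1 := by rw [map_one, map_one]
  have h1 : ∀ x : Label n, φ ⟨0, x, 0⟩ = ψ ⟨0, x, 0⟩ := by
    intro x
    induction x using Finsupp.induction_linear with
    | zero => exact one
    | add f g hf hg =>
      have : (⟨0, f + g, 0⟩ : Pauli n) = ⟨0, f, 0⟩ * ⟨0, g, 0⟩ := by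
        ext1 <;> simp [dot_zero_left, signPhase_zero]
      rw [this, map_mul, map_mul, hf, hg]
    | single q a =>
      rcases two a with rfl | rfl
      · rw [Finsupp.single_zero]; exact one
      · exact hX q
  have h2 : ∀ z : Label n, φ ⟨0, 0, z⟩ = ψ ⟨0, 0, z⟩ := by
    intro z
    induction z using Finsupp.induction_linear with
    | zero => exact one
    | add f g hf hg =>
      have : (⟨0, 0, f + g⟩ : Pauli n) = ⟨0, 0, f⟩ * ⟨0, 0, g⟩ := by
        ext1 <;> simp [dot_zero_right, signPhase_zero]
      rw [this, map_mul, map_mul, hf, hg]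
    | single q a =>
      rcases two a with rfl | rfl
      · rw [Finsupp.single_zero]; exact one
      · exact hZ q
  ext g
  have : g = Pauli.scalar g.phase * (⟨0, g.x, 0⟩ * ⟨0, 0, g.z⟩) := by
    rw [Pauli.scalar_mul]
    ext1 <;> simp [dot_zero_left, signPhase_zero]
  rw [this]
  simp only [map_mul, hs, h1, h2]

namespace Gate

theorem touches_of_conj {γ : Gate n} {g : Pauli n} {q : Qubit n} (h : (γ.conj g).Touches q)
    (hq : q ∉ γ.support) : g.Touches q := by
  contrapose! hq
  rw [Pauli.not_touches] at hq
  by_contra hn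
  refine Pauli.not_touches.2 ?_ h
  cases γ <;> simp [support] at hn <;>
    simp [conj, hq, hn]

/-- It suffices to test generators. Each touches one qubit, which lies outside one of the two
supports; that gate fixes the generator, and also its image under the other gate. -/
theorem commute_act_of_disjoint {γ γ' : Gate n} (h : Disjoint γ.support γ'.support) :
    Commute γ.act γ'.act := by
  have key : ∀ (q : Qubit n) (g : Pauli n), (∀ q', g.Touches q' → q' = q) →
      γ.conj (γ'.conj g) = γ'.conj (γ.conj g) := by
    have aux : ∀ (γ γ' : Gate n), Disjoint γ.support γ'.support → ∀ (q : Qubit n) (g : Pauli n),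
        (∀ q', g.Touches q' → q' = q) → q ∉ γ.support →
        γ.conj (γ'.conj g) = γ'.conj (γ.conj g) := by
      intro γ γ' h q g hg hq
      rw [γ.conj_of_not_touches g fun q' h1 h2 => hq (hg q' h2 ▸ h1)]
      by_cases hq' : q ∈ γ'.support
      · apply conj_of_not_touches
        intro q' h1 h2
        have h3 : q' ∉ γ'.support := Set.disjoint_left.1 h h1
        exact h3 (hg q' (touches_of_conj h2 h3) ▸ hq')
      · rw [γ'.conj_of_not_touches g fun q' h1 h2 => hq' (hg q' h2 ▸ h1)]
        exact γ.conj_of_not_touches g fun q' h1 h2 => hq (hg q' h2 ▸ h1)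
    intro q g hg
    by_cases hq : q ∈ γ.support
    · exact (aux γ' γ h.symm q g hg (Set.disjoint_left.1 h hq)).symm
    · exact aux γ γ' h q g hg hq
  have : (γ.act * γ'.act).toMonoidHom = (γ'.act * γ.act).toMonoidHom := by
    apply Pauli.hom_ext
    · intro c
      change γ.conj (γ'.conj _) = γ'.conj (γ.conj _)
      simp only [conj_scalar]
    · exact fun q => key q _ fun q' => touches_X
    · exact fun q => key q _ fun q' => touches_Z
  ext1 g
  exact DFunLike.congr_fun this g

/-- CSIGN gates are diagonal, so they commute even when they share qubits: they leave X labels alone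
and change the rest by functions of these. -/
theorem commute_csign (a b a' b' : Qubit n) (h : a ≠ b) (h' : a' ≠ b') :
    Commute (csign a b h).act (csign a' b' h').act := by
  ext1 g
  change (csign a b h).conj ((csign a' b' h').conj g) = (csign a' b' h').conj ((csign a b h).conj g)
  ext1
  · simp only [conj]; ring
  · rfl
  · simp only [conj]; abel

end Gate

/-! ### Finite circuits -/

theorem circuit_append (W W' : List (Gate n)) :
    circuit (W ++ W') = circuit W' * circuit W := by
  simp [circuit]

theorem circuit_singleton (γ : Gate n) : circuit [γ] = γ.act := by
  simp [circuit]

theorem circuit_commute {W W' : List (Gate n)}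
    (h : ∀ γ ∈ W, ∀ γ' ∈ W', Disjoint γ.support γ'.support) :
    Commute (circuit W) (circuit W') := by
  have aux : ∀ (A : MulAut (Pauli n)) (W : List (Gate n)), (∀ γ ∈ W, Commute A γ.act) →
      Commute A (circuit W) := by
    intro A W hW
    apply Commute.list_prod_right
    intro x hx
    simp only [List.map_reverse, List.mem_reverse, List.mem_map] at hx
    obtain ⟨γ, hγ, rfl⟩ := hx
    exact hW γ hγ
  exact aux _ _ fun γ' hγ' => (aux _ _ fun γ hγ =>
    (Gate.commute_act_of_disjoint (h γ hγ γ' hγ')).symm).symm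

theorem circuit_flatMap_range (W : List (Gate n)) (a : ℤ) (p : ℕ) :
    circuit ((List.range p).flatMap fun r : ℕ => W.map (Gate.shift (a + r))) =
      cascade (fun s => circuit (W.map (Gate.shift s))) a p := by
  induction p with
  | zero => rfl
  | succ p ih =>
    rw [List.range_succ, List.flatMap_append, circuit_append, ih, cascade_succ]
    simp

theorem cascade_cascade (f : ℤ → MulAut (Pauli n)) (p : ℕ) (b : ℤ) (N : ℕ) :
    cascade (fun s => cascade f (p * s) p) b N = cascade f (p * b) (p * N) := by
  induction N with
  | zero => rfl
  | succ N ih =>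
    rw [cascade_succ, ih, Nat.mul_succ, cascade_add]
    push_cast
    rw [mul_add]

/-! ### Replicated gates -/

/-- The versions of the gate `γ` shifted by multiples of `d` blocks. -/
def replicas (d : ℕ) (γ : Gate n) (t : ℤ) : MulAut (Pauli n) := (γ.shift (d * t)).act

theorem replicas_apply (d : ℕ) (γ : Gate n) (t : ℤ) (g : Pauli n) :
    replicas d γ t g = (γ.shift (d * t)).conj g := rfl

/-- The gate acts on the blocks `0, …, m`. -/
def Gate.Within (γ : Gate n) (m : ℕ) : Prop := ∀ q ∈ γ.support, 0 ≤ q.2 ∧ q.2 ≤ m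

theorem replicas_apply_of_before {d : ℕ} {γ : Gate n} {m : ℕ} (hγ : γ.Within m) {t : ℤ}
    {g : Pauli n} (h : ∀ q, g.Touches q → d * t + m < q.2) : replicas d γ t g = g := by
  apply Gate.conj_of_not_touches
  intro q hq hgq
  have h1 := hγ _ ((Gate.mem_support_shift _ _ _).1 hq)
  have h2 := h q hgq
  simp only at h1
  omega

theorem replicas_apply_of_after {d : ℕ} {γ : Gate n} {m : ℕ} (hγ : γ.Within m) {t : ℤ}
    {g : Pauli n} (h : ∀ q, g.Touches q → q.2 < d * t) : replicas d γ t g = g := by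
  apply Gate.conj_of_not_touches
  intro q hq hgq
  have h1 := hγ _ ((Gate.mem_support_shift _ _ _).1 hq)
  have h2 := h q hgq
  simp only at h1
  omega

theorem locallyFinite_replicas {d : ℕ} (hd : 0 < d) {γ : Gate n} {m : ℕ} (hγ : γ.Within m) :
    LocallyFinite (replicas d γ) := by
  intro g
  obtain ⟨L, hL⟩ := g.exists_bound
  refine ⟨L + m + 1, fun t ht => ?_⟩
  push_cast at ht
  have hd' : (1 : ℤ) ≤ d := by exact_mod_cast hd
  rcases ht with ht | ht
  · apply replicas_apply_of_before hγ
    intro q hq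
    have := abs_le.1 (hL q hq)
    nlinarith
  · apply replicas_apply_of_after hγ
    intro q hq
    have := abs_le.1 (hL q hq)
    nlinarith

theorem isReplicated_of_isLim {d : ℕ} {γ : Gate n} {α : MulAut (Pauli n)}
    (h : IsLim (replicas d γ) α) : IsReplicated d γ α := by
  intro g
  obtain ⟨K, hK⟩ := h g
  exact ⟨K, fun M hM => hK _ _ (by omega) (by push_cast; omega)⟩

/-- The replicas starting before frame `b` end before block `d * b + m`, so omitting them does not
affect operators supported from there on. -/
theorem isOnline_of_isLim {d : ℕ} {γ : Gate n} {α : MulAut (Pauli n)} {m : ℕ} (hd : 0 < d)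
    (hγ : γ.Within m) (h : IsLim (replicas d γ) α) : IsOnline d α := by
  refine ⟨m, [γ], ?_, ?_⟩
  · intro γ' hγ' q hq
    rw [List.mem_singleton] at hγ'
    subst hγ'
    exact hγ q hq
  · intro b g hg
    obtain ⟨K, hK⟩ := h g
    refine ⟨K + b.natAbs, fun N hN => ?_⟩
    have e : (fun s : ℤ => circuit ([γ].map (Gate.shift (d * s)))) = replicas d γ := by
      funext s
      rw [List.map_singleton, circuit_singleton, replicas]
    rw [e, ← hK (b - (b.natAbs + K : ℕ)) (b.natAbs + K + N) (by omega)
      (by omega), cascade_add, MulAut.mul_apply,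
      cascade_apply_of_fixed _ (b - (b.natAbs + K : ℕ)) _ g, sub_add_cancel]
    intro t _ ht
    apply replicas_apply_of_before hγ
    intro q hq
    have h1 : d * b + m ≤ q.2 := hg q hq
    have hd' : (1 : ℤ) ≤ d := by exact_mod_cast hd
    have : t < b := by omega
    nlinarith

/-- Group `p` consecutive one-block steps into one step. -/
theorem IsOnline.of_one {E : MulAut (Pauli n)} (h : IsOnline 1 E) (p : ℕ) (hp : 0 < p) :
    IsOnline p E := by
  obtain ⟨m, W, hW, h⟩ := h
  refine ⟨m + p, (List.range p).flatMap fun r : ℕ => W.map (Gate.shift r), ?_, ?_⟩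
  · intro γ hγ q hq
    simp only [List.mem_flatMap, List.mem_range, List.mem_map] at hγ
    obtain ⟨r, hr, γ, hγ, rfl⟩ := hγ
    have := hW γ hγ _ ((Gate.mem_support_shift _ _ _).1 hq)
    simp only [Set.mem_Icc] at this ⊢
    push_cast
    omega
  · intro b g hg
    obtain ⟨N₀, hN⟩ := h (p * b) g fun q hq => by
      have := hg q hq
      simp only [Set.mem_Ici] at this ⊢
      push_cast at this ⊢
      omega
    refine ⟨N₀, fun N hN' => ?_⟩
    rw [← hN (p * N) (le_trans hN' (Nat.le_mul_of_pos_left N hp)), ← cascade_cascade]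
    congr 2
    funext s
    simp only [Nat.cast_one, one_mul]
    rw [← circuit_flatMap_range, List.map_flatMap]
    congr 2
    funext r
    rw [List.map_map]
    congr 1
    funext γ
    rw [Function.comp_apply, Gate.shift_shift, add_comm]

/-- The automorphism moves the support of operators by at most `ρ` blocks. -/
def HasSpread (ρ : ℕ) (E : MulAut (Pauli n)) : Prop :=
  ∀ g q, (E g).Touches q → ∃ q', g.Touches q' ∧ |q.2 - q'.2| ≤ ρ

theorem HasSpread.mul {E E' : MulAut (Pauli n)} {ρ ρ' : ℕ} (h : HasSpread ρ E)
    (h' : HasSpread ρ' E') : HasSpread (ρ + ρ') (E * E') := by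
  intro g q hq
  obtain ⟨q', hq', h1⟩ := h _ _ hq
  obtain ⟨q'', hq'', h2⟩ := h' _ _ hq'
  refine ⟨q'', hq'', ?_⟩
  rw [abs_le] at *
  push_cast
  omega

/-- Pipelining: `E'` acts first, so its circuit runs `m` frames ahead of that of `E`. The circuit of
`E` at time `s` then never meets the circuit of `E'` at a later time, and the joint cascade splits
into the two separate ones. The spread of `E'` bounds how far `E' g` can reach back into the
preamble of `E`. -/
theorem IsOnline.mul {E E' : MulAut (Pauli n)} {ρ p : ℕ} (hp : 0 < p) (h : IsOnline p E)
    (h' : IsOnline p E') (hs : HasSpread ρ E') : IsOnline p (E * E') := by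
  obtain ⟨m, W, hW, h⟩ := h
  obtain ⟨m', W', hW', h'⟩ := h'
  have hp' : (1 : ℤ) ≤ p := by exact_mod_cast hp
  have hpm : (m : ℤ) ≤ p * m := by nlinarith [Int.natCast_nonneg m]
  refine ⟨p * m + m' + m + ρ, W'.map (Gate.shift (p * m)) ++ W, ?_, ?_⟩
  · intro γ hγ q hq
    rw [List.mem_append, List.mem_map] at hγ
    simp only [Set.mem_Icc]
    push_cast
    rcases hγ with ⟨γ, hγ, rfl⟩ | hγ
    · have := hW' γ hγ _ ((Gate.mem_support_shift _ _ _).1 hq)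
      simp only [Set.mem_Icc] at this
      omega
    · have := hW γ hγ _ hq
      simp only [Set.mem_Icc] at this
      omega
  · intro b g hg
    have hg' : ∀ q, g.Touches q → (p : ℤ) * b + (p * m + m' + m + ρ) ≤ q.2 := fun q hq => by
      have := hg q hq
      simp only [Set.mem_Ici] at this
      push_cast at this
      exact this
    obtain ⟨N', hN'⟩ := h' (b + m) g fun q hq => by
      have := hg' q hq
      simp only [Set.mem_Ici, mul_add]
      omega
    obtain ⟨N, hN⟩ := h b (E' g) fun q hq => by
      obtain ⟨q', hq', h1⟩ := hs _ _ hq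
      have := hg' q' hq'
      rw [abs_le] at h1
      simp only [Set.mem_Ici]
      omega
    refine ⟨N + N', fun K hK => ?_⟩
    have e : (fun s : ℤ => circuit ((W'.map (Gate.shift (p * m)) ++ W).map (Gate.shift (p * s)))) =
        fun s => circuit (W.map (Gate.shift (p * s))) *
          circuit (W'.map (Gate.shift (p * (s + m)))) := by
      funext s
      rw [List.map_append, circuit_append, List.map_map]
      congr 3
      funext γ
      rw [Function.comp_apply, Gate.shift_shift, mul_add, add_comm]
    have shift_cascade : ∀ f : ℤ → MulAut (Pauli n),
        cascade (fun s => f (s + m)) b K = cascade f (b + m) K := by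
      intro f
      simp only [cascade]
      congr 2
      funext s
      rw [add_right_comm]
    rw [e, cascade_mul, shift_cascade fun s => circuit (W'.map (Gate.shift (p * s))),
      MulAut.mul_apply, hN' K (by omega), hN K (by omega), MulAut.mul_apply]
    intro s t hst
    apply circuit_commute
    intro γ hγ γ' hγ'
    rw [List.mem_map] at hγ hγ'
    obtain ⟨γ, hγ, rfl⟩ := hγ
    obtain ⟨γ', hγ', rfl⟩ := hγ'
    rw [Set.disjoint_left]
    intro q hq hq'
    have h1 := hW γ hγ _ ((Gate.mem_support_shift _ _ _).1 hq)
    have h2 := hW' γ' hγ' _ ((Gate.mem_support_shift _ _ _).1 hq')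
    simp only [Set.mem_Icc, mul_add] at h1 h2
    nlinarith

/-! ### Layers -/

/-- The set `K` allows a layer to use only some of the replicas, which is needed when neighbouring
replicas overlap. -/
theorem isNonCatastrophic_of_isLim {γ : ℤ → Gate n} {K : Set ℤ} [DecidablePred (· ∈ K)]
    (hd : ∀ s ∈ K, ∀ t ∈ K, s ≠ t → Disjoint (γ s).support (γ t).support)
    {α : MulAut (Pauli n)} (h : IsLim (fun t => if t ∈ K then (γ t).act else 1) α) :
    IsNonCatastrophic α := by
  refine ⟨[α], by simp, fun β hβ => ⟨γ '' K, ?_⟩⟩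
  rw [List.mem_singleton] at hβ
  subst hβ
  have hc : ∀ s t, Commute (if s ∈ K then (γ s).act else 1) (if t ∈ K then (γ t).act else 1) := by
    intro s t
    split_ifs with h1 h2
    · by_cases hst : s = t
      · rw [hst]
      · exact Gate.commute_act_of_disjoint (hd s h1 t h2 hst)
    · exact Commute.one_right _
    · exact Commute.one_left _
    · exact Commute.one_left _
  have fix : ∀ (g : Pauli n) t, (t ∈ K → ∀ q ∈ (γ t).support, ¬ g.Touches q) →
      (if t ∈ K then (γ t).act else 1) g = g := by
    intro g t ht
    split_ifs with hK
    · exact Gate.conj_of_not_touches _ _ (ht hK)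
    · rfl
  refine ⟨?_, ?_, ?_, ?_⟩
  · rintro _ ⟨s, hs, rfl⟩ _ ⟨t, ht, rfl⟩ hne
    exact hd s hs t ht fun e => hne (by rw [e])
  · exact fun c => h.apply_of_fixed fun t => fix _ t fun _ q _ => by
      simp [Pauli.Touches, Pauli.scalar]
  · have key : ∀ t ∈ K, ∀ q ∈ (γ t).support, ∀ g : Pauli n, (∀ q', g.Touches q' → q' = q) →
        β g = (γ t).act g := by
      intro t ht q hq g hg
      rw [h.apply_of_fixed_ne hc t, if_pos ht]
      intro s hs
      apply fix
      intro hsK q' hq' hgq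
      exact Set.disjoint_left.1 (hd s hsK t ht hs) hq' (hg q' hgq ▸ hq)
    rintro _ ⟨t, ht, rfl⟩ q hq
    exact ⟨key t ht q hq _ fun _ => touches_X, key t ht q hq _ fun _ => touches_Z⟩
  · intro q hq
    have key : ∀ g : Pauli n, (∀ q', g.Touches q' → q' = q) → β g = g := by
      intro g hg
      apply h.apply_of_fixed
      intro t
      apply fix
      intro ht q' hq' hgq
      exact hq _ ⟨t, ht, rfl⟩ (hg q' hgq ▸ hq')
    exact ⟨key _ fun _ => touches_X, key _ fun _ => touches_Z⟩

theorem IsNonCatastrophic.mul {E E' : MulAut (Pauli n)} (h : IsNonCatastrophic E)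
    (h' : IsNonCatastrophic E') : IsNonCatastrophic (E * E') := by
  obtain ⟨L, rfl, hL⟩ := h
  obtain ⟨L', rfl, hL'⟩ := h'
  refine ⟨L ++ L', List.prod_append.symm, fun α hα => ?_⟩
  exact (List.mem_append.1 hα).elim (hL α) (hL' α)

theorem IsShiftInvariantClifford.mul {p : ℕ} {E E' : MulAut (Pauli n)}
    (h : IsShiftInvariantClifford p E) (h' : IsShiftInvariantClifford p E') :
    IsShiftInvariantClifford p (E * E') := by
  obtain ⟨L, rfl, hL⟩ := h
  obtain ⟨L', rfl, hL'⟩ := h'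
  refine ⟨L ++ L', List.prod_append.symm, fun α hα => ?_⟩
  exact (List.mem_append.1 hα).elim (hL α) (hL' α)

/-! ### Replicated Hadamard, phase, CNOT and CSIGN gates -/

theorem replicas_one (γ : Gate n) : replicas 1 γ = fun t => (γ.shift t).act := by
  funext t; simp [replicas]

/-- The gates that are replicated in every block, on the streams in `A`. -/
inductive IsBasic (A : Set (Fin n)) : Gate n → Prop
  | hadamard (i : Fin n) (hi : i ∈ A) : IsBasic A (.hadamard (i, 0))
  | phase (i : Fin n) (hi : i ∈ A) : IsBasic A (.phase (i, 0))
  | cnot (i j : Fin n) (hi : i ∈ A) (hj : j ∈ A) (hij : i ≠ j) (u v : ℕ)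
      (h : ((i, (u : ℤ)) : Qubit n) ≠ (j, (v : ℤ))) : IsBasic A (.cnot (i, u) (j, v) h)
  | csign (i : Fin n) (hi : i ∈ A) (s : ℕ) (hs : 0 < s)
      (h : ((i, (0 : ℤ)) : Qubit n) ≠ (i, (s : ℤ))) : IsBasic A (.csign (i, 0) (i, s) h)

section formulas

variable (g : Pauli n) (a : ℤ) (N : ℕ)

/-- These formulas concern finite cascades, where induction is available. In the limit the interval
contains any given block and the range conditions disappear. -/
theorem cascade_hadamard (i : Fin n) (q : Qubit n) :
    ((cascade (replicas 1 (.hadamard (i, 0))) a N g).x q =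
      if q.1 = i ∧ a ≤ q.2 ∧ q.2 < a + N then g.z q else g.x q) ∧
    ((cascade (replicas 1 (.hadamard (i, 0))) a N g).z q =
      if q.1 = i ∧ a ≤ q.2 ∧ q.2 < a + N then g.x q else g.z q) := by
  have e : ∀ a b : ZMod 2, a + (a + b) = b := by decide
  have e' : ∀ a b : ZMod 2, a + (b + a) = b := by decide
  induction N generalizing q with
  | zero =>
    have : ¬ (q.1 = i ∧ a ≤ q.2 ∧ q.2 < a + (0 : ℕ)) := by push_cast; omega
    simp only [if_neg this]
    exact ⟨rfl, rfl⟩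
  | succ N ih =>
    rw [cascade_succ, MulAut.mul_apply, replicas_apply]
    revert ih
    generalize cascade _ a N g = G
    intro ih
    simp only [Nat.cast_one, one_mul, Gate.shift, Gate.conj, Finsupp.add_apply, Finsupp.single_apply, ih, zero_add]
    obtain ⟨j, t⟩ := q
    by_cases hq : i = j ∧ a + N = t
    · obtain ⟨rfl, rfl⟩ := hq
      simp [e, e']
    · have h1 : ¬ ((i, a + (N : ℤ)) = ((j, t) : Qubit n)) := by simpa using hq
      have h2 : (j = i ∧ a ≤ t ∧ t < a + (N + 1 : ℕ)) ↔ (j = i ∧ a ≤ t ∧ t < a + N) := by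
        push_cast; constructor
        · rintro ⟨rfl, h⟩
          have : a + N ≠ t := fun h => hq ⟨rfl, h⟩
          refine ⟨rfl, ?_⟩; omega
        · rintro ⟨rfl, h⟩
          refine ⟨rfl, ?_⟩; omega
      simp only [if_neg h1, h2, add_zero, and_self]

theorem cascade_phase (i : Fin n) (q : Qubit n) :
    ((cascade (replicas 1 (.phase (i, 0))) a N g).x q = g.x q) ∧
    ((cascade (replicas 1 (.phase (i, 0))) a N g).z q =
      g.z q + if q.1 = i ∧ a ≤ q.2 ∧ q.2 < a + N then g.x q else 0) := by
  induction N generalizing q with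
  | zero =>
    have : ¬ (q.1 = i ∧ a ≤ q.2 ∧ q.2 < a + (0 : ℕ)) := by push_cast; omega
    simp only [if_neg this, add_zero]
    exact ⟨rfl, rfl⟩
  | succ N ih =>
    rw [cascade_succ, MulAut.mul_apply, replicas_apply]
    revert ih
    generalize cascade _ a N g = G
    intro ih
    simp only [Nat.cast_one, one_mul, Gate.shift, Gate.conj, Finsupp.add_apply, Finsupp.single_apply, ih, zero_add,
      true_and, add_assoc, add_right_inj]
    obtain ⟨j, t⟩ := q
    by_cases hq : i = j ∧ a + N = t
    · obtain ⟨rfl, rfl⟩ := hq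
      simp
    · have h1 : ¬ ((i, a + (N : ℤ)) = ((j, t) : Qubit n)) := by simpa using hq
      have h2 : (j = i ∧ a ≤ t ∧ t < a + (N + 1 : ℕ)) ↔ (j = i ∧ a ≤ t ∧ t < a + N) := by
        push_cast; constructor
        · rintro ⟨rfl, h⟩
          have : a + N ≠ t := fun h => hq ⟨rfl, h⟩
          refine ⟨rfl, ?_⟩; omega
        · rintro ⟨rfl, h⟩
          refine ⟨rfl, ?_⟩; omega
      simp only [if_neg h1, h2, add_zero]

/-- Extending an interval by one element changes a sum of indicators by a single term. -/
theorem indicator_succ (i : Fin n) (w : ℤ) (q : Qubit n) (c : ZMod 2) :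
    (if q.1 = i ∧ a ≤ q.2 - w ∧ q.2 - w < a + (N + 1 : ℕ) then c else 0) =
      (if q.1 = i ∧ a ≤ q.2 - w ∧ q.2 - w < a + N then c else 0) +
        if (i, w + (a + N)) = q then c else 0 := by
  obtain ⟨j, t⟩ := q
  by_cases h : i = j
  · subst h
    simp only [true_and, Prod.mk.injEq]
    push_cast
    split_ifs <;> first | omega | simp
  · have h' : ¬ j = i := fun e => h e.symm
    simp [h, h']

theorem cascade_cnot (i j : Fin n) (hij : i ≠ j) (u v : ℕ)
    (h : ((i, (u : ℤ)) : Qubit n) ≠ (j, (v : ℤ))) (q : Qubit n) :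
    ((cascade (replicas 1 (.cnot (i, u) (j, v) h)) a N g).x q =
      g.x q + if q.1 = j ∧ a ≤ q.2 - v ∧ q.2 - v < a + N then g.x (i, q.2 - v + u) else 0) ∧
    ((cascade (replicas 1 (.cnot (i, u) (j, v) h)) a N g).z q =
      g.z q + if q.1 = i ∧ a ≤ q.2 - u ∧ q.2 - u < a + N then g.z (j, q.2 - u + v) else 0) := by
  induction N generalizing q with
  | zero =>
    have h1 : ¬ (q.1 = j ∧ a ≤ q.2 - v ∧ q.2 - v < a + (0 : ℕ)) := by push_cast; omega
    have h2 : ¬ (q.1 = i ∧ a ≤ q.2 - u ∧ q.2 - u < a + (0 : ℕ)) := by push_cast; omega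
    simp only [if_neg h1, if_neg h2, add_zero]
    exact ⟨rfl, rfl⟩
  | succ N ih =>
    rw [cascade_succ, MulAut.mul_apply, replicas_apply]
    revert ih
    generalize cascade _ a N g = G
    intro ih
    simp only [Nat.cast_one, one_mul, Gate.shift, Gate.conj, Finsupp.add_apply, Finsupp.single_apply, ih, hij, hij.symm,
      false_and, if_false, add_zero, add_assoc, add_right_inj, indicator_succ]
    constructor
    · split_ifs with h1
      · subst h1; congr 2; ring
      · rfl
    · split_ifs with h1
      · subst h1; congr 2; ring
      · rfl

theorem cascade_csign (i : Fin n) (s : ℕ)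
    (h : ((i, (0 : ℤ)) : Qubit n) ≠ (i, (s : ℤ))) (q : Qubit n) :
    ((cascade (replicas 1 (.csign (i, 0) (i, s) h)) a N g).x q = g.x q) ∧
    ((cascade (replicas 1 (.csign (i, 0) (i, s) h)) a N g).z q =
      g.z q + ((if q.1 = i ∧ a ≤ q.2 - s ∧ q.2 - s < a + N then g.x (i, q.2 - s) else 0) +
        if q.1 = i ∧ a ≤ q.2 - 0 ∧ q.2 - 0 < a + N then g.x (i, q.2 + s) else 0)) := by
  induction N generalizing q with
  | zero =>
    have h1 : ¬ (q.1 = i ∧ a ≤ q.2 - s ∧ q.2 - s < a + (0 : ℕ)) := by push_cast; omega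
    have h2 : ¬ (q.1 = i ∧ a ≤ q.2 - 0 ∧ q.2 - 0 < a + (0 : ℕ)) := by push_cast; omega
    simp only [if_neg h1, if_neg h2, add_zero]
    exact ⟨rfl, rfl⟩
  | succ N ih =>
    rw [cascade_succ, MulAut.mul_apply, replicas_apply]
    revert ih
    generalize cascade _ a N g = G
    intro ih
    simp only [Nat.cast_one, one_mul, Gate.shift, Gate.conj, Finsupp.add_apply, Finsupp.single_apply, ih,
      true_and, indicator_succ]
    have e1 : (if (i, (s : ℤ) + (a + N)) = q then g.x (i, 0 + (a + N)) else 0) =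
        if (i, (s : ℤ) + (a + N)) = q then g.x (i, q.2 - s) else 0 := by
      split_ifs with h1
      · subst h1; congr 2; ring
      · rfl
    have e2 : (if (i, 0 + (a + N)) = q then g.x (i, (s : ℤ) + (a + N)) else 0) =
        if (i, 0 + (a + N)) = q then g.x (i, q.2 + s) else 0 := by
      split_ifs with h1
      · subst h1; congr 2; ring
      · rfl
    rw [e1, e2]
    abel

end formulas

namespace IsBasic

variable {A : Set (Fin n)} {γ : Gate n}

theorem ne_pauliX (h : IsBasic A γ) (q : Qubit n) : γ ≠ .pauliX q := by
  cases h <;> simp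

theorem exists_within (h : IsBasic A γ) : ∃ m, γ.Within m := by
  cases h with
  | hadamard i => exact ⟨0, fun q hq => by simp [Gate.support] at hq; simp [hq]⟩
  | phase i => exact ⟨0, fun q hq => by simp [Gate.support] at hq; simp [hq]⟩
  | cnot i j _ _ _ u v =>
    refine ⟨u + v, fun q hq => ?_⟩
    simp only [Gate.support, Set.mem_insert_iff, Set.mem_singleton_iff] at hq
    rcases hq with rfl | rfl <;> simp
  | csign i _ s =>
    refine ⟨s, fun q hq => ?_⟩
    simp only [Gate.support, Set.mem_insert_iff, Set.mem_singleton_iff] at hq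
    rcases hq with rfl | rfl <;> simp

theorem disjoint_or (h : IsBasic A γ) :
    (∀ s t : ℤ, s ≠ t → Disjoint (γ.shift s).support (γ.shift t).support) ∨
    ∃ (i : Fin n) (s : ℕ) (_ : 0 < s) (h : ((i, (0 : ℤ)) : Qubit n) ≠ (i, (s : ℤ))),
      γ = .csign (i, 0) (i, s) h := by
  cases h with
  | hadamard i =>
    left; intro s t hst
    simpa [Gate.support, Gate.shift] using hst
  | phase i =>
    left; intro s t hst
    simpa [Gate.support, Gate.shift] using hst
  | cnot i j _ _ hij u v =>
    left; intro s t hst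
    simp [Gate.support, Gate.shift, hst.symm, hij, hij.symm]
  | csign i _ s hs h => exact Or.inr ⟨i, s, hs, h, rfl⟩

theorem commute (h : IsBasic A γ) (s t : ℤ) : Commute (replicas 1 γ s) (replicas 1 γ t) := by
  rw [replicas_one]
  rcases h.disjoint_or with h | ⟨i, u, hu, h, rfl⟩
  · by_cases hst : s = t
    · rw [hst]
    · exact Gate.commute_act_of_disjoint (h s t hst)
  · exact Gate.commute_csign ..

theorem exists_lim (h : IsBasic A γ) : ∃ α, IsLim (replicas 1 γ) α := by
  obtain ⟨m, hm⟩ := h.exists_within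
  exact exists_isLim h.commute (locallyFinite_replicas one_pos hm)

theorem isNonCatastrophic (h : IsBasic A γ) {α : MulAut (Pauli n)}
    (hα : IsLim (replicas 1 γ) α) : IsNonCatastrophic α := by
  classical
  obtain ⟨m, hm⟩ := h.exists_within
  have hlf := locallyFinite_replicas one_pos hm
  have hcomm := h.commute
  rw [replicas_one] at hα hlf hcomm
  rcases h.disjoint_or with h | ⟨i, u, hu, hne, rfl⟩
  · exact isNonCatastrophic_of_isLim (K := Set.univ) (fun s _ t _ hst => h s t hst) (by simpa)
  · have hu' : (0 : ℤ) < u := by exact_mod_cast hu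
    -- Replicas of a CSIGN gate on one stream overlap exactly when their times differ by `u`.
    -- Passing from `t` to `t + u` changes the parity of `t / u`, so the even and the odd class each
    -- form a layer.
    have part : ∀ K : Set ℤ, (∀ s ∈ K, s + u ∉ K) → ∃ β : MulAut (Pauli n),
        IsLim (fun t => if t ∈ K then ((Gate.csign (i, 0) (i, (u : ℤ)) hne).shift t).act else 1) β ∧
          IsNonCatastrophic β := by
      intro K hK
      obtain ⟨β, hβ⟩ := exists_isLim
        (f := fun t => if t ∈ K then ((Gate.csign (i, 0) (i, (u : ℤ)) hne).shift t).act else 1)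
        (fun s t => by
          split_ifs
          · exact hcomm s t
          · exact Commute.one_right _
          · exact Commute.one_left _
          · exact Commute.one_left _)
        (fun g => by
          obtain ⟨M, hM⟩ := hlf g
          refine ⟨M, fun t ht => ?_⟩
          dsimp only
          split_ifs
          · exact hM t ht
          · rfl)
      refine ⟨β, hβ, isNonCatastrophic_of_isLim (fun s hs t ht hst => ?_) hβ⟩
      simp only [Gate.support, Gate.shift, Set.disjoint_insert_left, Set.disjoint_singleton_left,
        Set.mem_insert_iff, Set.mem_singleton_iff, Prod.mk.injEq, true_and, zero_add, not_or]
      refine ⟨⟨hst, fun e => hK t ht ?_⟩, fun e => hK s hs ?_, fun e => hst ?_⟩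
      · rw [add_comm, ← e]; exact hs
      · rw [add_comm, e]; exact ht
      · linarith
    have hdiv : ∀ s : ℤ, (s + u) / u = s / u + 1 := fun s => by
      rw [Int.add_ediv_of_dvd_right (dvd_refl _), Int.ediv_self hu'.ne']
    obtain ⟨β, hβ, hβ'⟩ := part {t | Even (t / (u : ℤ))} fun s hs => by
      simp only [Set.mem_ofPred_eq, hdiv] at hs ⊢
      simpa using hs.add_one
    obtain ⟨β', hb, hb'⟩ := part {t | ¬ Even (t / (u : ℤ))} fun s hs => by
      simp only [Set.mem_ofPred_eq, hdiv, Int.even_add_one, not_not] at hs ⊢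
      exact hs
    have := hβ.mul hb (fun s t => by
      split_ifs
      · exact hcomm s t
      · exact Commute.one_right _
      · exact Commute.one_left _
      · exact Commute.one_left _)
    rw [hα.unique (α' := β * β') ?_]
    · exact hβ'.mul hb'
    · convert this using 2 with t
      by_cases ht : Even (t / (u : ℤ)) <;> simp [ht]

end IsBasic

/-! ### Closure properties of admissible encoders -/

/-- Everything that is required of an encoder, apart from the code it produces. -/
structure Good (p : ℕ) (E : MulAut (Pauli n)) : Prop where
  scalar : ∀ c, E (Pauli.scalar c) = Pauli.scalar c
  spread : ∃ ρ, HasSpread ρ E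
  shift : ∀ (j : ℤ) g, E (Pauli.shift (p * j) g) = Pauli.shift (p * j) (E g)
  nonCatastrophic : IsNonCatastrophic E
  shiftInvariant : IsShiftInvariantClifford p E
  online : IsOnline p E

theorem Good.mul {p : ℕ} (hp : 0 < p) {E E' : MulAut (Pauli n)} (h : Good p E)
    (h' : Good p E') : Good p (E * E') where
  scalar c := by rw [MulAut.mul_apply, h'.scalar, h.scalar]
  spread := by
    obtain ⟨ρ, hρ⟩ := h.spread
    obtain ⟨ρ', hρ'⟩ := h'.spread
    exact ⟨_, hρ.mul hρ'⟩
  shift j g := by rw [MulAut.mul_apply, h'.shift, h.shift, MulAut.mul_apply]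
  nonCatastrophic := h.nonCatastrophic.mul h'.nonCatastrophic
  shiftInvariant := h.shiftInvariant.mul h'.shiftInvariant
  online := by
    obtain ⟨ρ', hρ'⟩ := h'.spread
    exact h.online.mul hp h'.online hρ'

theorem Good.one (p : ℕ) : Good p (1 : MulAut (Pauli n)) where
  scalar _ := rfl
  spread := ⟨0, fun g q hq => ⟨q, hq, by simp⟩⟩
  shift _ _ := rfl
  nonCatastrophic := ⟨[], rfl, by simp⟩
  shiftInvariant := ⟨[], rfl, by simp⟩
  online := ⟨0, [], by simp, fun b g _ => ⟨0, fun N _ => by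
    rw [cascade_apply_of_fixed]
    · rfl
    · intros; rfl⟩⟩

theorem IsLim.apply_shift {d : ℕ} {γ : Gate n} {α : MulAut (Pauli n)}
    (h : IsLim (replicas d γ) α) (j : ℤ) (g : Pauli n) :
    α (Pauli.shift (d * j) g) = Pauli.shift (d * j) (α g) := by
  have key : ∀ (a : ℤ) (N : ℕ), cascade (replicas d γ) (a + j) N (Pauli.shift (d * j) g) =
      Pauli.shift (d * j) (cascade (replicas d γ) a N g) := by
    intro a N
    induction N with
    | zero => rfl
    | succ N ih =>
      rw [cascade_succ, cascade_succ, MulAut.mul_apply, MulAut.mul_apply, ih, replicas_apply,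
        replicas_apply, ← Gate.conj_shift, Gate.shift_shift]
      congr 2
      ring
  obtain ⟨K, hK⟩ := h g
  obtain ⟨J, hJ⟩ := h (Pauli.shift (d * j) g)
  rw [← hK (-(K + J + j.natAbs : ℕ)) (2 * (K + J + j.natAbs)) (by omega) (by omega), ← key,
    hJ _ _ (by omega) (by omega)]

section limits

variable {α : MulAut (Pauli n)} (g : Pauli n) (q : Qubit n)

theorem IsLim.exists_cascade {f : ℤ → MulAut (Pauli n)} (h : IsLim f α) (L : ℕ) :
    ∃ (a : ℤ) (N : ℕ), a ≤ -L ∧ (L : ℤ) ≤ a + N ∧ cascade f a N g = α g := by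
  obtain ⟨a, N, h1, h2, h3, -⟩ := h.exists_interval h g g L
  exact ⟨a, N, h1, h2, h3⟩

theorem IsLim.hadamard_apply {i : Fin n} (h : IsLim (replicas 1 (.hadamard (i, 0))) α) :
    ((α g).x q = if q.1 = i then g.z q else g.x q) ∧
    ((α g).z q = if q.1 = i then g.x q else g.z q) := by
  obtain ⟨a, N, h1, h2, h3⟩ := h.exists_cascade g (q.2.natAbs + 1)
  have h4 : (q.1 = i ∧ a ≤ q.2 ∧ q.2 < a + N) ↔ q.1 = i := and_iff_left (by omega)
  have := cascade_hadamard g a N i q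
  simpa only [h3, h4] using this

theorem IsLim.phase_apply {i : Fin n} (h : IsLim (replicas 1 (.phase (i, 0))) α) :
    ((α g).x q = g.x q) ∧ ((α g).z q = g.z q + if q.1 = i then g.x q else 0) := by
  obtain ⟨a, N, h1, h2, h3⟩ := h.exists_cascade g (q.2.natAbs + 1)
  have h4 : (q.1 = i ∧ a ≤ q.2 ∧ q.2 < a + N) ↔ q.1 = i := and_iff_left (by omega)
  have := cascade_phase g a N i q
  simpa only [h3, h4] using this

theorem IsLim.cnot_apply {i j : Fin n} (hij : i ≠ j) {u v : ℕ}
    {hne : ((i, (u : ℤ)) : Qubit n) ≠ (j, (v : ℤ))}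
    (h : IsLim (replicas 1 (.cnot (i, u) (j, v) hne)) α) :
    ((α g).x q = g.x q + if q.1 = j then g.x (i, q.2 - v + u) else 0) ∧
    ((α g).z q = g.z q + if q.1 = i then g.z (j, q.2 - u + v) else 0) := by
  obtain ⟨a, N, h1, h2, h3⟩ := h.exists_cascade g (q.2.natAbs + u + v + 1)
  have h4 : (q.1 = j ∧ a ≤ q.2 - v ∧ q.2 - v < a + N) ↔ q.1 = j := and_iff_left (by omega)
  have h5 : (q.1 = i ∧ a ≤ q.2 - u ∧ q.2 - u < a + N) ↔ q.1 = i := and_iff_left (by omega)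
  have := cascade_cnot g a N i j hij u v hne q
  simpa only [h3, h4, h5] using this

theorem IsLim.csign_apply {i : Fin n} {s : ℕ} {hne : ((i, (0 : ℤ)) : Qubit n) ≠ (i, (s : ℤ))}
    (h : IsLim (replicas 1 (.csign (i, 0) (i, s) hne)) α) :
    ((α g).x q = g.x q) ∧
    ((α g).z q = g.z q + if q.1 = i then g.x (i, q.2 - s) + g.x (i, q.2 + s) else 0) := by
  obtain ⟨a, N, h1, h2, h3⟩ := h.exists_cascade g (q.2.natAbs + s + 1)
  have h4 : (q.1 = i ∧ a ≤ q.2 - s ∧ q.2 - s < a + N) ↔ q.1 = i := and_iff_left (by omega)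
  have h5 : (q.1 = i ∧ a ≤ q.2 - 0 ∧ q.2 - 0 < a + N) ↔ q.1 = i := and_iff_left (by omega)
  have := cascade_csign g a N i s hne q
  simp only [h3, h4, h5] at this
  refine ⟨this.1, this.2.trans ?_⟩
  split_ifs <;> simp

end limits

theorem IsBasic.exists_hasSpread {A : Set (Fin n)} {γ : Gate n} (h : IsBasic A γ)
    {α : MulAut (Pauli n)} (hα : IsLim (replicas 1 γ) α) : ∃ ρ, HasSpread ρ α := by
  cases h with
  | hadamard i =>
    refine ⟨0, fun g q hq => ⟨q, ?_, by simp⟩⟩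
    obtain ⟨h1, h2⟩ := hα.hadamard_apply g q
    contrapose! hq
    rw [Pauli.not_touches] at hq ⊢
    simp [h1, h2, hq]
  | phase i =>
    refine ⟨0, fun g q hq => ⟨q, ?_, by simp⟩⟩
    obtain ⟨h1, h2⟩ := hα.phase_apply g q
    contrapose! hq
    rw [Pauli.not_touches] at hq ⊢
    simp [h1, h2, hq]
  | cnot i j _ _ hij u v =>
    refine ⟨u + v, fun g q hq => ?_⟩
    obtain ⟨h1, h2⟩ := hα.cnot_apply g q hij
    contrapose! hq
    have h3 : ¬ g.Touches q := fun h => by have := hq q h; simp at this; omega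
    have h4 : ¬ g.Touches (i, q.2 - v + u) := fun h => by
      have := hq _ h; rw [lt_abs] at this; push_cast at this; omega
    have h5 : ¬ g.Touches (j, q.2 - u + v) := fun h => by
      have := hq _ h; rw [lt_abs] at this; push_cast at this; omega
    rw [Pauli.not_touches] at *
    simp [h1, h2, h3, h4, h5]
  | csign i _ s =>
    refine ⟨s, fun g q hq => ?_⟩
    obtain ⟨h1, h2⟩ := hα.csign_apply g q
    contrapose! hq
    have h3 : ¬ g.Touches q := fun h => by have := hq q h; simp at this; omega
    have h4 : ¬ g.Touches (i, q.2 - s) := fun h => by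
      have := hq _ h; rw [lt_abs] at this; omega
    have h5 : ¬ g.Touches (i, q.2 + s) := fun h => by
      have := hq _ h; rw [lt_abs] at this; omega
    rw [Pauli.not_touches] at *
    simp [h1, h2, h3, h4, h5]

theorem IsBasic.good {A : Set (Fin n)} {γ : Gate n} (h : IsBasic A γ)
    {α : MulAut (Pauli n)} (hα : IsLim (replicas 1 γ) α) {p : ℕ} (hp : 0 < p) : Good p α where
  scalar c := hα.apply_of_fixed fun t => Gate.conj_scalar _ c
  spread := h.exists_hasSpread hα
  shift j g := by simpa using hα.apply_shift (p * j) g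
  nonCatastrophic := h.isNonCatastrophic hα
  shiftInvariant := ⟨[α], by simp, fun β hβ => by
    rw [List.mem_singleton] at hβ
    subst hβ
    exact Or.inl ⟨γ, h.ne_pauliX, isReplicated_of_isLim hα⟩⟩
  online := by
    obtain ⟨m, hm⟩ := h.exists_within
    exact (isOnline_of_isLim one_pos hm hα).of_one p hp

/-- The group generated by the replicated gates on the streams in `A`. -/
def elementary (A : Set (Fin n)) : Subgroup (MulAut (Pauli n)) :=
  Subgroup.closure {α | ∃ γ, IsBasic A γ ∧ IsLim (replicas 1 γ) α}

theorem good_of_mem_elementary {A : Set (Fin n)} {E : MulAut (Pauli n)} (h : E ∈ elementary A)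
    {p : ℕ} (hp : 0 < p) : Good p E := by
  refine Subgroup.closure_induction'' (p := fun E _ => Good p E) ?_ ?_ ?_ ?_ h
  · rintro α ⟨γ, hγ, hα⟩
    exact hγ.good hα hp
  · rintro α ⟨γ, hγ, hα⟩
    have := hγ.good hα hp
    rw [hα.inv_eq hγ.commute fun t => Gate.act_pow_four _]
    exact (this.mul hp this).mul hp this
  · exact Good.one p
  · exact fun _ _ _ _ h1 h2 => h1.mul hp h2

theorem elementary_mono {A B : Set (Fin n)} (h : A ⊆ B) : elementary A ≤ elementary B := by
  apply Subgroup.closure_mono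
  rintro α ⟨γ, hγ, hα⟩
  refine ⟨γ, ?_, hα⟩
  cases hγ with
  | hadamard i hi => exact .hadamard i (h hi)
  | phase i hi => exact .phase i (h hi)
  | cnot i j hi hj hij u v hne => exact .cnot i j (h hi) (h hj) hij u v hne
  | csign i hi s hs hne => exact .csign i (h hi) s hs hne

/-- Later reduction steps use only gates on unfinished streams; this shows that they leave the
labels on finished streams unchanged. -/
theorem elementary_apply_of_notMem {A : Set (Fin n)} {E : MulAut (Pauli n)}
    (h : E ∈ elementary A) (g : Pauli n) (q : Qubit n) (hq : q.1 ∉ A) :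
    (E g).x q = g.x q ∧ (E g).z q = g.z q := by
  have key : ∀ γ α, IsBasic A γ → IsLim (replicas 1 γ) α →
      ∀ g : Pauli n, (α g).x q = g.x q ∧ (α g).z q = g.z q := by
    intro γ α hγ hα g
    cases hγ with
    | hadamard i hi =>
      have hne : q.1 ≠ i := fun e => hq (e ▸ hi)
      simpa [hne] using hα.hadamard_apply g q
    | phase i hi =>
      have hne : q.1 ≠ i := fun e => hq (e ▸ hi)
      simpa [hne] using hα.phase_apply g q
    | cnot i j hi hj hij u v =>
      have hne : q.1 ≠ i := fun e => hq (e ▸ hi)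
      have hne' : q.1 ≠ j := fun e => hq (e ▸ hj)
      simpa [hne, hne'] using hα.cnot_apply g q hij
    | csign i hi s =>
      have hne : q.1 ≠ i := fun e => hq (e ▸ hi)
      simpa [hne] using hα.csign_apply g q
  refine Subgroup.closure_induction
    (p := fun E _ => ∀ g : Pauli n, (E g).x q = g.x q ∧ (E g).z q = g.z q) ?_ ?_ ?_ ?_ h g
  · rintro α ⟨γ, hγ, hα⟩
    exact key γ α hγ hα
  · exact fun g => ⟨rfl, rfl⟩
  · intro E E' _ _ h1 h2 g
    rw [MulAut.mul_apply, (h1 _).1, (h1 _).2]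
    exact h2 g
  · intro E _ h1 g
    have := h1 (E⁻¹ g)
    rw [MulAut.apply_inv_self] at this
    exact ⟨this.1.symm, this.2.symm⟩

/-! ### Division with remainder for binary sequences of finite support -/

theorem eq_one_of_ne_zero {a : ZMod 2} (h : a ≠ 0) : a = 1 := by
  revert a; decide

/-- The nonzero terms of `f` lie between `s` and `s + d`, which are attained. -/
def Spans (f : ℤ → ZMod 2) (s : ℤ) (d : ℕ) : Prop :=
  f s ≠ 0 ∧ f (s + d) ≠ 0 ∧ ∀ t, f t ≠ 0 → s ≤ t ∧ t ≤ s + d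

theorem exists_spans {f : ℤ → ZMod 2} {a b t₀ : ℤ} (h : ∀ t, f t ≠ 0 → a ≤ t ∧ t ≤ b)
    (h₀ : f t₀ ≠ 0) : ∃ (s : ℤ) (d : ℕ), Spans f s d ∧ a ≤ s ∧ s + d ≤ b := by
  classical
  obtain ⟨lo, hlo, hlo'⟩ := Int.exists_least_of_bdd (P := fun t => f t ≠ 0)
    ⟨a, fun t ht => (h t ht).1⟩ ⟨t₀, h₀⟩
  obtain ⟨hi, hhi, hhi'⟩ := Int.exists_greatest_of_bdd (P := fun t => f t ≠ 0)
    ⟨b, fun t ht => (h t ht).2⟩ ⟨t₀, h₀⟩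
  have h1 := hlo' hi hhi
  have e : lo + ((hi - lo).toNat : ℤ) = hi := by omega
  refine ⟨lo, (hi - lo).toNat, ⟨hlo, by rwa [e], fun t ht => ⟨hlo' t ht, ?_⟩⟩, (h lo hlo).1, ?_⟩
  · rw [e]; exact hhi' t ht
  · rw [e]; exact (h hi hhi).2

/-- Euclidean division of Laurent polynomials: shifts of `g` cancel first the highest and then the
lowest terms of `f`. The predicate `Q` lets each subtraction be realized by a gate or a group
element, so the remainder comes with a witness. -/
theorem exists_reduced {g : ℤ → ZMod 2} {s : ℤ} {d : ℕ} (hg : Spans g s d)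
    {Q : (ℤ → ZMod 2) → Prop} (hQ : ∀ f (j : ℤ), Q f → Q fun t => f t + g (t - j))
    {f : ℤ → ZMod 2} (hf : Q f) {L : ℕ} (hL : ∀ t, f t ≠ 0 → |t| ≤ L) :
    ∃ f', Q f' ∧ ∀ t, f' t ≠ 0 → 0 ≤ t ∧ t < d := by
  obtain ⟨hs, hsd, hsupp⟩ := hg
  have supp : ∀ t, ¬ (s ≤ t ∧ t ≤ s + d) → g t = 0 := fun t ht => by
    by_contra hne; exact ht (hsupp t hne)
  have down : ∀ k : ℕ, ∀ f, Q f → (∀ t, f t ≠ 0 → -(L : ℤ) ≤ t ∧ t < d + k) →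
      ∃ f', Q f' ∧ ∀ t, f' t ≠ 0 → -(L : ℤ) ≤ t ∧ t < d := by
    intro k
    induction k with
    | zero => exact fun f hf h => ⟨f, hf, fun t ht => by simpa using h t ht⟩
    | succ k ih =>
      intro f hf h
      by_cases h0 : f (d + k) = 0
      · refine ih f hf fun t ht => ?_
        have h1 := h t ht
        have : t ≠ d + k := fun e => ht (e ▸ h0)
        push_cast at h1
        omega
      -- The shift by `k - s` moves the top term of `g` from `s + d` to `d + k`.
      · refine ih _ (hQ f (k - s) hf) fun t ht => ?_
        by_contra hn
        apply ht
        have h1 : t ≠ d + k → f t = 0 := fun hne => by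
          by_contra h1
          have := h t h1
          push_cast at this
          omega
        by_cases e : t = d + k
        · have e' : t - (k - s) = s + d := by rw [e]; ring
          rw [e', e, eq_one_of_ne_zero h0, eq_one_of_ne_zero hsd]; decide
        · rw [h1 e, supp _ (by omega), add_zero]
  have up : ∀ k : ℕ, ∀ f, Q f → (∀ t, f t ≠ 0 → -(k : ℤ) ≤ t ∧ t < d) →
      ∃ f', Q f' ∧ ∀ t, f' t ≠ 0 → 0 ≤ t ∧ t < d := by
    intro k
    induction k with
    | zero => exact fun f hf h => ⟨f, hf, fun t ht => by simpa using h t ht⟩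
    | succ k ih =>
      intro f hf h
      by_cases h0 : f (-(k + 1)) = 0
      · refine ih f hf fun t ht => ?_
        have h1 := h t ht
        have : t ≠ -(k + 1) := fun e => ht (e ▸ h0)
        push_cast at h1
        omega
      -- Here the bottom term of `g` is moved from `s` to `-(k + 1)`. The shifted copy ends at `d -
      -- (k + 1) < d`, so no high terms reappear.
      · refine ih _ (hQ f (-(k + 1) - s) hf) fun t ht => ?_
        by_contra hn
        apply ht
        have h1 : t ≠ -(k + 1) → f t = 0 := fun hne => by
          by_contra h1
          have := h t h1
          push_cast at this
          omega
        by_cases e : t = -(k + 1)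
        · have e' : t - (-(k + 1) - s) = s := by rw [e]; ring
          rw [e', e, eq_one_of_ne_zero h0, eq_one_of_ne_zero hs]; decide
        · rw [h1 e, supp _ (by omega), add_zero]
  obtain ⟨f', hf', h'⟩ := down (L + 1) f hf fun t ht => by
    have := abs_le.1 (hL t ht)
    push_cast
    omega
  exact up L f' hf' h'

/-! ### Orthogonality relations read off from extreme coefficients -/

theorem dot_eq_mul {z x : Label n} (q : Qubit n) (h : ∀ q', q' ≠ q → z q' * x q' = 0) :
    dot z x = z q * x q := by
  classical
  rw [dot, Finsupp.sum, Finset.sum_eq_single q]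
  · exact fun q' _ hq' => h q' hq'
  · intro hq
    rw [Finsupp.notMem_support_iff.1 hq, zero_mul]

theorem Pauli.commute_shift_iff (g h : Pauli n) (t : ℤ) :
    g * shift t h = shift t h * g ↔ dot g.z (shiftLabel t h.x) = dot (shiftLabel t h.z) g.x :=
  commute_iff _ _

theorem exists_row_bound (x : Label n) : ∃ L : ℕ, ∀ q, x q ≠ 0 → |q.2| ≤ L := by
  obtain ⟨L, hL⟩ := (⟨0, x, 0⟩ : Pauli n).exists_bound
  exact ⟨L, fun q hq => hL q (Or.inl hq)⟩

theorem exists_row_spans {x : Label n} {q : Qubit n} (h : x q ≠ 0) :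
    ∃ (s : ℤ) (d : ℕ), Spans (fun t => x (q.1, t)) s d := by
  obtain ⟨L, hL⟩ := exists_row_bound x
  obtain ⟨s, d, h, -⟩ := exists_spans (f := fun t => x (q.1, t)) (a := -L) (b := L) (t₀ := q.2)
    (fun t ht => abs_le.1 (hL _ ht)) h
  exact ⟨s, d, h⟩

/-- A self-orthogonal pair of sequences on a single stream has a common centre. -/
theorem centre_eq {g : Pauli n} {i : Fin n} (hx : ∀ q : Qubit n, q.1 ≠ i → g.x q = 0)
    (hcomm : ∀ t, g * Pauli.shift t g = Pauli.shift t g * g) {s s' : ℤ} {d d' : ℕ}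
    (h : Spans (fun t => g.x (i, t)) s d) (h' : Spans (fun t => g.z (i, t)) s' d') :
    2 * s + d = 2 * s' + d' := by
  obtain ⟨h1, h2, h3⟩ := h
  obtain ⟨h1', h2', h3'⟩ := h'
  simp only at h1 h2 h3 h1' h2' h3'
  have hx0 : ∀ t, ¬ (s ≤ t ∧ t ≤ s + d) → g.x (i, t) = 0 := fun t ht => by
    by_contra hne; exact ht (h3 t hne)
  have hz0 : ∀ t, ¬ (s' ≤ t ∧ t ≤ s' + d') → g.z (i, t) = 0 := fun t ht => by
    by_contra hne; exact ht (h3' t hne)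
  -- For a shift under which each of the two pairings has at most one nonzero term, commutation
  -- equates these two terms.
  have key : ∀ t u v, (∀ w, w ≠ u → g.z (i, w) = 0 ∨ g.x (i, w - t) = 0) →
      (∀ w, w ≠ v → g.z (i, w - t) = 0 ∨ g.x (i, w) = 0) →
      g.z (i, u) * g.x (i, u - t) = g.z (i, v - t) * g.x (i, v) := by
    intro t u v hu hv
    have e := (Pauli.commute_shift_iff g g t).1 (hcomm t)
    rw [dot_eq_mul (i, u), dot_eq_mul (i, v)] at e
    · simpa using e
    · rintro ⟨j, w⟩ hw
      by_cases hj : j = i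
      · subst hj
        rcases hv w (fun e => hw (by rw [e])) with h | h <;> simp [h]
      · simp [hx (j, w) hj]
    · rintro ⟨j, w⟩ hw
      by_cases hj : j = i
      · subst hj
        rcases hu w (fun e => hw (by rw [e])) with h | h <;> simp [h]
      · simp [hx (j, w - t) hj]
  rcases lt_trichotomy (2 * s + (d : ℤ)) (2 * s' + d') with hlt | heq | hlt
  · exfalso
    -- This shift puts the bottom of the X row on the top of the Z row. If the Z row has the larger
    -- centre, its own shifted copy lies wholly beyond the X row, so a nonzero term would equal
    -- zero.
    have := key (s' + d' - s) (s' + d') (s + d)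
      (fun w hw => by
        by_contra! hn
        have := h3' w hn.1
        have := h3 _ hn.2
        omega)
      (fun w hw => by
        by_contra! hn
        have := h3' _ hn.1
        have := h3 _ hn.2
        omega)
    rw [hz0 (s + d - (s' + d' - s)) (by omega), zero_mul,
      show s' + d' - (s' + d' - s) = s by ring] at this
    exact mul_ne_zero h2' h1 this
  · exact heq
  · exfalso
    -- The mirror case: the bottom of the shifted Z row meets the top of the X row, while the
    -- shifted X row lies beyond the Z row.
    have := key (s + d - s') (s' + d') (s + d)
      (fun w hw => by
        by_contra! hn
        have := h3' w hn.1
        have := h3 _ hn.2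
        omega)
      (fun w hw => by
        by_contra! hn
        have := h3' _ hn.1
        have := h3 _ hn.2
        omega)
    rw [hx0 (s' + d' - (s + d - s')) (by omega), mul_zero,
      show s + d - (s + d - s') = s' by ring] at this
    exact mul_ne_zero h1' h2 this.symm

/-! ### Row operations -/

section moves

variable {A : Set (Fin n)}

theorem exists_hadamard {i : Fin n} (hi : i ∈ A) : ∃ α ∈ elementary A, ∀ g q,
    ((α g).x q = if q.1 = i then g.z q else g.x q) ∧
    ((α g).z q = if q.1 = i then g.x q else g.z q) := by
  have hb := IsBasic.hadamard i hi
  obtain ⟨α, hα⟩ := hb.exists_lim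
  exact ⟨α, Subgroup.subset_closure ⟨_, hb, hα⟩, fun g q => hα.hadamard_apply g q⟩

/-- The offset `k` is split into its positive and negative parts so that both qubits of the gate lie
in blocks with nonnegative index. -/
theorem exists_cnot {i j : Fin n} (hi : i ∈ A) (hj : j ∈ A) (hij : i ≠ j) (k : ℤ) :
    ∃ α ∈ elementary A, ∀ g q,
    ((α g).x q = g.x q + if q.1 = j then g.x (i, q.2 - k) else 0) ∧
    ((α g).z q = g.z q + if q.1 = i then g.z (j, q.2 + k) else 0) := by
  have hb := IsBasic.cnot i j hi hj hij (-k).toNat k.toNat (by simp [hij])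
  obtain ⟨α, hα⟩ := hb.exists_lim
  refine ⟨α, Subgroup.subset_closure ⟨_, hb, hα⟩, fun g q => ?_⟩
  have := hα.cnot_apply g q hij
  have e1 : q.2 - (k.toNat : ℤ) + ((-k).toNat : ℤ) = q.2 - k := by omega
  have e2 : q.2 - ((-k).toNat : ℤ) + (k.toNat : ℤ) = q.2 + k := by omega
  rwa [e1, e2] at this

/-- A CSIGN gate is a CNOT gate conjugated by a Hadamard on the target. -/
theorem exists_csign {i j : Fin n} (hi : i ∈ A) (hj : j ∈ A) (hij : i ≠ j) (k : ℤ) :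
    ∃ α ∈ elementary A, ∀ g q, ((α g).x q = g.x q) ∧
    ((α g).z q = g.z q + (if q.1 = j then g.x (i, q.2 - k) else 0) +
      if q.1 = i then g.x (j, q.2 + k) else 0) := by
  obtain ⟨H, hH, hH'⟩ := exists_hadamard hj
  obtain ⟨C, hC, hC'⟩ := exists_cnot hi hj hij k
  refine ⟨H * C * H, mul_mem (mul_mem hH hC) hH, fun g q => ?_⟩
  simp only [MulAut.mul_apply, hH', hC', hij, if_false]
  by_cases h : q.1 = j
  · simp [h, hij.symm]
  · by_cases h' : q.1 = i <;> simp [h, h', hij]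

/-- This adds `(D ^ k + D ^ (-k))` times the X row to the Z row of the same stream. For `k = 0` that
sum would vanish, and the phase gate supplies the missing multiple `1`. -/
theorem exists_symmetric {i : Fin n} (hi : i ∈ A) (k : ℕ) :
    ∃ α ∈ elementary A, ∀ g q, ((α g).x q = g.x q) ∧
    ((α g).z q = g.z q + if q.1 = i then
      (if k = 0 then g.x (i, q.2) else g.x (i, q.2 - k) + g.x (i, q.2 + k)) else 0) := by
  by_cases hk : k = 0
  · have hb := IsBasic.phase i hi
    obtain ⟨α, hα⟩ := hb.exists_lim
    refine ⟨α, Subgroup.subset_closure ⟨_, hb, hα⟩, fun g q => ?_⟩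
    have := hα.phase_apply g q
    rw [if_pos hk]
    refine ⟨this.1, this.2.trans ?_⟩
    split_ifs with h
    · rw [← h]
    · rfl
  · have hb := IsBasic.csign i hi k (by omega) (by simpa [eq_comm] using hk)
    obtain ⟨α, hα⟩ := hb.exists_lim
    refine ⟨α, Subgroup.subset_closure ⟨_, hb, hα⟩, fun g q => ?_⟩
    rw [if_neg hk]
    exact hα.csign_apply g q

end moves

theorem elementary_apply_eq_self {A : Set (Fin n)} {E : MulAut (Pauli n)}
    (h : E ∈ elementary A) {g : Pauli n} (hg : ∀ q, g.Touches q → q.1 ∉ A) : E g = g := by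
  refine Subgroup.closure_induction (p := fun E _ => E g = g) ?_ rfl ?_ ?_ h
  · rintro α ⟨γ, hγ, hα⟩
    refine hα.apply_of_fixed fun t => Gate.conj_of_not_touches _ _ fun q hq hq' => hg q hq' ?_
    rw [Gate.mem_support_shift] at hq
    cases hγ with
    | hadamard i hi => simp [Gate.support] at hq; rwa [hq.1]
    | phase i hi => simp [Gate.support] at hq; rwa [hq.1]
    | cnot i j hi hj =>
      simp only [Gate.support, Set.mem_insert_iff, Set.mem_singleton_iff, Prod.mk.injEq] at hq
      rcases hq with h | h <;> rwa [h.1]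
    | csign i hi =>
      simp only [Gate.support, Set.mem_insert_iff, Set.mem_singleton_iff, Prod.mk.injEq] at hq
      rcases hq with h | h <;> rwa [h.1]
  · intro E E' _ _ h1 h2
    rw [MulAut.mul_apply, h2, h1]
  · intro E _ h1
    rw [← h1, MulAut.inv_apply_self, h1]

/-- By replicated gates on the streams in `A`, an operator that commutes with its shifts is brought
into a form in which it has on these streams only `Z` labels, and these on a single stream. -/
theorem exists_normal_form {A : Set (Fin n)} {g₀ : Pauli n}
    (hx : ∀ q : Qubit n, q.1 ∉ A → g₀.x q = 0) {q₀ : Qubit n} (hq₀ : q₀.1 ∈ A)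
    (htouch : g₀.Touches q₀) (hcomm : ∀ t, g₀ * Pauli.shift t g₀ = Pauli.shift t g₀ * g₀) :
    ∃ E ∈ elementary A, ∃ i ∈ A, (E g₀).x = 0 ∧
      (∀ q : Qubit n, q.1 ∈ A → q.1 ≠ i → (E g₀).z q = 0) ∧
      ∃ s d, Spans (fun t => (E g₀).z (i, t)) s d := by
  classical
  let orb : Set (Pauli n) := {g | ∃ E ∈ elementary A, E g₀ = g}
  have orb_mul : ∀ g ∈ orb, ∀ E ∈ elementary A, E g ∈ orb := by
    rintro _ ⟨E, hE, rfl⟩ E' hE'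
    exact ⟨E' * E, mul_mem hE' hE, rfl⟩
  have orb_x : ∀ g ∈ orb, ∀ q : Qubit n, q.1 ∉ A → g.x q = 0 := by
    rintro _ ⟨E, hE, rfl⟩ q hq
    rw [(elementary_apply_of_notMem hE g₀ q hq).1, hx q hq]
  have orb_comm : ∀ g ∈ orb, ∀ t, g * Pauli.shift t g = Pauli.shift t g * g := by
    rintro _ ⟨E, hE, rfl⟩ t
    have := (good_of_mem_elementary hE one_pos).shift t g₀
    simp only [Nat.cast_one, one_mul] at this
    rw [← this, ← map_mul, hcomm, map_mul]
  -- The possible sizes of nonzero X rows in the orbit of `g₀`; the pivot row realizes the least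
  -- one.
  let D : Set ℕ := {d | ∃ g ∈ orb, ∃ i ∈ A, ∃ s, Spans (fun t => g.x (i, t)) s d}
  have hD : D.Nonempty := by
    rcases htouch with h | h
    · obtain ⟨s, d, h⟩ := exists_row_spans h
      exact ⟨d, g₀, ⟨1, one_mem _, rfl⟩, q₀.1, hq₀, s, h⟩
    · obtain ⟨H, hH, hH'⟩ := exists_hadamard hq₀
      have : (H g₀).x q₀ ≠ 0 := by rw [(hH' _ _).1, if_pos rfl]; exact h
      obtain ⟨s, d, h⟩ := exists_row_spans this
      exact ⟨d, H g₀, ⟨H, hH, rfl⟩, q₀.1, hq₀, s, h⟩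
  obtain ⟨g₁, hg₁, i, hi, s, hs⟩ := Nat.sInf_mem hD
  have hmin : ∀ d ∈ D, sInf D ≤ d := fun d hd => Nat.sInf_le hd
  generalize sInf D = d at hs hmin
  -- A Hadamard turns a Z row into an X row, so the minimum also bounds the sizes of Z rows.
  have hminz : ∀ g ∈ orb, ∀ j ∈ A, ∀ s' d', Spans (fun t => g.z (j, t)) s' d' → d ≤ d' := by
    intro g hg j hj s' d' h
    obtain ⟨H, hH, hH'⟩ := exists_hadamard hj
    refine hmin d' ⟨H g, orb_mul g hg H hH, j, hj, s', ?_⟩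
    simpa only [(hH' _ _).1, if_true] using h
  -- A remainder confined to `d` consecutive blocks would have size less than `d`, contrary to
  -- minimality unless it is zero.
  have vanish : ∀ f : ℤ → ZMod 2, (∀ t, f t ≠ 0 → 0 ≤ t ∧ t < d) →
      (∀ s' d', Spans f s' d' → d ≤ d') → ∀ t, f t = 0 := by
    intro f hf hf' t
    by_contra hne
    obtain ⟨s', d', h1, h2, h3⟩ := exists_spans (a := 0) (b := d - 1)
      (fun t ht => ⟨(hf t ht).1, by have := (hf t ht).2; omega⟩) hne
    have := hf' s' d' h1
    omega
  -- CNOT gates controlled by the pivot stream clear the X rows of the other streams in `A`, one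
  -- stream at a time.
  have stepA : ∀ J : Finset (Fin n), (∀ j ∈ J, j ∈ A ∧ j ≠ i) → ∃ g ∈ orb,
      (∀ t, g.x (i, t) = g₁.x (i, t)) ∧ ∀ j ∈ J, ∀ t, g.x (j, t) = 0 := by
    intro J
    induction J using Finset.induction_on with
    | empty => exact fun _ => ⟨g₁, hg₁, fun _ => rfl, by simp⟩
    | insert j J hjJ ih =>
      intro hJ
      obtain ⟨g, hg, h1, h2⟩ := ih fun j' hj' => hJ j' (Finset.mem_insert_of_mem hj')
      obtain ⟨hjA, hji⟩ := hJ j (Finset.mem_insert_self _ _)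
      obtain ⟨L, hL⟩ := exists_row_bound g.x
      obtain ⟨f', ⟨g', hg', h1', h2', hf'⟩, hf''⟩ := exists_reduced hs
        (Q := fun f => ∃ g ∈ orb, (∀ t, g.x (i, t) = g₁.x (i, t)) ∧
          (∀ j ∈ J, ∀ t, g.x (j, t) = 0) ∧ ∀ t, g.x (j, t) = f t)
        (by
          rintro f k ⟨g, hg, h1, h2, h3⟩
          obtain ⟨C, hC, hC'⟩ := exists_cnot hi hjA hji.symm k
          refine ⟨C g, orb_mul g hg C hC, fun t => ?_, fun j' hj' t => ?_, fun t => ?_⟩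
          · rw [(hC' _ _).1, h1]; simp [hji.symm]
          · have : j' ≠ j := fun e => hjJ (e ▸ hj')
            rw [(hC' _ _).1, h2 j' hj']; simp [this]
          · rw [(hC' _ _).1, h3]; simp [h1])
        (f := fun t => g.x (j, t)) ⟨g, hg, h1, h2, fun _ => rfl⟩ (L := L) fun t ht => hL _ ht
      refine ⟨g', hg', h1', fun j' hj' => ?_⟩
      rcases Finset.mem_insert.1 hj' with rfl | hj'
      · intro t
        rw [hf']
        refine vanish f' hf'' (fun s' d' h => hmin d' ⟨g', hg', j', hjA, s', ?_⟩) t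
        simpa only [hf'] using h
      · exact h2' j' hj'
  obtain ⟨g₂, hg₂, hx₂, hx₂'⟩ := stepA {j | j ∈ A ∧ j ≠ i} (by simp)
  -- CSIGN gates between the pivot stream and stream `j` clear the Z rows off the pivot. They may
  -- alter nothing among the X rows, and the Z row of the pivot is not tracked here.
  have stepB : ∀ J : Finset (Fin n), (∀ j ∈ J, j ∈ A ∧ j ≠ i) → ∃ g ∈ orb,
      (∀ q, g.x q = g₂.x q) ∧ ∀ j ∈ J, ∀ t, g.z (j, t) = 0 := by
    intro J
    induction J using Finset.induction_on with
    | empty => exact fun _ => ⟨g₂, hg₂, fun _ => rfl, by simp⟩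
    | insert j J hjJ ih =>
      intro hJ
      obtain ⟨g, hg, h1, h2⟩ := ih fun j' hj' => hJ j' (Finset.mem_insert_of_mem hj')
      obtain ⟨hjA, hji⟩ := hJ j (Finset.mem_insert_self _ _)
      obtain ⟨L, hL⟩ := exists_row_bound g.z
      obtain ⟨f', ⟨g', hg', h1', h2', hf'⟩, hf''⟩ := exists_reduced hs
        (Q := fun f => ∃ g ∈ orb, (∀ q, g.x q = g₂.x q) ∧
          (∀ j ∈ J, ∀ t, g.z (j, t) = 0) ∧ ∀ t, g.z (j, t) = f t)
        (by
          rintro f k ⟨g, hg, h1, h2, h3⟩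
          obtain ⟨C, hC, hC'⟩ := exists_csign hi hjA hji.symm k
          refine ⟨C g, orb_mul g hg C hC, fun q => ?_, fun j' hj' t => ?_, fun t => ?_⟩
          · rw [(hC' _ _).1, h1]
          · have hne : j' ≠ j := fun e => hjJ (e ▸ hj')
            have hne' : j' ≠ i := (hJ j' (Finset.mem_insert_of_mem hj')).2
            rw [(hC' _ _).2, h2 j' hj']; simp [hne, hne']
          · rw [(hC' _ _).2, h3]; simp [h1, hx₂, hji])
        (f := fun t => g.z (j, t)) ⟨g, hg, h1, h2, fun _ => rfl⟩ (L := L) fun t ht => hL _ ht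
      refine ⟨g', hg', h1', fun j' hj' => ?_⟩
      rcases Finset.mem_insert.1 hj' with rfl | hj'
      · intro t
        rw [hf']
        refine vanish f' hf'' (fun s' d' h => hminz g' hg' j' hjA s' d' ?_) t
        simpa only [hf'] using h
      · exact h2' j' hj'
  obtain ⟨g₃, hg₃, hx₃, hz₃⟩ := stepB {j | j ∈ A ∧ j ≠ i} (by simp)
  have hx₂'' : ∀ q : Qubit n, q.1 ≠ i → g₂.x q = 0 := by
    intro q hq
    by_cases hA : q.1 ∈ A
    · exact hx₂' q.1 (by simp [hA, hq]) q.2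
    · exact orb_x g₂ hg₂ q hA
  have hspan : Spans (fun t => g₂.x (i, t)) s d := by simpa only [hx₂] using hs
  -- The Z row of the pivot is cleared by induction on a strict bound for its size; bound `0` means
  -- that the row is zero.
  have stepC : ∀ d' : ℕ, ∀ g ∈ orb, (∀ q, g.x q = g₂.x q) →
      (∀ q : Qubit n, q.1 ∈ A → q.1 ≠ i → g.z q = 0) →
      (∀ s'' d'', Spans (fun t => g.z (i, t)) s'' d'' → d'' < d') →
      ∃ g ∈ orb, (∀ q, g.x q = g₂.x q) ∧ ∀ q : Qubit n, q.1 ∈ A → g.z q = 0 := by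
    intro d'
    induction d' with
    | zero =>
      intro g hg h1 h2 h3
      refine ⟨g, hg, h1, fun q hq => ?_⟩
      by_cases hqi : q.1 = i
      · by_contra hne
        obtain ⟨s'', d'', h⟩ := exists_row_spans hne
        rw [hqi] at h
        exact absurd (h3 _ _ h) (by omega)
      · exact h2 q hq hqi
    | succ d' ih =>
      intro g hg h1 h2 h3
      by_cases hsp : ∃ s'', Spans (fun t => g.z (i, t)) s'' d'
      · obtain ⟨s', hs'⟩ := hsp
        have hxs : Spans (fun t => g.x (i, t)) s d := by simpa only [h1] using hspan
        have hle := hminz g hg i hi s' d' hs'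
        have hcen := centre_eq (fun q hq => by rw [h1, hx₂'' q hq]) (orb_comm g hg) hxs hs'
        obtain ⟨C, hC, hC'⟩ := exists_symmetric hi ((d' - d) / 2)
        -- Equal centres make `d' - d` even, and minimality makes it nonnegative. The symmetric move
        -- with half the difference aligns the outer ends of the two shifted X rows with the ends of
        -- the Z row.
        have hk : (d' : ℤ) = d + 2 * (((d' - d) / 2 : ℕ) : ℤ) := by omega
        generalize (d' - d) / 2 = k at hC' hk
        refine ih (C g) (orb_mul g hg C hC) (fun q => by rw [(hC' _ _).1, h1])
          (fun q hq hqi => by rw [(hC' _ _).2, h2 q hq hqi]; simp [hqi]) ?_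
        intro s'' d'' h''
        simp only [(hC' _ _).2, if_true] at h''
        obtain ⟨hx1, hx2, hx3⟩ := hxs
        obtain ⟨hz1, hz2, hz3⟩ := hs'
        simp only at hx1 hx2 hx3 hz1 hz2 hz3
        have hx0 : ∀ t, ¬ (s ≤ t ∧ t ≤ s + d) → g.x (i, t) = 0 := fun t ht => by
          by_contra hne; exact ht (hx3 t hne)
        have hz0 : ∀ t, ¬ (s' ≤ t ∧ t ≤ s' + d') → g.z (i, t) = 0 := fun t ht => by
          by_contra hne; exact ht (hz3 t hne)
        have hs'k : s' = s - k := by omega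
        -- Both end terms of the Z row cancel, so its size drops strictly.
        have inner : ∀ t, g.z (i, t) + (if k = 0 then g.x (i, t)
            else g.x (i, t - k) + g.x (i, t + k)) ≠ 0 → s' < t ∧ t < s' + d' := by
          intro t ht
          by_contra hn
          apply ht
          by_cases hk0 : k = 0
          · subst hk0
            rw [if_pos rfl]
            by_cases e1 : t = s'
            · have : s' = s := by omega
              rw [e1, eq_one_of_ne_zero hz1, this, eq_one_of_ne_zero hx1]; decide
            · by_cases e2 : t = s' + d'
              · have : s' + d' = s + d := by omega
                rw [e2, eq_one_of_ne_zero hz2, this, eq_one_of_ne_zero hx2]; decide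
              · rw [hz0 t (by omega), hx0 t (by omega), add_zero]
          · rw [if_neg hk0]
            by_cases e1 : t = s'
            · have : t + k = s := by omega
              rw [e1] at this
              rw [e1, eq_one_of_ne_zero hz1, this, eq_one_of_ne_zero hx1,
                hx0 (s' - k) (by omega)]; decide
            · by_cases e2 : t = s' + d'
              · have : t - k = s + d := by omega
                rw [e2] at this
                rw [e2, eq_one_of_ne_zero hz2, this, eq_one_of_ne_zero hx2,
                  hx0 (s' + d' + k) (by omega)]; decide
              · rw [hz0 t (by omega), hx0 (t - k) (by omega), hx0 (t + k) (by omega), add_zero,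
                  add_zero]
        have i1 := inner _ h''.1
        have i2 := inner _ h''.2.1
        omega
      · refine ih g hg h1 h2 fun s'' d'' h'' => ?_
        have := h3 s'' d'' h''
        have : d'' ≠ d' := fun e => hsp ⟨s'', e ▸ h''⟩
        omega
  obtain ⟨g₄, hg₄, hx₄, hz₄⟩ : ∃ g ∈ orb, (∀ q, g.x q = g₂.x q) ∧
      ∀ q : Qubit n, q.1 ∈ A → g.z q = 0 := by
    have hz : ∀ q : Qubit n, q.1 ∈ A → q.1 ≠ i → g₃.z q = 0 :=
      fun q hq hqi => hz₃ q.1 (by simp [hq, hqi]) q.2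
    by_cases h : ∃ s' d', Spans (fun t => g₃.z (i, t)) s' d'
    · obtain ⟨L, hL⟩ := exists_row_bound g₃.z
      refine stepC (2 * L + 1) g₃ hg₃ hx₃ hz fun s'' d'' h'' => ?_
      have h1 := abs_le.1 (hL _ h''.1)
      have h2 := abs_le.1 (hL _ h''.2.1)
      simp only at h1 h2
      omega
    · push Not at h
      exact stepC 0 g₃ hg₃ hx₃ hz fun s'' d'' h'' => absurd h'' (h s'' d'')
  -- Only the pivot X row is left on the streams in `A`; a Hadamard makes it the Z row.
  obtain ⟨H, hH, hH'⟩ := exists_hadamard hi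
  obtain ⟨E, hE, rfl⟩ := hg₄
  refine ⟨H * E, mul_mem hH hE, i, hi, ?_, ?_, s, d, ?_⟩
  · ext1 q
    rw [MulAut.mul_apply, (hH' _ _).1]
    split_ifs with h
    · exact hz₄ q (h ▸ hi)
    · rw [hx₄, hx₂'' q h]; rfl
  · intro q hq hqi
    rw [MulAut.mul_apply, (hH' _ _).2, if_neg hqi, hz₄ q hq]
  · simpa only [MulAut.mul_apply, (hH' _ _).2, if_true, hx₄] using hspan

/-! ### Reduction of a stabilizer group -/

/-- The operator is, up to a phase, a product of Pauli matrices `Z` on the streams in `I`. -/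
def Pauli.IsZOn (I : Finset (Fin n)) (g : Pauli n) : Prop :=
  g.x = 0 ∧ ∀ q : Qubit n, g.z q ≠ 0 → q.1 ∈ I

/-- Modulo labels of elements of `S`, all `Z` labels on the streams in `I` are supported on a fixed
finite set of blocks. -/
def IsCofinite (S : Subgroup (Pauli n)) (I : Finset (Fin n)) : Prop :=
  ∃ L : ℕ, ∀ z : Label n, (∀ q, z q ≠ 0 → q.1 ∈ I) →
    ∃ g ∈ S, g.IsZOn I ∧ ∀ q, (z + g.z) q ≠ 0 → |q.2| ≤ L

theorem Pauli.IsZOn.mul {I : Finset (Fin n)} {g h : Pauli n} (hg : g.IsZOn I) (hh : h.IsZOn I) :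
    (g * h).IsZOn I := by
  refine ⟨by rw [mul_x, hg.1, hh.1, add_zero], fun q hq => ?_⟩
  by_contra hn
  have h1 : g.z q = 0 := by by_contra h; exact hn (hg.2 q h)
  have h2 : h.z q = 0 := by by_contra h; exact hn (hh.2 q h)
  exact hq (by rw [mul_z, Finsupp.add_apply, h1, h2, add_zero])

theorem Pauli.IsZOn.shift {I : Finset (Fin n)} {g : Pauli n} (hg : g.IsZOn I) (j : ℤ) :
    (shift j g).IsZOn I :=
  ⟨by rw [shift_x', hg.1, shiftLabel_zero], fun q hq => hg.2 (q.1, q.2 - j) (by simpa using hq)⟩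

theorem Pauli.IsZOn.mono {I J : Finset (Fin n)} (h : I ⊆ J) {g : Pauli n} (hg : g.IsZOn I) :
    g.IsZOn J := ⟨hg.1, fun q hq => h (hg.2 q hq)⟩

/-- Induction on the number of streams outside `I`. The streams in `I` are finished: they carry no X
labels, and division by the pivots found so far bounds their Z labels modulo the group. -/
theorem exists_isZOn_of_card (m : ℕ) : ∀ (S : Subgroup (Pauli n)) (I : Finset (Fin n)),
    Iᶜ.card = m → (∀ g ∈ S, ∀ h ∈ S, g * h = h * g) → (∀ g ∈ S, ∀ j, Pauli.shift j g ∈ S) →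
    (∀ g ∈ S, ∀ q : Qubit n, q.1 ∈ I → g.x q = 0) → IsCofinite S I →
    ∃ E ∈ elementary (Set.univ : Set (Fin n)), ∃ J : Finset (Fin n),
      (∀ g ∈ S.map E.toMonoidHom, g.IsZOn J) ∧ IsCofinite (S.map E.toMonoidHom) J := by
  induction m with
  | zero =>
    intro S I hI _ _ hx hcof
    rw [Finset.card_eq_zero, Finset.compl_eq_empty_iff] at hI
    subst hI
    refine ⟨1, one_mem _, Finset.univ, ?_, ?_⟩
    · rintro _ ⟨g, hg, rfl⟩
      exact ⟨Finsupp.ext fun q => hx g hg q (Finset.mem_univ _), fun _ _ => Finset.mem_univ _⟩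
    · convert hcof
      exact Subgroup.map_id S
  | succ m ih =>
    intro S I hI hcomm hshift hx hcof
    by_cases hall : ∀ g ∈ S, ∀ q : Qubit n, q.1 ∉ I → ¬ g.Touches q
    · refine ⟨1, one_mem _, I, ?_, ?_⟩
      · rintro _ ⟨g, hg, rfl⟩
        refine ⟨Finsupp.ext fun q => ?_, fun q hq => ?_⟩
        · by_cases hq : q.1 ∈ I
          · exact hx g hg q hq
          · exact (Pauli.not_touches.1 (hall g hg q hq)).1
        · by_contra hn
          exact hall g hg q hn (Or.inr hq)
      · convert hcof
        exact Subgroup.map_id S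
    · push Not at hall
      obtain ⟨g₀, hg₀, q₀, hq₀, htouch⟩ := hall
      obtain ⟨E, hE, i, hi, hEx, hEz, s, d, hspan⟩ := exists_normal_form
        (A := {i | i ∉ I}) (g₀ := g₀) (fun q hq => hx g₀ hg₀ q (by simpa using hq)) hq₀ htouch
        (fun t => hcomm _ hg₀ _ (hshift _ hg₀ t))
      have hiI : i ∉ I := hi
      have hgood := good_of_mem_elementary hE one_pos
      set S₁ := S.map E.toMonoidHom with hS₁
      have hmem : ∀ g ∈ S, E g ∈ S₁ := fun g hg => ⟨g, hg, rfl⟩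
      have hcomm₁ : ∀ g ∈ S₁, ∀ h ∈ S₁, g * h = h * g := by
        rintro _ ⟨g, hg, rfl⟩ _ ⟨h, hh, rfl⟩
        rw [← map_mul, hcomm g hg h hh, map_mul]
      have hshift₁ : ∀ g ∈ S₁, ∀ j, Pauli.shift j g ∈ S₁ := by
        rintro _ ⟨g, hg, rfl⟩ j
        have := hgood.shift j g
        simp only [Nat.cast_one, one_mul] at this
        change Pauli.shift j (E g) ∈ S₁
        rw [← this]
        exact hmem _ (hshift g hg j)
      have hxI : ∀ g ∈ S₁, ∀ q : Qubit n, q.1 ∈ I → g.x q = 0 := by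
        rintro _ ⟨g, hg, rfl⟩ q hq
        change (E g).x q = 0
        rw [(elementary_apply_of_notMem hE g q (by simpa using hq)).1, hx g hg q hq]
      have hg₁ : (E g₀).IsZOn (insert i I) := by
        refine ⟨hEx, fun q hq => ?_⟩
        by_contra hn
        rw [Finset.mem_insert, not_or] at hn
        exact hq (hEz q hn.2 hn.1)
      -- If the X row of `g` on stream `i` were nonzero, shift the pivot so that its top Z term
      -- meets the bottom term of that row. This is the only nonzero term in the pairing, so the two
      -- operators would anticommute.
      have hxi : ∀ g ∈ S₁, ∀ t, g.x (i, t) = 0 := by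
        intro g hg t
        by_contra hne
        obtain ⟨s', d', h1, h2, h3⟩ := exists_row_spans hne
        obtain ⟨h4, h5, h6⟩ := hspan
        have e := (Pauli.commute_shift_iff g (E g₀) (s' - (s + d))).1
          (hcomm₁ _ hg _ (hshift₁ _ (hmem _ hg₀) _))
        rw [hEx, shiftLabel_zero, dot_zero_right, dot_eq_mul (i, s')] at e
        · rw [shiftLabel_apply] at e
          simp only [sub_sub_cancel] at e
          exact mul_ne_zero h5 h1 e.symm
        · rintro ⟨j, w⟩ hw
          rw [shiftLabel_apply]
          by_cases hj : j = i
          · subst hj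
            by_contra hn
            obtain ⟨hn1, hn2⟩ := mul_ne_zero_iff.1 hn
            have h7 := h3 w hn2
            have h8 := h6 _ hn1
            exact hw (by congr 1; omega)
          · by_cases hjI : j ∈ I
            · rw [hxI g hg _ hjI, mul_zero]
            · rw [hEz (j, _) (by simpa using hjI) hj, zero_mul]
      obtain ⟨E', hE', J, hJ, hJ'⟩ := ih S₁ (insert i I) (by
          rw [Finset.compl_insert, Finset.card_erase_of_mem (by simpa using hiI), hI]; rfl)
        hcomm₁ hshift₁ (by
          intro g hg q hq
          rcases Finset.mem_insert.1 hq with h | h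
          · rw [← hxi g hg q.2, ← h]
          · exact hxI g hg q h) (by
          -- First divide the row on stream `i` by the pivot, leaving fewer than `d + 1` blocks;
          -- then reduce the streams in `I` by the old bound, which does not touch stream `i`.
          obtain ⟨L, hL⟩ := hcof
          refine ⟨max L d, fun z hz => ?_⟩
          obtain ⟨K, hK⟩ := exists_row_bound z
          obtain ⟨f', ⟨h, hh, hhZ, hf'⟩, hf''⟩ := exists_reduced hspan
            (Q := fun f => ∃ h ∈ S₁, h.IsZOn (insert i I) ∧ ∀ t, (z + h.z) (i, t) = f t)
            (by
              rintro f j ⟨h, hh, hhZ, hf⟩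
              refine ⟨h * Pauli.shift j (E g₀), mul_mem hh (hshift₁ _ (hmem _ hg₀) j),
                hhZ.mul (hg₁.shift j), fun t => ?_⟩
              simp only [← hf]
              rw [Pauli.mul_z, ← add_assoc, Finsupp.add_apply, Pauli.shift_z])
            (f := fun t => z (i, t)) ⟨1, one_mem _, ⟨rfl, fun q hq => absurd rfl hq⟩,
              fun t => by simp⟩ (L := K) fun t ht => hK _ ht
          have hsupp : ∀ q : Qubit n, (z + h.z) q ≠ 0 → q.1 ∈ insert i I := by
            intro q hq
            by_contra hn
            have h1 : z q = 0 := by by_contra h; exact hn (hz q h)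
            have h2 : h.z q = 0 := by by_contra h; exact hn (hhZ.2 q h)
            exact hq (by rw [Finsupp.add_apply, h1, h2, add_zero])
          obtain ⟨g, hg, hgZ, hgL⟩ := hL ((z + h.z).filter fun q => q.1 ∈ I) (by
            intro q hq
            by_contra hn
            exact hq (Finsupp.filter_apply_neg _ _ hn))
          -- The old reductions lie in `S`, but `E` acts only on streams outside `I`, so they lie in
          -- `S₁` as well.
          have hEg : E g = g := elementary_apply_eq_self hE (by
            intro q hq
            rcases hq with hq | hq
            · exact absurd (by rw [hgZ.1]; rfl) hq
            · simpa using hgZ.2 q hq)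
          refine ⟨h * g, mul_mem hh (hEg ▸ hmem g hg),
            hhZ.mul (hgZ.mono (Finset.subset_insert _ _)), fun q hq => ?_⟩
          rw [Pauli.mul_z, ← add_assoc] at hq
          push_cast
          by_cases hqI : q.1 ∈ I
          · exact le_trans (hgL q (by
              rwa [Finsupp.add_apply, Finsupp.filter_apply_pos (fun q : Qubit n => q.1 ∈ I) _ hqI, ← Finsupp.add_apply]))
              (le_max_left _ _)
          · have h1 : g.z q = 0 := by by_contra h; exact hqI (hgZ.2 q h)
            rw [Finsupp.add_apply, h1, add_zero] at hq
            have h2 : q.1 = i := (Finset.mem_insert.1 (hsupp q hq)).resolve_right hqI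
            have h3 := hf'' q.2 (by rw [← hf', ← h2]; exact hq)
            refine le_trans ?_ (le_max_right _ _)
            rw [abs_le]
            omega)
      refine ⟨E' * E, mul_mem hE' (elementary_mono (Set.subset_univ _) hE), J, ?_⟩
      have : S.map (E' * E).toMonoidHom = S₁.map E'.toMonoidHom := by
        rw [hS₁, Subgroup.map_map]; rfl
      rw [this]
      exact ⟨hJ, hJ'⟩

/-- A commutative shift-invariant group of operators is mapped by replicated gates to a group of
signed products of `Z` on certain streams, which has finite index in the group of all of them. -/
theorem exists_isZOn {S : Subgroup (Pauli n)} (hcomm : ∀ g ∈ S, ∀ h ∈ S, g * h = h * g)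
    (hshift : ∀ g ∈ S, ∀ j, Pauli.shift j g ∈ S) :
    ∃ E ∈ elementary (Set.univ : Set (Fin n)), ∃ J : Finset (Fin n),
      (∀ g ∈ S.map E.toMonoidHom, g.IsZOn J) ∧ IsCofinite (S.map E.toMonoidHom) J := by
  -- With no finished stream, only the zero label has to be reduced.
  refine exists_isZOn_of_card _ S ∅ rfl hcomm hshift (by simp)
    ⟨0, fun z hz => ⟨1, one_mem _, ⟨rfl, fun q hq => absurd rfl hq⟩, fun q hq => ?_⟩⟩
  exact absurd (hz q (by simpa using hq)) (Finset.notMem_empty _)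

/-! ### Changes of signs -/

theorem addMonoidHom_label_ext {M : Type*} [AddMonoid M] {χ ψ : Label n →+ M}
    (h : ∀ q, χ (Finsupp.single q 1) = ψ (Finsupp.single q 1)) : χ = ψ := by
  have two : ∀ a : ZMod 2, a = 0 ∨ a = 1 := by decide
  refine Finsupp.addHom_ext fun q a => ?_
  rcases two a with rfl | rfl
  · rw [Finsupp.single_zero, map_zero, map_zero]
  · exact h q

/-- The automorphism that multiplies a Pauli operator with labels `x`, `z` by `(-1) ^ χ z`. -/
def flip (χ : Label n →+ ZMod 2) : MulAut (Pauli n) where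
  toFun g := ⟨g.phase + signPhase (χ g.z), g.x, g.z⟩
  invFun g := ⟨g.phase + signPhase (χ g.z), g.x, g.z⟩
  left_inv g := by
    ext1
    · simp only [add_assoc, signPhase_add_self, add_zero]
    · rfl
    · rfl
  right_inv g := by
    ext1
    · simp only [add_assoc, signPhase_add_self, add_zero]
    · rfl
    · rfl
  map_mul' g h := by
    ext1
    · simp only [Pauli.mul_phase, Pauli.mul_z, map_add, signPhase_add]; ring
    · rfl
    · rfl

theorem flip_apply (χ : Label n →+ ZMod 2) (g : Pauli n) :
    flip χ g = ⟨g.phase + signPhase (χ g.z), g.x, g.z⟩ := rfl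

theorem flip_zero : flip (0 : Label n →+ ZMod 2) = 1 := by
  ext1 g
  rw [flip_apply]
  ext1 <;> simp [signPhase_zero]

theorem flip_add (χ ψ : Label n →+ ZMod 2) : flip (χ + ψ) = flip χ * flip ψ := by
  ext1 g
  rw [MulAut.mul_apply, flip_apply, flip_apply, flip_apply]
  ext1
  · simp only [AddMonoidHom.add_apply, signPhase_add]; ring
  · rfl
  · rfl

theorem flip_inv (χ : Label n →+ ZMod 2) : (flip χ)⁻¹ = flip χ := by
  rw [inv_eq_iff_mul_eq_one, ← flip_add, ← flip_zero]
  congr 1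
  ext z
  simp [CharTwo.add_self_eq_zero]

open Classical in
/-- The number (mod 2) of entries of a label on stream `i` in blocks congruent to `r` mod `p`. -/
def residueCount (p : ℕ) (i : Fin n) (r : ℕ) : Label n →+ ZMod 2 :=
  Finsupp.liftAddHom fun q => if q.1 = i ∧ (p : ℤ) ∣ q.2 - r then AddMonoidHom.id _ else 0

open Classical in
theorem residueCount_single (p : ℕ) (i : Fin n) (r : ℕ) (q : Qubit n) :
    residueCount p i r (Finsupp.single q 1) = if q.1 = i ∧ (p : ℤ) ∣ q.2 - r then 1 else 0 := by
  rw [residueCount, Finsupp.liftAddHom_apply_single]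
  split_ifs <;> rfl

theorem isLim_flip_residueCount {p : ℕ} (hp : 0 < p) (i : Fin n) (r : ℕ) :
    IsLim (replicas p (.pauliX (i, r))) (flip (residueCount p i r)) := by
  have hw : (Gate.pauliX (i, (r : ℤ)) : Gate n).Within r := by
    intro q hq
    rw [Gate.support, Set.mem_singleton_iff] at hq
    subst hq
    simp
  have hc : ∀ s t : ℤ, Commute (replicas p (Gate.pauliX (i, (r : ℤ)))  s)
      (replicas p (Gate.pauliX (i, (r : ℤ))) t) := by
    intro s t
    by_cases hst : s = t
    · rw [hst]
    · apply Gate.commute_act_of_disjoint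
      simpa [Gate.shift, Gate.support, hp.ne'] using hst
  obtain ⟨α, hα⟩ := exists_isLim hc (locallyFinite_replicas hp hw)
  have key : α.toMonoidHom = (flip (residueCount p i r)).toMonoidHom := by
    apply Pauli.hom_ext
    · intro c
      change α _ = flip _ _
      rw [hα.apply_of_fixed fun t => by rw [replicas_apply, Gate.conj_scalar], flip_apply]
      ext1
      · simp [Pauli.scalar, signPhase_zero]
      · rfl
      · rfl
    · intro q
      change α _ = flip _ _
      rw [hα.apply_of_fixed, flip_apply]
      · ext1
        · simp [Pauli.X, signPhase_zero]
        · rfl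
        · rfl
      · intro t
        rw [replicas_apply, Gate.shift, Gate.conj]
        ext1
        · simp [Pauli.X, signPhase_zero]
        · rfl
        · rfl
    · intro q
      change α _ = flip _ _
      have fix : ∀ t : ℤ, q ≠ (i, r + p * t) →
          replicas p (.pauliX (i, r)) t (Pauli.Z q) = Pauli.Z q := by
        intro t ht
        rw [replicas_apply]
        apply Gate.conj_of_not_touches
        intro q' hq' h
        simp only [Gate.shift, Gate.support, Set.mem_singleton_iff] at hq'
        exact ht ((touches_Z h).symm.trans hq')
      rw [flip_apply]
      by_cases h : q.1 = i ∧ (p : ℤ) ∣ q.2 - r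
      · obtain ⟨h1, t, ht⟩ := h
        have hq : q = (i, r + p * t) := Prod.ext h1 (by simp only; omega)
        rw [hα.apply_of_fixed_ne hc t, replicas_apply, Gate.shift, Gate.conj]
        · ext1
          · simp only [Pauli.Z]
            rw [residueCount_single, if_pos ⟨h1, t, ht⟩, ← hq, Finsupp.single_eq_same]
          · rfl
          · rfl
        · intro s hs
          apply fix
          rw [hq]
          simpa [hp.ne'] using hs.symm
      · rw [hα.apply_of_fixed]
        · ext1
          · simp only [Pauli.Z]
            rw [residueCount_single, if_neg h, signPhase_zero, add_zero]
          · rfl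
          · rfl
        · intro t
          apply fix
          rintro rfl
          exact h ⟨rfl, t, by ring⟩
  have : α = flip (residueCount p i r) := by
    ext1 g
    exact DFunLike.congr_fun key g
  exact this ▸ hα

theorem good_flip_residueCount {p : ℕ} (hp : 0 < p) (i : Fin n) (r : ℕ) :
    Good p (flip (residueCount p i r)) where
  scalar c := by
    rw [flip_apply]
    ext1
    · simp [Pauli.scalar, signPhase_zero]
    · rfl
    · rfl
  spread := ⟨0, fun g q hq => ⟨q, hq, by simp⟩⟩
  shift j g := (isLim_flip_residueCount hp i r).apply_shift j g
  nonCatastrophic := by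
    classical
    have h := isLim_flip_residueCount hp i r
    refine isNonCatastrophic_of_isLim (γ := fun t => (Gate.pauliX (i, (r : ℤ))).shift (p * t))
      (K := Set.univ) ?_ (by simp only [Set.mem_univ, if_true]; exact h)
    intro s _ t _ hst
    simpa [Gate.shift, Gate.support, hp.ne'] using hst
  shiftInvariant := ⟨[flip (residueCount p i r)], by simp, fun β hβ => by
    rw [List.mem_singleton] at hβ
    subst hβ
    exact Or.inr ⟨_, isReplicated_of_isLim (isLim_flip_residueCount hp i r)⟩⟩
  online := isOnline_of_isLim (m := r) hp (by
    intro q hq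
    rw [Gate.support, Set.mem_singleton_iff] at hq
    subst hq
    simp) (isLim_flip_residueCount hp i r)

/-- A character of period `p` is determined by its values on the qubits in blocks `0, …, p - 1`. It
is the sum of the residue counts at those qubits where it equals `1`, each of which is one
replicated Pauli `X`. -/
theorem good_flip {p : ℕ} (hp : 0 < p) (χ : Label n →+ ZMod 2)
    (hχ : ∀ q : Qubit n, χ (Finsupp.single (q.1, q.2 + p) 1) = χ (Finsupp.single q 1)) :
    Good p (flip χ) := by
  classical
  have hper : ∀ (k : ℤ) (q : Qubit n),
      χ (Finsupp.single (q.1, q.2 + p * k) 1) = χ (Finsupp.single q 1) := by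
    intro k q
    induction k using Int.induction_on with
    | zero => simp
    | succ k ih => rw [← ih, ← hχ (q.1, q.2 + p * k)]; congr 3; push_cast; ring
    | pred k ih => rw [← ih, ← hχ (q.1, q.2 + p * (-k - 1))]; congr 3; push_cast; ring
  have hsum : ∀ F : Finset (Fin n × ℕ), Good p (flip (∑ a ∈ F, residueCount p a.1 a.2)) := by
    intro F
    induction F using Finset.induction_on with
    | empty => rw [Finset.sum_empty, flip_zero]; exact Good.one p
    | insert a F ha ih =>
      rw [Finset.sum_insert ha, flip_add]
      exact (good_flip_residueCount hp _ _).mul hp ih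
  have : χ = ∑ a ∈ (Finset.univ ×ˢ Finset.range p).filter
      (fun a : Fin n × ℕ => χ (Finsupp.single (a.1, (a.2 : ℤ)) 1) = 1),
      residueCount p a.1 a.2 := by
    apply addMonoidHom_label_ext
    intro q
    have hp' : (0 : ℤ) < p := by exact_mod_cast hp
    have hr0 := Int.emod_nonneg q.2 hp'.ne'
    have hr1 := Int.emod_lt_of_pos q.2 hp'
    have hrq : q.2 = ((q.2 % p).toNat : ℤ) + p * (q.2 / p) := by
      rw [Int.toNat_of_nonneg hr0, Int.emod_add_mul_ediv]
    have hlt : (q.2 % p).toNat < p := by omega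
    generalize (q.2 % p).toNat = r at hrq hlt
    generalize q.2 / p = t at hrq
    have hq : χ (Finsupp.single q 1) = χ (Finsupp.single (q.1, (r : ℤ)) 1) := by
      rw [← hper t (q.1, r)]
      simp only
      rw [← hrq]
    rw [AddMonoidHom.finsetSum_apply, Finset.sum_filter, Finset.sum_eq_single (q.1, r)]
    · have h1 : residueCount p (q.1, r).1 (q.1, r).2 (Finsupp.single q 1) = 1 := by
        rw [residueCount_single]
        exact if_pos ⟨rfl, t, by simp only; omega⟩
      rw [h1, hq]
      split_ifs with h
      · exact h
      · by_contra hne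
        exact h (eq_one_of_ne_zero hne)
    · rintro ⟨i, r'⟩ hmem hne
      rw [residueCount_single]
      split_ifs with h1 h2
      · exfalso
        apply hne
        obtain ⟨h2, h3⟩ := h2
        simp only [Finset.mem_product, Finset.mem_range] at hmem
        have h4 : (p : ℤ) ∣ r - r' := by
          have : (r : ℤ) - r' = (q.2 - r') - p * t := by rw [hrq]; ring
          rw [this]
          exact dvd_sub h3 (dvd_mul_right _ _)
        have h5 := Int.eq_zero_of_abs_lt_dvd h4 (by rw [abs_lt]; omega)
        ext
        · rw [← h2]
        · simp only; omega
      · rfl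
      · rfl
    · intro h
      exact absurd (Finset.mem_product.2 ⟨Finset.mem_univ _, Finset.mem_range.2 hlt⟩) h
  rw [this]
  exact hsum _

/-- Since the group contains no nontrivial scalar, an element is determined by its Z label and
squares to one, so its phase is a sign. The sign is a linear functional on the `𝔽₂`-space of labels
that occur, and extends to all labels; filtering by `J` makes it vanish on the other streams. -/
theorem exists_sign_character {S : Subgroup (Pauli n)} {J : Finset (Fin n)}
    (hc : ∀ c : ZMod 4, Pauli.scalar c ∈ S → c = 0) (hZ : ∀ g ∈ S, g.IsZOn J) :
    ∃ χ : Label n →+ ZMod 2, (∀ g ∈ S, g.phase = signPhase (χ g.z)) ∧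
      ∀ q : Qubit n, q.1 ∉ J → χ (Finsupp.single q 1) = 0 := by
  classical
  have hmul : ∀ g ∈ S, ∀ h ∈ S, g * h = ⟨g.phase + h.phase, 0, g.z + h.z⟩ := by
    intro g hg h hh
    ext1
    · simp [(hZ h hh).1, dot_zero_right, signPhase_zero]
    · simp [(hZ g hg).1, (hZ h hh).1]
    · rfl
  have huniq : ∀ g ∈ S, ∀ h ∈ S, g.z = h.z → g.phase + h.phase = 0 := by
    intro g hg h hh e
    apply hc
    have := mul_mem hg hh
    rwa [hmul g hg h hh, e, label_add_self] at this
  have hsign : ∀ c : ZMod 4, c + c = 0 → ∃ a : ZMod 2, c = signPhase a := by decide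
  have hex : ∀ g ∈ S, ∃ a : ZMod 2, g.phase = signPhase a :=
    fun g hg => hsign _ (huniq g hg g hg rfl)
  let N : AddSubgroup (Label n) :=
    { carrier := {z | ∃ g ∈ S, g.z = z}
      zero_mem' := ⟨1, one_mem _, rfl⟩
      add_mem' := by
        rintro _ _ ⟨g, hg, rfl⟩ ⟨h, hh, rfl⟩
        exact ⟨g * h, mul_mem hg hh, rfl⟩
      neg_mem' := by
        rintro _ ⟨g, hg, rfl⟩
        exact ⟨g⁻¹, inv_mem hg, by
          rw [Pauli.inv_z, eq_neg_iff_add_eq_zero, label_add_self]⟩ }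
  have hN : ∀ z : N, ∃ a : ZMod 2, ∀ g ∈ S, g.z = z → g.phase = signPhase a := by
    rintro ⟨_, g, hg, rfl⟩
    obtain ⟨a, ha⟩ := hex g hg
    refine ⟨a, fun h hh e => ?_⟩
    rw [← ha]
    have h1 := huniq g hg g hg rfl
    have h2 := huniq h hh g hg e
    linear_combination h2 - h1
  choose χ₀ hχ₀ using hN
  let χ₁ : N →+ ZMod 2 := AddMonoidHom.mk' χ₀ (by
    rintro ⟨_, g, hg, rfl⟩ ⟨_, h, hh, rfl⟩
    apply signPhase_injective
    rw [signPhase_add, ← hχ₀ ⟨g.z, g, hg, rfl⟩ g hg rfl, ← hχ₀ ⟨h.z, h, hh, rfl⟩ h hh rfl,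
      ← hχ₀ _ (g * h) (mul_mem hg hh) rfl, hmul g hg h hh])
  let N' : Submodule (ZMod 2) (Label n) := AddSubgroup.toZModSubmodule 2 N
  let χ₂ : N' →ₗ[ZMod 2] ZMod 2 := AddMonoidHom.toZModLinearMap 2 χ₁
  obtain ⟨χ₃, hχ₃⟩ := LinearMap.exists_extend χ₂
  refine ⟨χ₃.toAddMonoidHom.comp (Finsupp.filterAddHom fun q : Qubit n => q.1 ∈ J), ?_, ?_⟩
  · intro g hg
    have h1 : g.z.filter (fun q : Qubit n => q.1 ∈ J) = g.z :=
      Finsupp.filter_eq_self_iff _ _ |>.2 fun q hq => (hZ g hg).2 q hq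
    have h2 := LinearMap.congr_fun hχ₃ ⟨g.z, g, hg, rfl⟩
    change g.phase = signPhase (χ₃ (g.z.filter _))
    rw [h1]
    have h3 : χ₃ g.z = χ₀ ⟨g.z, g, hg, rfl⟩ := h2
    rw [h3]
    exact hχ₀ ⟨g.z, g, hg, rfl⟩ g hg rfl
  · intro q hq
    change χ₃ ((Finsupp.single q 1).filter _) = 0
    rw [Finsupp.filter_single_of_neg (fun q : Qubit n => q.1 ∈ J) hq, map_zero]

/-- By pigeonhole two shifts `k < k'` of `χ` agree on the window `[-L, L]`. They also agree on
labels from `S`, because shifting preserves phases. Every Z label on `J` is the sum of one of each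
kind, so the shifts agree on all of these. -/
theorem exists_period {S : Subgroup (Pauli n)} {J : Finset (Fin n)}
    (hshift : ∀ g ∈ S, ∀ j, Pauli.shift j g ∈ S) (hcof : IsCofinite S J)
    {χ : Label n →+ ZMod 2} (hχ : ∀ g ∈ S, g.phase = signPhase (χ g.z))
    (hχ' : ∀ q : Qubit n, q.1 ∉ J → χ (Finsupp.single q 1) = 0) :
    ∃ p : ℕ, 0 < p ∧
      ∀ q : Qubit n, χ (Finsupp.single (q.1, q.2 + p) 1) = χ (Finsupp.single q 1) := by
  classical
  obtain ⟨L, hL⟩ := hcof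
  obtain ⟨k, k', hne, hk⟩ := Finite.exists_ne_map_eq_of_infinite
    (fun (k : ℕ) (a : Fin n × Fin (2 * L + 1)) =>
      χ (Finsupp.single (a.1, (a.2 : ℤ) - L + k) 1))
  wlog hlt : k < k' generalizing k k'
  · exact this k' k hne.symm hk.symm (by omega)
  refine ⟨k' - k, by omega, fun q => ?_⟩
  by_cases hq : q.1 ∈ J
  swap
  · rw [hχ' q hq]; exact hχ' (q.1, _) hq
  have hS : ∀ g ∈ S, χ (shiftLabel k' g.z) = χ (shiftLabel k g.z) := by
    intro g hg
    apply signPhase_injective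
    rw [← Pauli.shift_z', ← Pauli.shift_z', ← hχ _ (hshift g hg k), ← hχ _ (hshift g hg k'),
      Pauli.shift_phase, Pauli.shift_phase]
  have hW : ∀ w : Label n, (∀ q, w q ≠ 0 → |q.2| ≤ L) →
      χ (shiftLabel k' w) = χ (shiftLabel k w) := by
    intro w
    induction w using Finsupp.induction with
    | zero => intro; simp [shiftLabel_zero]
    | single_add q a f hqf ha ih =>
      intro h
      rw [Finsupp.notMem_support_iff] at hqf
      rw [shiftLabel_add, shiftLabel_add, map_add, map_add, ih]
      · congr 1
        have h1 := abs_le.1 (h q (by simpa [hqf] using ha))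
        rw [eq_one_of_ne_zero ha, shiftLabel_single, shiftLabel_single]
        have h2 := congrFun hk (q.1, ⟨(q.2 + L).toNat, by omega⟩)
        simp only at h2
        rw [Int.toNat_of_nonneg (by omega), add_sub_cancel_right] at h2
        exact h2.symm
      · intro q' hq'
        refine h q' ?_
        have : q ≠ q' := fun e => hq' (e ▸ hqf)
        simpa [Finsupp.single_apply, this] using hq'
  -- The block `q.2 - k` is chosen so that the shifts by `k` and `k'` lead to `q.2` and `q.2 + (k' -
  -- k)`.
  obtain ⟨g, hg, hgZ, hgL⟩ := hL (Finsupp.single (q.1, q.2 - k) 1) (by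
    intro q' hq'
    have : (q.1, q.2 - (k : ℤ)) = q' := by
      by_contra hne
      exact hq' (Finsupp.single_eq_of_ne (Ne.symm hne))
    rw [← this]
    exact hq)
  have h1 := hW _ hgL
  rw [shiftLabel_add, shiftLabel_add, map_add, map_add, hS g hg, add_left_inj,
    shiftLabel_single, shiftLabel_single] at h1
  simp only [sub_add_cancel] at h1
  rw [← h1]
  congr 3
  push_cast [hlt.le]
  ring

/-! ### States -/

namespace IsState

variable {ω : Pauli n → ℂ}

/-- Positivity for families with repetitions: coefficients of equal operators are added up. -/
theorem sum_nonneg (hω : IsState ω) {ι : Type*} (s : Finset ι) (g : ι → Pauli n) (a : ι → ℂ) :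
    0 ≤ ∑ i ∈ s, ∑ j ∈ s, star (a i) * a j * ω ((g i)⁻¹ * g j) := by
  classical
  have h := hω.nonneg (s.image g) fun h => ∑ i ∈ s with g i = h, a i
  have hmaps : ∀ i ∈ s, g i ∈ s.image g := fun i hi => Finset.mem_image_of_mem g hi
  convert h using 1
  rw [← Finset.sum_fiberwise_of_maps_to hmaps]
  refine Finset.sum_congr rfl fun u _ => ?_
  have inner : ∀ i, (∑ j ∈ s, star (a i) * a j * ω ((g i)⁻¹ * g j)) =
      ∑ v ∈ s.image g, star (a i) * (∑ j ∈ s with g j = v, a j) * ω ((g i)⁻¹ * v) := by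
    intro i
    rw [← Finset.sum_fiberwise_of_maps_to hmaps]
    refine Finset.sum_congr rfl fun v _ => ?_
    rw [Finset.mul_sum, Finset.sum_mul]
    refine Finset.sum_congr rfl fun j hj => ?_
    rw [(Finset.mem_filter.1 hj).2]
  rw [Finset.sum_congr rfl fun i _ => inner i, Finset.sum_comm]
  refine Finset.sum_congr rfl fun v _ => ?_
  rw [star_sum, Finset.sum_mul, Finset.sum_mul]
  refine Finset.sum_congr rfl fun i hi => ?_
  rw [(Finset.mem_filter.1 hi).2]

/-- Positivity on the span of `1` and `g` makes the form real; the coefficients `1` and `I` give the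
two real equations. -/
theorem apply_inv (hω : IsState ω) (g : Pauli n) : ω g⁻¹ = star (ω g) := by
  have h : ∀ c : ℂ, 0 ≤ 1 + c * ω g + (star c * ω g⁻¹ + star c * c) := by
    intro c
    have := hω.sum_nonneg Finset.univ ![1, g] ![1, c]
    simpa [Fin.sum_univ_two, hω.one] using this
  have h1 := (Complex.nonneg_iff.1 (h 1)).2
  have h2 := (Complex.nonneg_iff.1 (h Complex.I)).2
  simp at h1 h2
  apply Complex.ext
  · simp; linarith
  · simp; linarith

/-- A Cauchy–Schwarz argument: `1 - t` is a null vector of the positive form, hence orthogonal to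
everything. If it were not orthogonal to `g⁻¹`, the coefficients below would give the form the value
`0 - 1 - 1 + 1 = -1`. -/
theorem apply_mul_right (hω : IsState ω) {t : Pauli n} (ht : ω t = 1) (g : Pauli n) :
    ω (g * t) = ω g := by
  have ht' : ω t⁻¹ = 1 := by rw [hω.apply_inv, ht, star_one]
  by_contra hne
  have hc : ω (g * t) - ω g ≠ 0 := sub_ne_zero.2 hne
  have h := hω.sum_nonneg Finset.univ ![1, t, g⁻¹]
    ![(ω (g * t) - ω g)⁻¹, -(ω (g * t) - ω g)⁻¹, 1]
  have e1 : ω (t⁻¹ * g⁻¹) = star (ω (g * t)) := by rw [← hω.apply_inv, mul_inv_rev]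
  simp [Fin.sum_univ_three, hω.one, ht, ht', e1, hω.apply_inv g] at h
  have e2 : (ω (g * t) - ω g)⁻¹ * ω g - (ω (g * t) - ω g)⁻¹ * ω (g * t) = -1 := by
    field_simp; ring
  have e3 : ((starRingEnd ℂ) (ω (g * t)) - (starRingEnd ℂ) (ω g))⁻¹ * (starRingEnd ℂ) (ω g) -
      ((starRingEnd ℂ) (ω (g * t)) - (starRingEnd ℂ) (ω g))⁻¹ * (starRingEnd ℂ) (ω (g * t)) =
      -1 := by
    have := congrArg (starRingEnd ℂ) e2
    simpa using this
  have key : ∀ x : ℂ, 0 ≤ x → x = -1 → False := by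
    rintro x hx rfl
    have := (Complex.nonneg_iff.1 hx).1
    norm_num at this
  refine key _ h ?_
  linear_combination e2 + e3

theorem apply_mul_left (hω : IsState ω) {t : Pauli n} (ht : ω t = 1) (g : Pauli n) :
    ω (t * g) = ω g := by
  have ht' : ω t⁻¹ = 1 := by rw [hω.apply_inv, ht, star_one]
  have := hω.apply_mul_right ht' g⁻¹
  rw [← mul_inv_rev, hω.apply_inv, hω.apply_inv] at this
  exact star_injective this

theorem comp {k : ℕ} (hω : IsState ω) (f : Pauli k →* Pauli n)
    (hf : ∀ c, f (Pauli.scalar c) = Pauli.scalar c) : IsState fun g => ω (f g) where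
  one := by rw [map_one, hω.one]
  scalar c g := by rw [map_mul, hf, hω.scalar]
  nonneg s a := by
    simp only [map_mul, map_inv]
    exact hω.sum_nonneg s f a

end IsState

/-! ### Insertion of qubits in the state `|0⟩` -/

section insertion

variable {k : ℕ} (e : Fin k ↪ Fin n)

/-- The label on the streams selected by `e`, extended by zero. -/
def extendLabel (y : Label k) : Label n := y.mapDomain (Prod.map e id)

theorem injective_prodMap : Function.Injective (Prod.map e id : Qubit k → Qubit n) :=
  e.injective.prodMap Function.injective_id

theorem restrictLabel_apply (x : Label n) (q : Qubit k) :
    restrictLabel e x q = x (e q.1, q.2) := rfl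

theorem extendLabel_apply (y : Label k) (q : Qubit k) : extendLabel e y (e q.1, q.2) = y q :=
  Finsupp.mapDomain_apply (injective_prodMap e) y q

theorem extendLabel_of_notMem (y : Label k) {q : Qubit n} (hq : q.1 ∉ Set.range e) :
    extendLabel e y q = 0 := by
  apply Finsupp.mapDomain_of_notMem_range
  rintro ⟨q', rfl⟩
  exact hq ⟨q'.1, rfl⟩

theorem extendLabel_add (y y' : Label k) :
    extendLabel e (y + y') = extendLabel e y + extendLabel e y' := Finsupp.mapDomain_add

theorem extendLabel_zero : extendLabel e (0 : Label k) = 0 := Finsupp.mapDomain_zero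

theorem restrictLabel_add (x x' : Label n) :
    restrictLabel e (x + x') = restrictLabel e x + restrictLabel e x' := by
  ext q; simp [restrictLabel_apply]

theorem restrictLabel_zero : restrictLabel e (0 : Label n) = 0 := by
  ext q; simp [restrictLabel_apply]

theorem restrictLabel_extendLabel (y : Label k) : restrictLabel e (extendLabel e y) = y := by
  ext q; rw [restrictLabel_apply, extendLabel_apply]

theorem extendLabel_restrictLabel {x : Label n} (hx : ∀ q : Qubit n, q.1 ∉ Set.range e → x q = 0) :
    extendLabel e (restrictLabel e x) = x := by
  ext q
  by_cases hq : q.1 ∈ Set.range e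
  · obtain ⟨i, hi⟩ := hq
    have : q = (e i, q.2) := Prod.ext hi.symm rfl
    rw [this]
    exact extendLabel_apply e _ (i, q.2)
  · rw [extendLabel_of_notMem e _ hq, hx q hq]

theorem dot_extendLabel (z : Label n) (y : Label k) :
    dot z (extendLabel e y) = dot (restrictLabel e z) y := by
  induction y using Finsupp.induction_linear with
  | zero => rw [extendLabel_zero, dot_zero_right, dot_zero_right]
  | add f g hf hg => rw [extendLabel_add, dot_add_right, dot_add_right, hf, hg]
  | single q a =>
    rw [extendLabel, Finsupp.mapDomain_single, dot_single_right, dot_single_right]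
    rfl

/-- Pauli operators on the streams selected by `e`. -/
def extendPauli : Pauli k →* Pauli n where
  toFun g := ⟨g.phase, extendLabel e g.x, extendLabel e g.z⟩
  map_one' := by
    ext1
    · rfl
    · exact extendLabel_zero e
    · exact extendLabel_zero e
  map_mul' g h := by
    ext1
    · simp only [Pauli.mul_phase, dot_extendLabel, restrictLabel_extendLabel]
    · exact extendLabel_add ..
    · exact extendLabel_add ..

theorem extendPauli_scalar (c : ZMod 4) :
    extendPauli e (Pauli.scalar c : Pauli k) = Pauli.scalar c := by
  ext1
  · rfl
  · exact extendLabel_zero e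
  · exact extendLabel_zero e

/-- The part of a Pauli operator on the streams selected by `e`. -/
def restrictPauli (g : Pauli n) : Pauli k := ⟨g.phase, restrictLabel e g.x, restrictLabel e g.z⟩

theorem insertZeros_of_vanish (φ : Pauli k → ℂ) {g : Pauli n}
    (hg : ∀ q : Qubit n, q.1 ∉ Set.range e → g.x q = 0) :
    insertZeros e φ g = φ (restrictPauli e g) := if_pos hg

theorem insertZeros_of_not_vanish (φ : Pauli k → ℂ) {g : Pauli n}
    (hg : ¬ ∀ q : Qubit n, q.1 ∉ Set.range e → g.x q = 0) : insertZeros e φ g = 0 := if_neg hg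

/-- Neither X label need vanish off the selected streams, but their sum does, and the phase of `g⁻¹
* h` depends on the X labels only through this sum. -/
theorem insertZeros_inv_mul (φ : Pauli k → ℂ) {g h : Pauli n}
    (hgh : ∀ q : Qubit n, q.1 ∉ Set.range e → g.x q = h.x q) :
    insertZeros e φ (g⁻¹ * h) = φ ((restrictPauli e g)⁻¹ * restrictPauli e h) := by
  have hx : ∀ q : Qubit n, q.1 ∉ Set.range e → (g.x + h.x) q = 0 := fun q hq => by
    rw [Finsupp.add_apply, hgh q hq, CharTwo.add_self_eq_zero]
  rw [insertZeros_of_vanish e φ hx]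
  congr 1
  have hdot : dot g.z g.x + dot g.z h.x = dot (restrictLabel e g.z) (restrictLabel e g.x) +
      dot (restrictLabel e g.z) (restrictLabel e h.x) := by
    rw [← dot_add_right, ← dot_add_right, ← restrictLabel_add, ← dot_extendLabel,
      extendLabel_restrictLabel e hx]
  ext1
  · simp only [restrictPauli, Pauli.mul_phase, Pauli.inv_phase, Pauli.inv_z]
    have := congrArg signPhase hdot
    rw [signPhase_add, signPhase_add] at this
    linear_combination this
  · exact restrictLabel_add ..
  · exact restrictLabel_add ..

theorem IsState.insertZeros {φ : Pauli k → ℂ} (hφ : IsState φ) : IsState (insertZeros e φ) where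
  one := by
    rw [insertZeros_of_vanish e φ (fun _ _ => rfl), ← hφ.one]
    congr 1
    ext1
    · rfl
    · exact restrictLabel_zero e
    · exact restrictLabel_zero e
  scalar c g := by
    have hx : (Pauli.scalar c * g).x = g.x := by rw [Pauli.scalar_mul]
    by_cases hg : ∀ q : Qubit n, q.1 ∉ Set.range e → g.x q = 0
    · rw [insertZeros_of_vanish e φ hg, insertZeros_of_vanish e φ (by rwa [hx]), ← hφ.scalar,
        Pauli.scalar_mul, Pauli.scalar_mul]
      rfl
    · rw [insertZeros_of_not_vanish e φ hg, insertZeros_of_not_vanish e φ (by rwa [hx]), mul_zero]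
  nonneg s a := by
    classical
    -- The Gram matrix is block diagonal with respect to the X label off the selected streams, and
    -- each block is a Gram matrix of `φ`.
    let key : Pauli n → Label n := fun g => g.x.filter fun q => q.1 ∉ Set.range e
    have hkey : ∀ g h, key g = key h ↔ ∀ q : Qubit n, q.1 ∉ Set.range e → g.x q = h.x q := by
      intro g h
      constructor
      · intro E q hq
        have := DFunLike.congr_fun E q
        rwa [Finsupp.filter_apply_pos (fun q : Qubit n => q.1 ∉ Set.range e) _ hq,
          Finsupp.filter_apply_pos (fun q : Qubit n => q.1 ∉ Set.range e) _ hq] at this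
      · intro E
        ext q
        simp only [key, Finsupp.filter_apply]
        split_ifs with hq
        · rfl
        · exact E q hq
    rw [← Finset.sum_fiberwise_of_maps_to (fun g hg => Finset.mem_image_of_mem key hg)]
    refine Finset.sum_nonneg fun κ _ => ?_
    have h := hφ.sum_nonneg (s.filter fun g => key g = κ) (restrictPauli e) a
    refine h.trans_eq (Finset.sum_congr rfl fun g hg => ?_)
    have hg' := (Finset.mem_filter.1 hg).2
    rw [Finset.sum_filter]
    refine Finset.sum_congr rfl fun u _ => ?_
    split_ifs with hu
    · rw [insertZeros_inv_mul e φ ((hkey g u).1 (hg'.trans hu.symm))]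
    · rw [insertZeros_of_not_vanish, mul_zero]
      intro hx
      apply hu
      rw [← hg', eq_comm, hkey]
      intro q hq
      have := hx q hq
      rwa [Pauli.mul_x, Pauli.inv_x, Finsupp.add_apply, CharTwo.add_eq_zero] at this

/-- The group of products of Pauli matrices `Z` on the streams in `J`. -/
def zGroup (J : Finset (Fin n)) : Subgroup (Pauli n) where
  carrier := {g | g.phase = 0 ∧ g.IsZOn J}
  one_mem' := ⟨rfl, rfl, fun _ hq => absurd rfl hq⟩
  mul_mem' := by
    rintro g h ⟨h1, h2⟩ ⟨h3, h4⟩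
    refine ⟨?_, h2.mul h4⟩
    rw [Pauli.mul_phase, h1, h3, h4.1, dot_zero_right, signPhase_zero, add_zero, add_zero]
  inv_mem' := by
    rintro g ⟨h1, h2⟩
    refine ⟨?_, h2⟩
    rw [Pauli.inv_phase, h1, h2.1, dot_zero_right, signPhase_zero, add_zero, neg_zero]

theorem Z_mem_zGroup {J : Finset (Fin n)} {q : Qubit n} (hq : q.1 ∈ J) :
    Pauli.Z q ∈ zGroup J := by
  refine ⟨rfl, rfl, fun q' hq' => ?_⟩
  rw [touches_Z (Or.inr hq')]
  exact hq

/-- A fixed `Z` can be multiplied into any operator without changing the expectation value. An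
operator with an X label on `J` anticommutes with some such `Z`, so its value is its own negative;
from any other operator the `Z` factors on `J` can be removed. -/
theorem codeSpace_zGroup {J : Finset (Fin n)} (hJ : ∀ i, i ∈ J ↔ i ∉ Set.range e) :
    codeSpace (zGroup J) = {ω | ∃ φ : Pauli k → ℂ, IsState φ ∧ ω = insertZeros e φ} := by
  classical
  ext ω
  constructor
  · rintro ⟨hω, hfix⟩
    refine ⟨fun g => ω (extendPauli e g), hω.comp _ (extendPauli_scalar e), ?_⟩
    ext g
    by_cases hg : ∀ q : Qubit n, q.1 ∉ Set.range e → g.x q = 0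
    · rw [insertZeros_of_vanish e _ hg]
      let t : Pauli n := ⟨0, 0, g.z.filter fun q => q.1 ∉ Set.range e⟩
      have ht : t ∈ zGroup J := by
        refine ⟨rfl, rfl, fun q hq => ?_⟩
        rw [hJ]
        by_contra hn
        exact hq (Finsupp.filter_apply_neg _ _ (not_not.2 hn))
      have : g = extendPauli e (restrictPauli e g) * t := by
        ext1
        · simp [t, extendPauli, restrictPauli, dot_zero_right, signPhase_zero]
        · change g.x = extendLabel e (restrictLabel e g.x) + 0
          rw [extendLabel_restrictLabel e hg, add_zero]
        · change g.z = extendLabel e (restrictLabel e g.z) + _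
          ext q
          rw [Finsupp.add_apply]
          by_cases hq : q.1 ∈ Set.range e
          · rw [Finsupp.filter_apply_neg (fun q : Qubit n => q.1 ∉ Set.range e) _ (by simpa using hq),
              add_zero]
            obtain ⟨i, hi⟩ := hq
            have : q = (e i, q.2) := Prod.ext hi.symm rfl
            rw [this]
            exact (extendLabel_apply e (restrictLabel e g.z) (i, q.2)).symm
          · rw [Finsupp.filter_apply_pos (fun q : Qubit n => q.1 ∉ Set.range e) _ hq,
              extendLabel_of_notMem e _ hq, zero_add]
      conv_lhs => rw [this]
      exact hω.apply_mul_right (hfix t ht) _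
    · rw [insertZeros_of_not_vanish e _ hg]
      push Not at hg
      obtain ⟨q, hq, hne⟩ := hg
      have hZ := hfix _ (Z_mem_zGroup ((hJ q.1).2 hq))
      have anti : Pauli.Z q * g = Pauli.scalar 2 * (g * Pauli.Z q) := by
        rw [Pauli.scalar_mul]
        ext1
        · simp only [Pauli.mul_phase, Pauli.Z, dot_single_left, dot_zero_right, signPhase_zero,
            one_mul, eq_one_of_ne_zero hne, add_zero, zero_add]
          rw [add_comm]
          rfl
        · exact add_comm _ _
        · exact add_comm _ _
      have h := hω.apply_mul_left hZ g
      rw [anti, hω.scalar, hω.apply_mul_right hZ] at h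
      have h2 : (2 : ZMod 4).val = 2 := rfl
      rw [h2, Complex.I_sq] at h
      linear_combination -(1 / 2 : ℂ) * h
  · rintro ⟨φ, hφ, rfl⟩
    refine ⟨hφ.insertZeros e, fun g hg => ?_⟩
    obtain ⟨h1, h2, h3⟩ := hg
    rw [insertZeros_of_vanish e φ (fun q _ => by rw [h2]; rfl), ← hφ.one]
    congr 1
    ext1
    · exact h1
    · change restrictLabel e g.x = 0
      rw [h2, restrictLabel_zero]
    · ext q
      change g.z (e q.1, q.2) = 0
      by_contra hne
      exact (hJ _).1 (h3 _ hne) ⟨q.1, rfl⟩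

theorem isEncoder_map_zGroup {J : Finset (Fin n)} (hJ : ∀ i, i ∈ J ↔ i ∉ Set.range e)
    {E : MulAut (Pauli n)} (hE : ∀ c, E (Pauli.scalar c) = Pauli.scalar c) :
    IsEncoder e E ((zGroup J).map E.toMonoidHom) := by
  have hE' : ∀ c, E⁻¹ (Pauli.scalar c) = Pauli.scalar c := fun c => by
    rw [← hE c, MulAut.inv_apply_self, hE]
  have h0 := codeSpace_zGroup e hJ
  unfold IsEncoder
  ext ω
  constructor
  · rintro ⟨hω, hfix⟩
    have : (fun g => ω (E g)) ∈ codeSpace (zGroup J) :=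
      ⟨hω.comp E.toMonoidHom hE, fun g hg => hfix _ ⟨g, hg, rfl⟩⟩
    rw [h0] at this
    obtain ⟨φ, hφ, hωφ⟩ := this
    refine ⟨φ, hφ, ?_⟩
    rw [← hωφ]
    ext g
    rw [applyToState, MulAut.apply_inv_self]
  · rintro ⟨φ, hφ, rfl⟩
    have : insertZeros e φ ∈ codeSpace (zGroup J) := by rw [h0]; exact ⟨φ, hφ, rfl⟩
    refine ⟨this.1.comp (E⁻¹ : MulAut (Pauli n)).toMonoidHom hE', ?_⟩
    rintro _ ⟨g, hg, rfl⟩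
    change insertZeros e φ (E⁻¹ (E g)) = 1
    rw [MulAut.inv_apply_self]
    exact this.2 g hg

end insertion

/-! ### Rates -/

/-- A bounded error in the number of stabilizer generators disappears after division by `n * N`. For
`n = 0` both sides are `0` by the convention for division by zero. -/
theorem hasRate_of_abs_sub_le {S : Subgroup (Pauli n)} {r : ℕ} (hr : r ≤ n) {C : ℝ}
    (h : ∀ N : ℕ, |Real.logb 2 (Nat.card (window S N)) - r * N| ≤ C) :
    HasRate S (((n - r : ℕ) : ℝ) / n) := by
  unfold HasRate
  rcases Nat.eq_zero_or_pos n with rfl | hn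
  · simp
  have hn' : (0 : ℝ) < n := by exact_mod_cast hn
  rw [tendsto_iff_dist_tendsto_zero]
  have hlim : Filter.Tendsto (fun N : ℕ => C / n * (1 / (N : ℝ))) Filter.atTop (nhds 0) := by
    have := (tendsto_one_div_atTop_nhds_zero_nat (𝕜 := ℝ)).const_mul (C / n)
    rwa [mul_zero] at this
  refine squeeze_zero' (Filter.Eventually.of_forall fun _ => dist_nonneg) ?_ hlim
  filter_upwards [Filter.eventually_gt_atTop 0] with N hN
  have hN' : (0 : ℝ) < N := by exact_mod_cast hN
  rw [Real.dist_eq, Nat.cast_sub hr]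
  have : ((n : ℝ) * N - Real.logb 2 (Nat.card (window S N))) / (n * N) - ((n : ℝ) - r) / n =
      -((Real.logb 2 (Nat.card (window S N)) - r * N) / (n * N)) := by
    field_simp
    ring
  rw [this, abs_neg, abs_div, abs_of_pos (mul_pos hn' hN')]
  have e : C / n * (1 / (N : ℝ)) = C / (n * N) := by field_simp
  rw [e]
  exact div_le_div_of_nonneg_right (h N) (mul_pos hn' hN').le

/-- An element of the window comes from a product of `Z` on at most `ρ` further blocks at either
end, and is determined by its label there. -/
theorem finite_window_of_hasSpread {J : Finset (Fin n)} {E : MulAut (Pauli n)} {ρ : ℕ}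
    (h : HasSpread ρ E⁻¹) (N : ℕ) :
    Finite (window ((zGroup J).map E.toMonoidHom) N) ∧
      Nat.card (window ((zGroup J).map E.toMonoidHom) N) ≤ 2 ^ (J.card * (N + 2 * ρ)) := by
  let F : window ((zGroup J).map E.toMonoidHom) N → (J × Fin (N + 2 * ρ) → ZMod 2) :=
    fun g a => (E⁻¹ g.1).z (a.1, (a.2 : ℤ) - ρ)
  have hF : Function.Injective F := by
    rintro ⟨_, ⟨g, hg, rfl⟩, hgN⟩ ⟨_, ⟨g', hg', rfl⟩, hgN'⟩ e
    have hz : ∀ g ∈ zGroup J, (E g).SupportedOn (Set.Ico 0 (N : ℤ)) → ∀ q, g.z q ≠ 0 →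
        q.1 ∈ J ∧ -(ρ : ℤ) ≤ q.2 ∧ q.2 < N + ρ := by
      intro g hg hgN q hq
      refine ⟨hg.2.2 q hq, ?_⟩
      obtain ⟨q', hq', hd⟩ := h (E g) q (Or.inr (by rwa [MulAut.inv_apply_self]))
      have h1 := hgN q' hq'
      rw [Set.mem_Ico] at h1
      rw [abs_le] at hd
      omega
    have hz1 := hz g hg hgN
    have hz2 := hz g' hg' hgN'
    have : g = g' := by
      ext1
      · rw [hg.1, hg'.1]
      · rw [hg.2.1, hg'.2.1]
      · ext q
        by_cases hq : q.1 ∈ J ∧ -(ρ : ℤ) ≤ q.2 ∧ q.2 < N + ρ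
        · have h1 := congrFun e (⟨q.1, hq.1⟩, ⟨(q.2 + ρ).toNat, by omega⟩)
          have h2 : (((q.2 + ρ).toNat : ℕ) : ℤ) - ρ = q.2 := by omega
          simp only [F, h2] at h1
          change (E⁻¹ (E g)).z q = (E⁻¹ (E g')).z q at h1
          rwa [MulAut.inv_apply_self, MulAut.inv_apply_self] at h1
        · have h1 : g.z q = 0 := by by_contra hne; exact hq (hz1 q hne)
          have h2 : g'.z q = 0 := by by_contra hne; exact hq (hz2 q hne)
          rw [h1, h2]
    subst this
    rfl
  refine ⟨Finite.of_injective F hF, (Nat.card_le_card_of_injective F hF).trans_eq ?_⟩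
  rw [Nat.card_eq_fintype_card]
  simp [ZMod.card]

/-- Products of `Z` at distance at least `ρ` from the ends stay inside the window; truncated
subtraction covers short windows. -/
theorem le_card_window_of_hasSpread {J : Finset (Fin n)} {E : MulAut (Pauli n)} {ρ N : ℕ}
    (h : HasSpread ρ E) [Finite (window ((zGroup J).map E.toMonoidHom) N)] :
    2 ^ (J.card * (N - 2 * ρ)) ≤ Nat.card (window ((zGroup J).map E.toMonoidHom) N) := by
  classical
  let pos : J × Fin (N - 2 * ρ) → Qubit n := fun a => (a.1.1, (a.2 : ℤ) + ρ)
  have hinj : Function.Injective pos := by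
    rintro ⟨⟨i, hi⟩, u⟩ ⟨⟨i', hi'⟩, u'⟩ e
    simp only [pos, Prod.mk.injEq, add_left_inj, Nat.cast_inj] at e
    obtain ⟨rfl, e⟩ := e
    rw [Fin.ext e]
  let L : (J × Fin (N - 2 * ρ) → ZMod 2) → Label n := fun f =>
    (Finsupp.equivFunOnFinite.symm f).mapDomain pos
  have hLinj : Function.Injective L :=
    (Finsupp.mapDomain_injective hinj).comp Finsupp.equivFunOnFinite.symm.injective
  have hL : ∀ f q, L f q ≠ 0 → q.1 ∈ J ∧ (ρ : ℤ) ≤ q.2 ∧ q.2 + ρ < N := by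
    intro f q hq
    by_contra hn
    apply hq
    apply Finsupp.mapDomain_of_notMem_range
    rintro ⟨⟨⟨i, hi⟩, u⟩, rfl⟩
    have := u.2
    simp only [pos, not_and, not_lt] at hn
    have := hn hi (by omega)
    omega
  let F : (J × Fin (N - 2 * ρ) → ZMod 2) → window ((zGroup J).map E.toMonoidHom) N := fun f =>
    ⟨E ⟨0, 0, L f⟩, ⟨⟨0, 0, L f⟩, ⟨rfl, rfl, fun q hq => (hL f q hq).1⟩, rfl⟩, fun q hq => by
      obtain ⟨q', hq', hd⟩ := h _ q hq
      have h1 := hL f q' (hq'.resolve_left fun h => h rfl)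
      rw [abs_le] at hd
      rw [Set.mem_Ico]
      omega⟩
  have hF : Function.Injective F := by
    intro f f' e
    have h1 : E ⟨0, 0, L f⟩ = E ⟨0, 0, L f'⟩ := congrArg Subtype.val e
    exact hLinj (congrArg Pauli.z (E.injective h1))
  refine le_of_eq_of_le ?_ (Nat.card_le_card_of_injective F hF)
  rw [Nat.card_eq_fintype_card]
  simp [ZMod.card]

/-- Dividing by a chosen representative of its class embeds `A` into `B × F`. The invariant `c` need
not be a homomorphism. -/
theorem card_le_card_mul {G F : Type*} [Group G] [Finite F] {A B : Set G} [Finite B] (c : G → F)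
    (h : ∀ t ∈ A, ∀ t' ∈ A, c t = c t' → t * t'⁻¹ ∈ B) :
    Nat.card A ≤ Nat.card B * Nat.card F := by
  have hex : ∀ t : A, ∃ u ∈ A, c u = c t.1 := fun t => ⟨t, t.2, rfl⟩
  let rep : F → G := fun x => Classical.epsilon fun u => u ∈ A ∧ c u = x
  have hrep : ∀ t : A, rep (c t) ∈ A ∧ c (rep (c t)) = c t := fun t =>
    Classical.epsilon_spec (p := fun u => u ∈ A ∧ c u = c t) ⟨t, t.2, rfl⟩
  let f : A → B × F := fun t => (⟨t * (rep (c t))⁻¹, h _ t.2 _ (hrep t).1 (hrep t).2.symm⟩, c t)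
  have hf : Function.Injective f := by
    intro t t' e
    simp only [f, Prod.mk.injEq, Subtype.mk.injEq] at e
    rw [e.2] at e
    exact Subtype.ext (mul_right_cancel e.1)
  exact (Nat.card_le_card_of_injective f hf).trans_eq (Nat.card_prod _ _)

theorem one_mem_window (S : Subgroup (Pauli n)) (N : ℕ) : 1 ∈ window S N :=
  ⟨one_mem S, fun _ hq => absurd hq (by simp)⟩

theorem card_window_pos (S : Subgroup (Pauli n)) (N : ℕ) [Finite (window S N)] :
    (0 : ℝ) < Nat.card (window S N) := by
  have : Nonempty (window S N) := ⟨⟨1, one_mem_window S N⟩⟩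
  exact_mod_cast Nat.card_pos

theorem exists_abs_logb_card_window_le {J : Finset (Fin n)} {E : MulAut (Pauli n)} {ρ ρ' : ℕ}
    (h : HasSpread ρ E) (h' : HasSpread ρ' E⁻¹) :
    ∃ C : ℝ, ∀ N : ℕ,
      |Real.logb 2 (Nat.card (window ((zGroup J).map E.toMonoidHom) N)) - J.card * N| ≤ C := by
  refine ⟨J.card * (2 * ρ) + J.card * (2 * ρ'), fun N => ?_⟩
  obtain ⟨hfin, hupper⟩ := finite_window_of_hasSpread (J := J) h' N
  have hlower := le_card_window_of_hasSpread (J := J) (N := N) h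
  have hpos := card_window_pos ((zGroup J).map E.toMonoidHom) N
  generalize Nat.card (window ((zGroup J).map E.toMonoidHom) N) = w at *
  have logpow : ∀ m : ℕ, Real.logb 2 ((2 : ℝ) ^ m) = m := fun m => by
    rw [Real.logb_pow, Real.logb_self_eq_one (by norm_num), mul_one]
  have h1 : Real.logb 2 w ≤ J.card * (N + 2 * ρ') := by
    have h1 : (w : ℝ) ≤ 2 ^ (J.card * (N + 2 * ρ')) := by exact_mod_cast hupper
    have h2 := Real.logb_le_logb_of_le (by norm_num : (1 : ℝ) < 2) hpos h1
    rw [logpow] at h2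
    exact_mod_cast h2
  have h2 : (J.card : ℝ) * (N - 2 * ρ) ≤ Real.logb 2 w := by
    have h1 : (2 : ℝ) ^ (J.card * (N - 2 * ρ)) ≤ w := by exact_mod_cast hlower
    have h2 := Real.logb_le_logb_of_le (by norm_num : (1 : ℝ) < 2) (by positivity) h1
    rw [logpow] at h2
    refine le_trans ?_ h2
    push_cast
    refine mul_le_mul_of_nonneg_left ?_ (Nat.cast_nonneg _)
    have : (N : ℝ) ≤ ((N - 2 * ρ : ℕ) : ℝ) + 2 * ρ := by
      have : N ≤ (N - 2 * ρ) + 2 * ρ := by omega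
      exact_mod_cast this
    linarith
  have hb1 : (0 : ℝ) ≤ J.card * (2 * ρ) := by positivity
  have hb2 : (0 : ℝ) ≤ J.card * (2 * ρ') := by positivity
  rw [mul_add] at h1
  rw [mul_sub] at h2
  rw [abs_le]
  constructor <;> linarith

theorem abs_logb_card_window_le_of_le {S T : Subgroup (Pauli n)} (hST : S ≤ T)
    (hfin : ∀ N, Finite (window T N)) {c : ℕ} (hc0 : 0 < c)
    (hc : ∀ N, Nat.card (window T N) ≤ Nat.card (window S N) * c) {r : ℕ} {C : ℝ}
    (hT : ∀ N : ℕ, |Real.logb 2 (Nat.card (window T N)) - r * N| ≤ C) (N : ℕ) :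
    |Real.logb 2 (Nat.card (window S N)) - r * N| ≤ C + Real.logb 2 c := by
  have hsub : window S N ⊆ window T N := fun g hg => ⟨hST hg.1, hg.2⟩
  have := hfin N
  have : Finite (window S N) := Finite.Set.subset _ hsub
  have hcard : Nat.card (window S N) ≤ Nat.card (window T N) := Nat.card_mono (Set.toFinite _) hsub
  have hposS := card_window_pos S N
  have hposT := card_window_pos T N
  have hc' : (0 : ℝ) < c := by exact_mod_cast hc0
  have h1 : Real.logb 2 (Nat.card (window S N)) ≤ Real.logb 2 (Nat.card (window T N)) :=
    Real.logb_le_logb_of_le (by norm_num) hposS (by exact_mod_cast hcard)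
  have h2 : Real.logb 2 (Nat.card (window T N)) ≤
      Real.logb 2 (Nat.card (window S N)) + Real.logb 2 c := by
    rw [← Real.logb_mul hposS.ne' hc'.ne']
    exact Real.logb_le_logb_of_le (by norm_num) hposT (by exact_mod_cast hc N)
  have h3 : 0 ≤ Real.logb 2 c := Real.logb_nonneg (by norm_num) (by exact_mod_cast hc0)
  have h4 := abs_le.1 (hT N)
  rw [abs_le]
  constructor <;> linarith

/-! ### The encoder -/

theorem zGroup_le {J : Finset (Fin n)} {K : Subgroup (Pauli n)}
    (h : ∀ q : Qubit n, q.1 ∈ J → Pauli.Z q ∈ K) : zGroup J ≤ K := by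
  have key : ∀ z : Label n, (∀ q, z q ≠ 0 → q.1 ∈ J) → (⟨0, 0, z⟩ : Pauli n) ∈ K := by
    intro z
    induction z using Finsupp.induction with
    | zero => exact fun _ => one_mem K
    | single_add q a f hqf ha ih =>
      intro hz
      rw [Finsupp.notMem_support_iff] at hqf
      have : (⟨0, 0, Finsupp.single q a + f⟩ : Pauli n) = Pauli.Z q * ⟨0, 0, f⟩ := by
        rw [eq_one_of_ne_zero ha]
        ext1
        · simp [Pauli.Z, dot_zero_right, signPhase_zero]
        · simp [Pauli.Z]
        · rfl
      rw [this]
      refine mul_mem (h q (hz q (by simpa [hqf] using ha))) (ih fun q' hq' => hz q' ?_)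
      have : q ≠ q' := fun e => hq' (e ▸ hqf)
      simpa [Finsupp.single_apply, this] using hq'
  rintro ⟨c, x, z⟩ ⟨h1, h2, h3⟩
  simp only at h1 h2 h3
  subst h1 h2
  exact key z h3

theorem shift_mem_zGroup {J : Finset (Fin n)} {g : Pauli n} (hg : g ∈ zGroup J) (j : ℤ) :
    Pauli.shift j g ∈ zGroup J := ⟨hg.1, hg.2.shift j⟩

theorem isConvolutional_map_zGroup (J : Finset (Fin n)) {p : ℕ} (hp : 0 < p)
    {E : MulAut (Pauli n)} (hE : Good p E) :
    IsConvolutional p ((zGroup J).map E.toMonoidHom) where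
  comm := by
    rintro _ ⟨g, hg, rfl⟩ _ ⟨h, hh, rfl⟩
    rw [← map_mul, ← map_mul]
    congr 1
    rw [Pauli.commute_iff, hg.2.1, hh.2.1, dot_zero_right, dot_zero_right]
  center := by
    rintro c ⟨g, hg, hgc⟩
    have : g = Pauli.scalar c := E.injective (Eq.trans hgc (hE.scalar c).symm)
    rw [this] at hg
    exact hg.1
  generated := by
    classical
    refine ⟨(J ×ˢ Finset.range p).image fun a => E (Pauli.Z (a.1, (a.2 : ℤ))), le_antisymm ?_ ?_⟩
    · rw [Subgroup.map_le_iff_le_comap]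
      refine zGroup_le fun q hq => ?_
      have hp' : (0 : ℤ) < p := by exact_mod_cast hp
      have hr0 := Int.emod_nonneg q.2 hp'.ne'
      have hr1 := Int.emod_lt_of_pos q.2 hp'
      apply Subgroup.subset_closure
      refine ⟨E (Pauli.Z (q.1, ((q.2 % p).toNat : ℤ))), Finset.mem_image.2
        ⟨(q.1, (q.2 % p).toNat), Finset.mem_product.2 ⟨hq, Finset.mem_range.2 (by omega)⟩, rfl⟩,
        q.2 / p, ?_⟩
      rw [← hE.shift]
      change E _ = E _
      congr 1
      ext1
      · rfl
      · exact (shiftLabel_zero _).symm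
      · rw [Pauli.shift_z']
        simp only [Pauli.Z]
        rw [shiftLabel_single, Int.toNat_of_nonneg hr0, Int.emod_add_mul_ediv]
    · rw [Subgroup.closure_le]
      rintro _ ⟨g, hg, j, rfl⟩
      obtain ⟨⟨i, r⟩, hir, rfl⟩ := Finset.mem_image.1 hg
      rw [← hE.shift]
      exact ⟨_, shift_mem_zGroup (Z_mem_zGroup (Finset.mem_product.1 hir).1) _, rfl⟩

theorem IsConvolutional.shift_mem {S : Subgroup (Pauli n)} (hS : IsConvolutional 1 S)
    {g : Pauli n} (hg : g ∈ S) (j : ℤ) : Pauli.shift j g ∈ S := by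
  obtain ⟨G, hG⟩ := hS.generated
  have : S ≤ S.comap (Pauli.shiftHom j) := by
    conv_lhs => rw [hG]
    rw [Subgroup.closure_le]
    rintro _ ⟨g, hg, i, rfl⟩
    change Pauli.shift j (Pauli.shift _ g) ∈ S
    rw [Pauli.shift_shift, hG]
    exact Subgroup.subset_closure ⟨g, hg, j + i, by push_cast; ring_nf⟩
  exact this hg

theorem Pauli.SupportedOn.mul_inv {g h : Pauli n} {B : Set ℤ} (hg : g.SupportedOn B)
    (hh : h.SupportedOn B) : (g * h⁻¹).SupportedOn B := by
  intro q hq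
  by_contra hn
  have h1 : ¬ g.Touches q := fun h => hn (hg q h)
  have h2 : ¬ h.Touches q := fun h => hn (hh q h)
  rw [Pauli.not_touches] at h1 h2
  rcases hq with hq | hq
  · exact hq (by rw [mul_x, inv_x, Finsupp.add_apply, h1.1, h2.1, add_zero])
  · exact hq (by rw [mul_z, inv_z, Finsupp.add_apply, h1.2, h2.2, add_zero])

/-- Assign to an element of the larger group the remainder of its Z label modulo the labels of `S'`,
a vector on a window independent of `N`. Two elements with equal remainders differ by an element of
`S`, and the quotient stays in the same blocks. -/
theorem exists_card_window_le_mul {S S' : Subgroup (Pauli n)} {J : Finset (Fin n)}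
    {E₀ E F₀ : MulAut (Pauli n)} (hmemS : ∀ g, E₀ g ∈ S' → g ∈ S) (hE₀E : ∀ g, E₀ (E g) = F₀ g)
    (hST' : ∀ g ∈ S', ∃ t ∈ zGroup J, F₀ t = g ∧ t.z = g.z) (hcof : IsCofinite S' J)
    (hfinS : ∀ N, Finite (window S N)) :
    ∃ c : ℕ, 0 < c ∧ ∀ N, Nat.card (window ((zGroup J).map E.toMonoidHom) N) ≤
      Nat.card (window S N) * c := by
  classical
  obtain ⟨L, hL⟩ := hcof
  have hch : ∀ z : Label n, ∃ g : Pauli n, (∀ q, z q ≠ 0 → q.1 ∈ J) →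
      g ∈ S' ∧ ∀ q, (z + g.z) q ≠ 0 → |q.2| ≤ L := by
    intro z
    by_cases hz : ∀ q, z q ≠ 0 → q.1 ∈ J
    · obtain ⟨g, h1, -, h2⟩ := hL z hz
      exact ⟨g, fun _ => ⟨h1, h2⟩⟩
    · exact ⟨1, fun h => absurd h hz⟩
  choose γ hγ using hch
  let F : Pauli n → (Fin n × Fin (2 * L + 1) → ZMod 2) := fun t a =>
    ((E⁻¹ t).z + (γ (E⁻¹ t).z).z) (a.1, (a.2 : ℤ) - L)
  refine ⟨Nat.card (Fin n × Fin (2 * L + 1) → ZMod 2), Nat.card_pos, fun N => ?_⟩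
  have := hfinS N
  refine card_le_card_mul F ?_
  rintro _ ⟨⟨t, ht, rfl⟩, htN⟩ _ ⟨⟨u, hu, rfl⟩, huN⟩ hF
  refine ⟨?_, htN.mul_inv huN⟩
  obtain ⟨ht1, ht2⟩ := hγ t.z ht.2.2
  obtain ⟨hu1, hu2⟩ := hγ u.z hu.2.2
  have hz : t.z + (γ t.z).z = u.z + (γ u.z).z := by
    ext q
    by_cases hq : |q.2| ≤ L
    · rw [abs_le] at hq
      have h1 := congrFun hF (q.1, ⟨(q.2 + L).toNat, by omega⟩)
      have h2 : (((q.2 + L).toNat : ℕ) : ℤ) - L = q.2 := by omega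
      simp only [F, h2] at h1
      change ((E⁻¹ (E t)).z + (γ (E⁻¹ (E t)).z).z) q =
        ((E⁻¹ (E u)).z + (γ (E⁻¹ (E u)).z).z) q at h1
      rwa [MulAut.inv_apply_self, MulAut.inv_apply_self] at h1
    · have h1 : (t.z + (γ t.z).z) q = 0 := by by_contra hne; exact hq (ht2 q hne)
      have h2 : (u.z + (γ u.z).z) q = 0 := by by_contra hne; exact hq (hu2 q hne)
      rw [h1, h2]
  -- Equality of remainders says that `t` and `u` differ in label by a product of two elements of
  -- `S'`; its unsigned version `v` must be `t * u⁻¹`.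
  obtain ⟨v, hv, hvg, hvz⟩ := hST' _ (mul_mem ht1 hu1)
  have hv' : v = t * u⁻¹ := by
    have h1 := mul_mem ht (inv_mem hu)
    ext1
    · rw [hv.1, h1.1]
    · rw [hv.2.1, h1.2.1]
    · rw [hvz, Pauli.mul_z, Pauli.mul_z, Pauli.inv_z]
      have h2 := label_add_self t.z
      have h3 := label_add_self (γ u.z).z
      have h4 : (γ t.z).z = t.z + (u.z + (γ u.z).z) := by
        rw [← hz, ← add_assoc, h2, zero_add]
      rw [h4, add_assoc, add_assoc, h3, add_zero]
  apply hmemS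
  have : E.toMonoidHom t * (E.toMonoidHom u)⁻¹ = E v := by
    rw [hv', map_mul, map_inv]
    rfl
  rw [this, hE₀E, hvg]
  exact mul_mem ht1 hu1

end QConv

end

/-! ### Assembly of the encoder and the subcode -/

theorem mainTheorem2 (n : ℕ) (S : Subgroup (QConv.Pauli n))
    (hS : QConv.IsConvolutional 1 S) :
    ∃ (p : ℕ) (T : Subgroup (QConv.Pauli n)) (k : ℕ) (e : Fin k ↪ Fin n)
      (E : MulAut (QConv.Pauli n)),
      0 < p ∧ QConv.IsConvolutional p T ∧
      (∀ g ∈ T, ∀ j : ℤ, ∃ c : ZMod 4, QConv.Pauli.scalar c * QConv.Pauli.shift j g ∈ T) ∧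
      QConv.codeSpace T ⊆ QConv.codeSpace S ∧
      QConv.IsEncoder e E T ∧
      (QConv.IsNonCatastrophic E ∧ QConv.IsNonCatastrophic E⁻¹) ∧
      (QConv.IsShiftInvariantClifford p E ∧ QConv.IsShiftInvariantClifford p E⁻¹) ∧
      (QConv.IsOnline p E ∧ QConv.IsOnline p E⁻¹) ∧
      QConv.HasRate S ((k : ℝ) / n) ∧ QConv.HasRate T ((k : ℝ) / n) := by
  open QConv in
  classical
  obtain ⟨E₀, hE₀, J, hZ, hcof⟩ := exists_isZOn hS.comm fun g hg j => hS.shift_mem hg j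
  have hE₀1 := good_of_mem_elementary hE₀ one_pos
  have hE₀shift : ∀ j g, E₀ (Pauli.shift j g) = Pauli.shift j (E₀ g) := by
    simpa using hE₀1.shift
  set S' := S.map E₀.toMonoidHom with hS'
  have hmem : ∀ g ∈ S, E₀ g ∈ S' := fun g hg => ⟨g, hg, rfl⟩
  have hshift' : ∀ g ∈ S', ∀ j, Pauli.shift j g ∈ S' := by
    rintro _ ⟨g, hg, rfl⟩ j
    change Pauli.shift j (E₀ g) ∈ S'
    rw [← hE₀shift]
    exact hmem _ (hS.shift_mem hg j)
  have hcenter' : ∀ c : ZMod 4, Pauli.scalar c ∈ S' → c = 0 := by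
    rintro c ⟨g, hg, hgc⟩
    have : g = Pauli.scalar c := E₀.injective (Eq.trans hgc (hE₀1.scalar c).symm)
    exact hS.center c (this ▸ hg)
  obtain ⟨χ, hχ, hχJ⟩ := exists_sign_character hcenter' hZ
  obtain ⟨p, hp, hper⟩ := exists_period hshift' hcof hχ hχJ
  have hflip := good_flip hp χ hper
  have hgood : Good p (E₀⁻¹ * flip χ) :=
    (good_of_mem_elementary (inv_mem hE₀) hp).mul hp hflip
  have hgood' : Good p (E₀⁻¹ * flip χ)⁻¹ := by
    rw [mul_inv_rev, inv_inv, flip_inv]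
    exact hflip.mul hp (good_of_mem_elementary hE₀ hp)
  set E := E₀⁻¹ * flip χ with hE
  set T := (zGroup J).map E.toMonoidHom with hT
  have hE₀E : ∀ g, E₀ (E g) = flip χ g := fun g => by
    rw [hE, MulAut.mul_apply, MulAut.apply_inv_self]
  -- The character `χ` was built to restore exactly the signs occurring in `S'`, so `flip χ` of the
  -- unsigned product is `g`.
  have hST' : ∀ g ∈ S', ∃ t ∈ zGroup J, flip χ t = g ∧ t.z = g.z := by
    intro g hg
    refine ⟨⟨0, 0, g.z⟩, ⟨rfl, rfl, (hZ g hg).2⟩, ?_, rfl⟩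
    rw [flip_apply]
    ext1
    · exact (zero_add _).trans (hχ g hg).symm
    · exact (hZ g hg).1.symm
    · rfl
  have hST : S ≤ T := by
    intro g hg
    obtain ⟨t, ht, htg, -⟩ := hST' _ (hmem g hg)
    refine ⟨t, ht, E₀.injective ?_⟩
    change E₀ (E t) = E₀ g
    rw [hE₀E, htg]
  have hcard : Jᶜ.card = n - J.card := by rw [Finset.card_compl, Fintype.card_fin]
  have hJn : J.card ≤ n := by simpa using Finset.card_le_univ J
  -- The input qubits use the streams outside `J`; thus `k = n - |J|`.
  let e : Fin (n - J.card) ↪ Fin n := (Jᶜ.orderEmbOfFin hcard).toEmbedding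
  have he : ∀ i, i ∈ J ↔ i ∉ Set.range e := by
    intro i
    have : Set.range e = ((Jᶜ : Finset (Fin n)) : Set (Fin n)) :=
      Finset.range_orderEmbOfFin Jᶜ hcard
    rw [this]
    simp
  obtain ⟨ρ, hρ⟩ := hgood.spread
  obtain ⟨ρ', hρ'⟩ := hgood'.spread
  have hfinT : ∀ N, Finite (window T N) := fun N => (finite_window_of_hasSpread hρ' N).1
  obtain ⟨C, hC⟩ := exists_abs_logb_card_window_le (J := J) hρ hρ'
  have hmemS : ∀ g, E₀ g ∈ S' → g ∈ S := by
    rintro g ⟨g', hg', e⟩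
    rw [← E₀.injective e]
    exact hg'
  obtain ⟨c, hc0, hc⟩ := exists_card_window_le_mul hmemS hE₀E hST' hcof fun N =>
    have := hfinT N
    Finite.Set.subset (window T N) fun g hg => ⟨hST hg.1, hg.2⟩
  refine ⟨p, T, n - J.card, e, E, hp, isConvolutional_map_zGroup J hp hgood, ?_, ?_,
    isEncoder_map_zGroup e he hgood.scalar, ⟨hgood.nonCatastrophic, hgood'.nonCatastrophic⟩,
    ⟨hgood.shiftInvariant, hgood'.shiftInvariant⟩, ⟨hgood.online, hgood'.online⟩,
    hasRate_of_abs_sub_le hJn (abs_logb_card_window_le_of_le hST hfinT hc0 hc hC),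
    hasRate_of_abs_sub_le hJn hC⟩
  · rintro _ ⟨t, ht, rfl⟩ j
    -- `E₀` commutes with all shifts, but `flip χ` only with those by multiples of `p`. The
    -- correction is the change of the sign under the shift.
    refine ⟨signPhase (χ (shiftLabel j t.z)) - signPhase (χ t.z), Pauli.shift j t,
      shift_mem_zGroup ht j, E₀.injective ?_⟩
    change E₀ (E _) = E₀ (_ * Pauli.shift j (E t))
    rw [hE₀E, map_mul, hE₀1.scalar, hE₀shift, hE₀E, Pauli.scalar_mul, flip_apply, flip_apply]
    ext1
    · simp only [Pauli.shift_phase, Pauli.shift_z']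
      ring
    · rfl
    · rfl
  · rintro ω ⟨hω, hfix⟩
    exact ⟨hω, fun g hg => hfix g (hST hg)⟩
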